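/- Let $n\ge 3$ be an integer, let $0^\circ<\theta<180^\circ$, put $\alpha=90^\circ-\frac{180^\circ}{n}$, and let $\delta\in(0^\circ,180^\circ)$ be the angle with $\tan\delta=\dfrac{\sin\theta}{\tan\alpha-\cos\theta}$ ($\delta=90^\circ$ if the denominator vanishes). Consider simple pentagons $ABCDE$ (straight or reflex angles at vertices are allowed) with interior angles $$A=\tfrac{360^\circ}{n},\quad B=90^\circ+\theta,\quad C=180^\circ-\tfrac{360^\circ}{n},\quad D=\delta+\tfrac{180^\circ}{n},\quad E=270^\circ-\theta-\delta-\tfrac{180^\circ}{n}$$ and with four equal edges $AB=BC=CD=EA$. Such pentagons exist, and for every such pentagon $P$ there are a monohedral tiling $\mathcal T$ of the plane (a family of congruent copies of $P$, reflected copies being allowed, that covers the plane and whose members have pairwise disjoint interiors) and a point $O$ such that: 1. $\mathcal T$ has $n$-fold rotational symmetry with point group $C_n$ at $O$: the isometries of the plane that fix $O$ and map $\mathcal T$ to itself are exactly the $n$ rotations about $O$ through multiples of $\frac{360^\circ}{n}$ (in particular there is no reflection axis through $O$). 2. Exactly $n$ tiles contain $O$, and each of them has its vertex $A$ at $O$.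 3. If $n\neq 4$, no reflection in any line maps $\mathcal T$ to itself. 4. If $P$ is a convex pentagon (with no straight angle), then $\mathcal T$ is edge-to-edge: any two different tiles are disjoint, or share exactly one point, which is a vertex of both, or share exactly one segment, which is an entire edge of both. This covers the cases in which $P$ is convex, in which it degenerates to a trapezoid ($E=180^\circ$, or $D=180^\circ$ when $n=3$) or a parallelogram ($B=180^\circ$), and in which it is concave. -/

import Mathlib

noncomputable section

namespace PentagonTiling

/-! The Euclidean plane is `ℂ`. A pentagon is given by its vertices `V 0, …, V 4`, in cyclic order
(indices are taken modulo `5`), which play the roles of `A, B, C, D, E`. -/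

/-- The `i`-th edge, from `V i` to `V (i + 1)`: the edges are `AB, BC, CD, DE, EA`. -/
def edge (V : Fin 5 → ℂ) (i : Fin 5) : Set ℂ := segment ℝ (V i) (V (i + 1))

/-- The closed polygonal curve formed by the five edges. -/
def boundary (V : Fin 5 → ℂ) : Set ℂ := ⋃ i, edge V i

/-- The closed polygonal curve is simple: consecutive edges meet in their common endpoint only and
non-consecutive edges are disjoint. Straight angles at a vertex are allowed. -/
structure IsSimplePentagon (V : Fin 5 → ℂ) : Prop where
  injective : Function.Injective V
  consecutive : ∀ i, edge V i ∩ edge V (i + 1) = {V (i + 1)}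
  nonconsecutive : ∀ i, Disjoint (edge V i) (edge V (i + 2))

/-- The closed region bounded by the pentagon: the curve together with all points that it separates
from infinity. -/
def region (V : Fin 5 → ℂ) : Set ℂ :=
  boundary V ∪
    {z | z ∉ boundary V ∧ Bornology.IsBounded (connectedComponentIn (boundary V)ᶜ z)}

/-- The interior angles (possibly reflex) of the simple pentagon `V` at its vertices are
`φ 0, …, φ 4`. Turning the ray from `V i` to the next vertex by `φ i`, counterclockwise if the
vertices are listed counterclockwise (`ε = 1`) and clockwise otherwise (`ε = -1`), gives the ray
to the previous vertex. The angle sum `3 * π` singles out the interior angles among these data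
(the exterior ones have sum `7 * π`). -/
def HasInteriorAngles (V : Fin 5 → ℂ) (φ : Fin 5 → ℝ) : Prop :=
  (∀ i, 0 < φ i ∧ φ i < 2 * Real.pi) ∧ ∑ i, φ i = 3 * Real.pi ∧
    ∃ ε : ℝ, (ε = 1 ∨ ε = -1) ∧ ∀ i, ∃ r : ℝ, 0 < r ∧
      V (i - 1) - V i = r * Complex.exp ((ε * φ i : ℝ) * Complex.I) * (V (i + 1) - V i)

/-- The angle `δ = arctan (sin θ / (tan α - cos θ))`, where `α = π / 2 - π / n`, on the branch with
values in `(0, π)` for `0 < θ < π`: it is the angle `BDE` of the triangle `BDE`. -/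
def delta (n : ℕ) (θ : ℝ) : ℝ :=
  Complex.arg ⟨Real.tan (Real.pi / 2 - Real.pi / n) - Real.cos θ, Real.sin θ⟩

/-- The simple pentagon `V = ABCDE` has the interior angles
`A = 2π/n`, `B = π/2 + θ`, `C = π - 2π/n`, `D = δ + π/n`, `E = 3π/2 - θ - δ - π/n`
and the four equal edges `AB = BC = CD = EA`. -/
structure SatisfiesConditions (n : ℕ) (θ : ℝ) (V : Fin 5 → ℂ) : Prop where
  simple : IsSimplePentagon V
  angles : HasInteriorAngles V
    ![2 * Real.pi / n,
      Real.pi / 2 + θ,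
      Real.pi - 2 * Real.pi / n,
      delta n θ + Real.pi / n,
      3 * Real.pi / 2 - θ - delta n θ - Real.pi / n]
  AB_eq_BC : dist (V 0) (V 1) = dist (V 1) (V 2)
  BC_eq_CD : dist (V 1) (V 2) = dist (V 2) (V 3)
  CD_eq_EA : dist (V 2) (V 3) = dist (V 4) (V 0)

/-- A genuine convex pentagon: the region is convex and no vertex lies in the convex hull of the
other ones (so there are no straight angles). -/
def IsConvexPentagon (V : Fin 5 → ℂ) : Prop :=
  Convex ℝ (region V) ∧ ConvexIndependent ℝ V

/-- `𝒯` is a monohedral tiling of the plane with prototile the pentagon `V`: every tile is the image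
of the pentagon under an isometry (possibly a reflection), the tiles cover the plane, and different
tiles have disjoint interiors. -/
structure IsMonohedralTiling (V : Fin 5 → ℂ) (𝒯 : Set (Set ℂ)) : Prop where
  congruent : ∀ T ∈ 𝒯, ∃ g : ℂ ≃ᵢ ℂ, T = g '' region V
  covers : ⋃₀ 𝒯 = Set.univ
  disjoint_interiors : ∀ T ∈ 𝒯, ∀ T' ∈ 𝒯, T ≠ T' → Disjoint (interior T) (interior T')

/-- Any two different tiles (copies of the pentagon `V`) are disjoint, or share exactly one point,
which is a vertex of both, or share exactly one segment, which is an entire edge of both. -/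
def IsEdgeToEdge (V : Fin 5 → ℂ) (𝒯 : Set (Set ℂ)) : Prop :=
  ∀ T ∈ 𝒯, ∀ T' ∈ 𝒯, T ≠ T' → ∃ g h : ℂ ≃ᵢ ℂ, T = g '' region V ∧ T' = h '' region V ∧
    (T ∩ T' = ∅ ∨
      (∃ i j, T ∩ T' = {g (V i)} ∧ T ∩ T' = {h (V j)}) ∨
      (∃ i j, T ∩ T' = edge (g ∘ V) i ∧ T ∩ T' = edge (h ∘ V) j))

/-- The isometry `g` maps the tiling `𝒯` onto itself. -/
def IsSymmetry (g : ℂ ≃ᵢ ℂ) (𝒯 : Set (Set ℂ)) : Prop :=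
  (fun T : Set ℂ => g '' T) '' 𝒯 = 𝒯

/-- `g` is the rotation about `O` through the angle `φ`. -/
def IsRotation (g : ℂ ≃ᵢ ℂ) (O : ℂ) (φ : ℝ) : Prop :=
  ∀ z, g z = O + Complex.exp (φ * Complex.I) * (z - O)

/-- `g` is the reflection in some line (through a point `p`, with unit direction vector `u`). -/
def IsLineReflection (g : ℂ ≃ᵢ ℂ) : Prop :=
  ∃ p u : ℂ, ‖u‖ = 1 ∧ ∀ z, g z = p + u ^ 2 * (starRingEnd ℂ) (z - p)

/-- The point group of `𝒯` at `O` is the cyclic group `C_n`: the isometries that fix `O` and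
preserve `𝒯` are precisely the rotations about `O` through the multiples of `2π/n`. -/
def HasCnSymmetryAt (n : ℕ) (O : ℂ) (𝒯 : Set (Set ℂ)) : Prop :=
  ∀ g : ℂ ≃ᵢ ℂ, (g O = O ∧ IsSymmetry g 𝒯) ↔ ∃ k : ℕ, IsRotation g O (2 * Real.pi * k / n)

end PentagonTiling

end

/-!
The plane is `ℂ`. The conditions determine the pentagon `A B C D E` up to similarity: in normal
position, with `A = 0`, its edges `AB`, `BC`, `CD`, `AE` are `a`, `a w`, `b w`, `b`, where
`a = r exp (-i π / n)`, `b = r exp (i π / n)` and `w = exp (i (π / 2 - θ))`. Only `‖w‖ = 1` and `0 < Re w`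
matter for the tiling (`Shape`), so that convex, concave and degenerate pentagons need no separate
treatment. The diagonals from `B` cut the pentagon into three counterclockwise triangles, and its
region is their union (`region_eq_fan`).

The tiling comes from the tiling of the plane by rhombi with angles `2 π / n` and `π - 2 π / n` that
has `n` sectors around `O = 0`; the sector `k` is the one between the directions
`exp (2 π i k / n) (1 + w) a` and `exp (2 π i k / n) (1 + w) b`. Every edge of a rhombus is replaced by a bent edge
made of two congruent pieces, `a` and `a w` in one direction or `b` and `b w` in the other one, in
an order that alternates like the colours of a chessboard. The rhombus then becomes an octagon,
which a segment `DE` cuts into two pentagons that are images of each other under a half-turn; in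
every other rhombus they are mirror images of the prototile (`vtx_even`, `vtx_odd`).

That these pentagons tile is shown by counting. For a point `z` on no line through two vertices of a
tile, the winding number of the boundary of a tile about `z` counts the triangles of the tile that
contain `z` (`sight_tile`). Summed over the rhombi `i, j < N` of all sectors, the contributions of
the inner bent edges cancel, and what remains is the winding number of the outer boundary, which is
`1` as soon as `N` is large (`eventually_patch_eq_one`). Thus a generic point lies in exactly one
tile (`existsUnique_mem_tile`), and the tiling property follows by density. Moreover, if some given
tiles cover a neighbourhood of a point, then no other tile contains that point
(`mem_of_eventually_mem`); this reduces all questions about the tiles at a point to exhibiting a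
star of triangles around it. The centre lies in the `n` corners `A` of the innermost tiles, every
other vertex of the rhombus tiling in four tiles (`ncard_lat`), and an apex of a bent edge in three
(`ApexStar`).

A symmetry that fixes the centre is, up to one of the `n` rotations, a symmetry of the prototile
that fixes `A`. The only candidate besides the identity is the reflection in the bisector at `A`,
and it is excluded by looking at where it can send the convex corner `C` (`conj_region_ne`). If
`n ≠ 4`, every symmetry fixes the centre, because the numbers of tiles at the vertices differ; for `n =
3` a comparison of distances is needed in addition (`map_zero_of_isSymmetry`). Hence no reflection
is a symmetry. In the convex case the tiling is edge-to-edge because every edge of a tile is also an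
edge of another tile (`exists_neighbour`), so that a common inner point of an edge forces a common
edge.
-/

noncomputable section
namespace PentagonTiling
open Complex Filter Topology
open scoped ComplexConjugate

/-! ### Orientation, triangles and stars -/

/-- Twice the signed area of the triangle `P Q R`; positive when it is counterclockwise. -/
def orient (P Q R : ℂ) : ℝ := (Q.re - P.re) * (R.im - P.im) - (Q.im - P.im) * (R.re - P.re)

theorem orient_rotate (P Q R : ℂ) : orient Q R P = orient P Q R := by
  unfold orient; ring

theorem orient_swap (P Q R : ℂ) : orient P R Q = -orient P Q R := by
  unfold orient; ring

theorem orient_split (z P Q R : ℂ) :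
    orient z P Q + orient z Q R + orient z R P = orient P Q R := by
  unfold orient; ring

@[fun_prop]
theorem continuous_orient_left (P Q : ℂ) : Continuous fun z => orient z P Q := by
  unfold orient; fun_prop

/-- The closed triangle with vertices `P`, `Q`, `R`. -/
def tri (P Q R : ℂ) : Set ℂ := convexHull ℝ {P, Q, R}

theorem mem_tri_iff_exists {P Q R z : ℂ} :
    z ∈ tri P Q R ↔ ∃ α β γ : ℝ, 0 ≤ α ∧ 0 ≤ β ∧ 0 ≤ γ ∧ α + β + γ = 1 ∧
      z = α * P + β * Q + γ * R := by
  unfold tri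
  rw [convexHull_insert (by simp), convexHull_pair, mem_convexJoin]
  constructor
  · rintro ⟨x, rfl, y, ⟨u, v, hu, hv, huv, rfl⟩, s, t, hs, ht, hst, rfl⟩
    refine ⟨s, t * u, t * v, hs, by positivity, by positivity, ?_, ?_⟩
    · rw [add_assoc, ← mul_add, huv, mul_one, hst]
    · simp [real_smul]; ring
  · rintro ⟨α, β, γ, hα, hβ, hγ, hs, rfl⟩
    refine ⟨P, rfl, ?_⟩
    rcases eq_or_lt_of_le (add_nonneg hβ hγ) with h | h
    · refine ⟨Q, left_mem_segment _ _ _, ?_⟩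
      have hβ0 : β = 0 := by linarith
      have hγ0 : γ = 0 := by linarith
      have hα1 : α = 1 := by linarith
      subst hβ0 hγ0 hα1
      simpa using left_mem_segment ℝ P Q
    · refine ⟨(β / (β + γ) : ℝ) • Q + (γ / (β + γ) : ℝ) • R,
        ⟨_, _, by positivity, by positivity, by field_simp, rfl⟩, α, β + γ, hα, h.le,
        by linarith, ?_⟩
      have h' : ((β : ℂ) + γ) ≠ 0 := by exact_mod_cast h.ne'
      simp only [real_smul, ofReal_div, ofReal_add]
      field_simp
      ring

theorem mem_tri_iff {P Q R z : ℂ} (h : 0 < orient P Q R) :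
    z ∈ tri P Q R ↔ 0 ≤ orient z P Q ∧ 0 ≤ orient z Q R ∧ 0 ≤ orient z R P := by
  rw [mem_tri_iff_exists]
  constructor
  · rintro ⟨α, β, γ, hα, hβ, hγ, hs, rfl⟩
    have e : α = 1 - β - γ := by linarith
    have h1 : orient (α * P + β * Q + γ * R) P Q = γ * orient P Q R := by
      subst e; simp [orient]; ring
    have h2 : orient (α * P + β * Q + γ * R) Q R = α * orient P Q R := by
      subst e; simp [orient]; ring
    have h3 : orient (α * P + β * Q + γ * R) R P = β * orient P Q R := by
      subst e; simp [orient]; ring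
    rw [h1, h2, h3]
    exact ⟨by positivity, by positivity, by positivity⟩
  · rintro ⟨h1, h2, h3⟩
    refine ⟨orient z Q R / orient P Q R, orient z R P / orient P Q R, orient z P Q / orient P Q R,
      by positivity, by positivity, by positivity, ?_, ?_⟩
    · field_simp
      linarith [orient_split z P Q R]
    · have h' : orient P Q R ≠ 0 := h.ne'
      apply Complex.ext <;>
      · simp
        field_simp
        unfold orient
        ring

theorem tri_subset {s : Set ℂ} (hs : Convex ℝ s) {P Q R : ℂ} (hP : P ∈ s) (hQ : Q ∈ s)
    (hR : R ∈ s) : tri P Q R ⊆ s := by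
  have h : ({P, Q, R} : Set ℂ) ⊆ s := by rintro x (rfl | rfl | rfl) <;> assumption
  exact convexHull_min h hs

theorem convex_tri (P Q R : ℂ) : Convex ℝ (tri P Q R) := convex_convexHull _ _

theorem left_mem_tri (P Q R : ℂ) : P ∈ tri P Q R := subset_convexHull _ _ (by simp)
theorem mid_mem_tri (P Q R : ℂ) : Q ∈ tri P Q R := subset_convexHull _ _ (by simp)
theorem right_mem_tri (P Q R : ℂ) : R ∈ tri P Q R := subset_convexHull _ _ (by simp)

theorem tri_rotate (P Q R : ℂ) : tri Q R P = tri P Q R := by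
  unfold tri; congr 1; ext; simp; tauto

theorem tri_swap (P Q R : ℂ) : tri P R Q = tri P Q R := by
  unfold tri; congr 1; ext; simp; tauto

theorem isCompact_tri (P Q R : ℂ) : IsCompact (tri P Q R) :=
  (Set.toFinite _).isCompact_convexHull ℝ

/-- If each ray from `p` through `r i` turns counterclockwise, by less than `π`, into the ray
through `r (σ i)`, then every point lies in one of the cones spanned by such pairs of rays: on a
side of the line through `p` and `z` the turning would strictly change a cotangent for ever. -/
theorem exists_cone {ι : Type*} [Finite ι] [Nonempty ι] (σ : ι → ι) (r : ι → ℂ) (p z : ℂ)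
    (h : ∀ i, 0 < orient p (r i) (r (σ i))) :
    ∃ i, 0 ≤ orient p (r i) z ∧ 0 ≤ orient p z (r (σ i)) := by
  by_contra! hc
  have step : ∀ i, 0 ≤ orient p (r i) z → 0 < orient p (r (σ i)) z := by
    intro i hi
    have := hc i hi
    rw [orient_swap] at this
    linarith
  have hz : 0 < (z.re - p.re) ^ 2 + (z.im - p.im) ^ 2 := by
    by_contra! h0
    have h1 : z.re - p.re = 0 := by nlinarith [sq_nonneg (z.re - p.re), sq_nonneg (z.im - p.im)]
    have h2 : z.im - p.im = 0 := by nlinarith [sq_nonneg (z.re - p.re), sq_nonneg (z.im - p.im)]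
    obtain ⟨i⟩ := ‹Nonempty ι›
    have h3 := step i (by simp [orient, h1, h2])
    simp [orient, h1, h2] at h3
  let d : ι → ℝ := fun i =>
    -(((r i).re - p.re) * (z.re - p.re) + ((r i).im - p.im) * (z.im - p.im))
  let t : ι → ℝ := fun i => d i / orient p (r i) z
  have key : ∀ i, 0 < orient p (r i) z * orient p (r (σ i)) z → t (σ i) < t i := by
    intro i hi
    have hi1 : orient p (r i) z ≠ 0 := fun h => by simp [h] at hi
    have hi2 : orient p (r (σ i)) z ≠ 0 := fun h => by simp [h] at hi
    have : t i - t (σ i) = ((z.re - p.re) ^ 2 + (z.im - p.im) ^ 2) * orient p (r i) (r (σ i)) /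
        (orient p (r i) z * orient p (r (σ i)) z) := by
      simp only [t, d]
      field_simp
      unfold orient
      ring
    have h4 : 0 < t i - t (σ i) := by
      rw [this]; have := h i; positivity
    linarith
  by_cases hA : ∃ i, 0 ≤ orient p (r i) z
  · obtain ⟨i₀, h0⟩ := hA
    obtain ⟨i, hi, hmin⟩ := (Set.toFinite {i | 0 < orient p (r i) z}).exists_minimalFor t _
      ⟨σ i₀, step i₀ h0⟩
    have hs := step i (le_of_lt hi)
    have h5 := key i (mul_pos hi hs)
    exact absurd (hmin hs h5.le) (not_le.2 h5)
  · push Not at hA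
    obtain ⟨i, hmin⟩ := Finite.exists_min t
    have h5 := key i (mul_pos_of_neg_of_neg (hA i) (hA _))
    exact absurd (hmin (σ i)) (not_le.2 h5)

theorem eventually_mem_star {ι : Type*} [Finite ι] [Nonempty ι] (σ : ι → ι) (r : ι → ℂ) (p : ℂ)
    (h : ∀ i, 0 < orient p (r i) (r (σ i))) :
    ∀ᶠ z in 𝓝 p, ∃ i, z ∈ tri p (r i) (r (σ i)) := by
  have : ∀ᶠ z in 𝓝 p, ∀ i, 0 < orient z (r i) (r (σ i)) := by
    rw [eventually_all]
    intro i
    exact (continuous_orient_left _ _).continuousAt.eventually_const_lt (h i)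
  filter_upwards [this] with z hz
  obtain ⟨i, h1, h2⟩ := exists_cone σ r p z h
  refine ⟨i, (mem_tri_iff (h i)).2 ⟨?_, (hz i).le, ?_⟩⟩
  · rwa [← orient_rotate z p]
  · rwa [orient_rotate p z]

/-- The clockwise counterpart of `eventually_mem_star` is covered as well: only the common sign
`ε` of all turns matters. -/
theorem eventually_mem_star_of_sign {ι : Type*} [Finite ι] [Nonempty ι] (σ : Equiv.Perm ι)
    (r : ι → ℂ) (p : ℂ) {ε : ℝ} (h : ∀ i, 0 < ε * orient p (r i) (r (σ i))) :
    ∀ᶠ z in 𝓝 p, ∃ i, z ∈ tri p (r i) (r (σ i)) := by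
  rcases lt_trichotomy ε 0 with hε | rfl | hε
  · have := eventually_mem_star σ.symm r p (fun i => by
      have := h (σ.symm i)
      rw [Equiv.apply_symm_apply, orient_swap] at this
      nlinarith)
    filter_upwards [this] with z ⟨i, hi⟩
    exact ⟨σ.symm i, by rwa [Equiv.apply_symm_apply, tri_swap]⟩
  · simp at h
  · exact eventually_mem_star σ r p fun i => pos_of_mul_pos_right (h i) hε.le

/-! ### Winding angles -/

/-- The angle, in `(-π, π]`, under which the oriented segment from `P` to `Q` is seen from `z`. -/
def sight (z P Q : ℂ) : ℝ := arg ((Q - z) / (P - z))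

theorem ne_of_orient_ne {z P Q : ℂ} (h : orient z P Q ≠ 0) : P - z ≠ 0 ∧ Q - z ≠ 0 := by
  constructor <;> intro h0 <;> rw [sub_eq_zero] at h0 <;> subst h0 <;> simp [orient] at h

theorem im_div_eq (z P Q : ℂ) :
    ((Q - z) / (P - z)).im = orient z P Q / normSq (P - z) := by
  rw [div_im]; simp [orient]; ring

theorem sight_swap {z P Q : ℂ} (h : orient z P Q ≠ 0) : sight z Q P = -sight z P Q := by
  have h1 := ne_of_orient_ne h
  unfold sight
  rw [← inv_div, arg_inv, if_neg]
  rw [arg_eq_pi_iff]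
  rintro ⟨-, h2⟩
  rw [im_div_eq, div_eq_zero_iff] at h2
  rcases h2 with h2 | h2
  · exact h h2
  · exact h1.1 (normSq_eq_zero.1 h2)

theorem sight_pos {z P Q : ℂ} (h : 0 < orient z P Q) : 0 < sight z P Q ∧ sight z P Q < Real.pi := by
  have h1 := ne_of_orient_ne h.ne'
  have h2 : 0 < ((Q - z) / (P - z)).im := by
    rw [im_div_eq]; exact div_pos h (normSq_pos.2 h1.1)
  refine ⟨lt_of_le_of_ne (arg_nonneg_iff.2 h2.le) fun h0 => ?_, arg_lt_pi_iff.2 (Or.inr h2.ne')⟩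
  exact h2.ne' (arg_eq_zero_iff.1 h0.symm).2

theorem sight_neg {z P Q : ℂ} (h : orient z P Q < 0) :
    -Real.pi < sight z P Q ∧ sight z P Q < 0 := by
  have h1 : 0 < orient z Q P := by rw [orient_swap]; linarith
  have := sight_pos h1
  rw [sight_swap h.ne] at this
  constructor <;> linarith

theorem sight_triangle_int {z P Q R : ℂ} (hP : P - z ≠ 0) (hQ : Q - z ≠ 0) (hR : R - z ≠ 0) :
    ∃ m : ℤ, sight z P Q + sight z Q R + sight z R P = m * (2 * Real.pi) := by
  have h1 : ((sight z P Q + sight z Q R + sight z R P : ℝ) : Real.Angle) = 0 := by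
    unfold sight
    rw [Real.Angle.coe_add, Real.Angle.coe_add,
      ← arg_mul_coe_angle (div_ne_zero hQ hP) (div_ne_zero hR hQ),
      ← arg_mul_coe_angle (mul_ne_zero (div_ne_zero hQ hP) (div_ne_zero hR hQ))
        (div_ne_zero hP hR)]
    have : (Q - z) / (P - z) * ((R - z) / (Q - z)) * ((P - z) / (R - z)) = 1 := by field_simp
    rw [this]; simp
  obtain ⟨m, hm⟩ := Real.Angle.coe_eq_zero_iff.1 h1
  exact ⟨m, by rw [← hm]; simp⟩

/-- The winding number of a counterclockwise triangle is the indicator function of the triangle,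
off the lines that contain its edges. -/
theorem sight_triangle {z P Q R : ℂ} (h : 0 < orient P Q R) (hP : orient z P Q ≠ 0)
    (hQ : orient z Q R ≠ 0) (hR : orient z R P ≠ 0) :
    sight z P Q + sight z Q R + sight z R P =
      2 * Real.pi * (tri P Q R).indicator 1 z := by
  obtain ⟨m, hm⟩ := sight_triangle_int (ne_of_orient_ne hP).1 (ne_of_orient_ne hQ).1
    (ne_of_orient_ne hR).1
  have hs := orient_split z P Q R
  rw [hm]
  by_cases hz : z ∈ tri P Q R
  · have := (mem_tri_iff h).1 hz
    have h1 := sight_pos (lt_of_le_of_ne this.1 hP.symm)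
    have h2 := sight_pos (lt_of_le_of_ne this.2.1 hQ.symm)
    have h3 := sight_pos (lt_of_le_of_ne this.2.2 hR.symm)
    have l1 : (0 : ℝ) < m := by nlinarith
    have l2 : (m : ℝ) < 2 := by nlinarith
    have l1' : 0 < m := by exact_mod_cast l1
    have l2' : m < 2 := by exact_mod_cast l2
    have : m = 1 := by omega
    subst this
    simp [Set.indicator_of_mem hz]
  · rw [Set.indicator_of_notMem hz, mul_zero]
    have hne : orient z P Q < 0 ∨ orient z Q R < 0 ∨ orient z R P < 0 := by
      by_contra! hc
      exact hz ((mem_tri_iff h).2 hc)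
    have bd : -(2 * Real.pi) < sight z P Q + sight z Q R + sight z R P ∧
        sight z P Q + sight z Q R + sight z R P < 2 * Real.pi := by
      rcases lt_or_gt_of_ne hP with a1 | a1 <;> rcases lt_or_gt_of_ne hQ with a2 | a2 <;>
        rcases lt_or_gt_of_ne hR with a3 | a3 <;> first
        | (exfalso; linarith)
        | (exfalso; rcases hne with h | h | h <;> linarith)
        | (have b1 := (by first | exact sight_pos a1 | exact sight_neg a1 :
              _ < sight z P Q ∧ sight z P Q < _)
           have b2 := (by first | exact sight_pos a2 | exact sight_neg a2 :
              _ < sight z Q R ∧ sight z Q R < _)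
           have b3 := (by first | exact sight_pos a3 | exact sight_neg a3 :
              _ < sight z R P ∧ sight z R P < _)
           constructor <;> linarith [b1.1, b1.2, b2.1, b2.2, b3.1, b3.2])
    rw [hm] at bd
    have l1 : (-1 : ℝ) < m := by nlinarith
    have l2 : (m : ℝ) < 1 := by nlinarith
    have l1' : -1 < m := by exact_mod_cast l1
    have l2' : m < 1 := by exact_mod_cast l2
    have : m = 0 := by omega
    simp [this]

/-- Seen from a point `z` such that `P` and `Q` lie in the open half plane `z + {x | 0 < ⟪x, u⟫}`,
the angle of the segment is a difference of arguments relative to `u`. -/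
theorem sight_eq_sub {z P Q u : ℂ} (hP : 0 < ((P - z) / u).re) (hQ : 0 < ((Q - z) / u).re) :
    sight z P Q = arg ((Q - z) / u) - arg ((P - z) / u) := by
  have hu : u ≠ 0 := by rintro rfl; simp at hP
  have hP' : P - z ≠ 0 := by intro h; simp [h] at hP
  have e : (Q - z) / (P - z) = ((Q - z) / u) * ((P - z) / u)⁻¹ := by field_simp
  have h1 := abs_lt.1 (abs_arg_lt_pi_div_two_iff.2 (Or.inl hP))
  have h2 := abs_lt.1 (abs_arg_lt_pi_div_two_iff.2 (Or.inl hQ))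
  have h3 : arg ((P - z) / u)⁻¹ = -arg ((P - z) / u) := by
    rw [arg_inv, if_neg]; linarith
  unfold sight
  have hQ' : (Q - z) / u ≠ 0 := by intro h; rw [h] at hQ; simp at hQ
  rw [e, arg_mul hQ' (inv_ne_zero (div_ne_zero hP' hu)), h3]
  · ring
  · rw [h3]; constructor <;> linarith

/-! ### The region of a pentagon that is a fan of triangles -/

theorem mem_segment_of_orient_eq_zero {P Q R z : ℂ} (h : 0 < orient P Q R) (hz : z ∈ tri P Q R)
    (h0 : orient z P Q = 0) : z ∈ segment ℝ P Q := by
  obtain ⟨α, β, γ, hα, hβ, hγ, hs, rfl⟩ := mem_tri_iff_exists.1 hz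
  have e : α = 1 - β - γ := by linarith
  have h1 : orient (α * P + β * Q + γ * R) P Q = γ * orient P Q R := by
    subst e; simp [orient]; ring
  rw [h1, mul_eq_zero, or_iff_left h.ne'] at h0
  subst h0
  exact ⟨α, β, hα, hβ, by linarith, by simp⟩

theorem eventually_mem_tri {P Q R z : ℂ} (h : 0 < orient P Q R) (h1 : 0 < orient z P Q)
    (h2 : 0 < orient z Q R) (h3 : 0 < orient z R P) : ∀ᶠ x in 𝓝 z, x ∈ tri P Q R := by
  filter_upwards [(continuous_orient_left P Q).continuousAt.eventually_const_lt h1,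
    (continuous_orient_left Q R).continuousAt.eventually_const_lt h2,
    (continuous_orient_left R P).continuousAt.eventually_const_lt h3] with x a1 a2 a3
  exact (mem_tri_iff h).2 ⟨a1.le, a2.le, a3.le⟩

theorem segment_subset_tri (P Q R : ℂ) : segment ℝ P Q ⊆ tri P Q R :=
  (convex_tri P Q R).segment_subset (left_mem_tri _ _ _) (mid_mem_tri _ _ _)

theorem orient_self_left (P Q : ℂ) : orient P P Q = 0 := by simp [orient]
theorem orient_self_right (P Q : ℂ) : orient P Q Q = 0 := by simp [orient]; ring
theorem orient_self_outer (P Q : ℂ) : orient P Q P = 0 := by simp [orient]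

/-- Two triangles on the two sides of a common edge cover a neighbourhood of each inner point of
that edge. -/
theorem eventually_mem_tri_or_tri {P Q R S p : ℂ} (hR : 0 < orient P R Q) (hS : 0 < orient P Q S)
    (hp : p ∈ segment ℝ P Q) (hpP : p ≠ P) (hpQ : p ≠ Q) :
    ∀ᶠ z in 𝓝 p, z ∈ tri P R Q ∨ z ∈ tri P Q S := by
  obtain ⟨α, β, hα, hβ, hs, rfl⟩ := hp
  have hα' : 0 < α := hα.lt_of_ne (by rintro rfl; apply hpQ; simp at hs; simp [hs])
  have hβ' : 0 < β := hβ.lt_of_ne (by rintro rfl; apply hpP; simp at hs; simp [hs])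
  have e : α = 1 - β := by linarith
  have hmem : α • P + β • Q ∈ segment ℝ P Q := ⟨α, β, hα, hβ, hs, rfl⟩
  have h1 : α • P + β • Q ∈ tri P R Q := by
    rw [← tri_swap]; exact segment_subset_tri P Q R hmem
  have h2 : α • P + β • Q ∈ tri P Q S := segment_subset_tri P Q S hmem
  have := eventually_mem_star (fun i : Fin 4 => i + 1) ![P, R, Q, S] (α • P + β • Q) (by
    have q1 : orient (α • P + β • Q) P R = β * orient P R Q := by
      subst e; simp [orient]; ring
    have q2 : orient (α • P + β • Q) R Q = α * orient P R Q := by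
      subst e; simp [orient]; ring
    have q3 : orient (α • P + β • Q) Q S = α * orient P Q S := by
      subst e; simp [orient]; ring
    have q4 : orient (α • P + β • Q) S P = β * orient P Q S := by
      subst e; simp [orient]; ring
    intro i
    fin_cases i
    · simpa using q1 ▸ mul_pos hβ' hR
    · simpa using q2 ▸ mul_pos hα' hR
    · simpa using q3 ▸ mul_pos hα' hS
    · simpa using q4 ▸ mul_pos hβ' hS)
  filter_upwards [this] with z hz
  obtain ⟨i, hi⟩ := hz
  fin_cases i
  · exact Or.inl (tri_subset (convex_tri _ _ _) h1 (left_mem_tri _ _ _) (mid_mem_tri _ _ _) hi)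
  · exact Or.inl (tri_subset (convex_tri _ _ _) h1 (mid_mem_tri _ _ _) (right_mem_tri _ _ _) hi)
  · exact Or.inr (tri_subset (convex_tri _ _ _) h2 (mid_mem_tri _ _ _) (right_mem_tri _ _ _) hi)
  · exact Or.inr (tri_subset (convex_tri _ _ _) h2 (right_mem_tri _ _ _) (left_mem_tri _ _ _) hi)

/-- The union of the three triangles into which the diagonals from the vertex `B` cut a
pentagon. -/
def fan (V : Fin 5 → ℂ) : Set ℂ :=
  tri (V 1) (V 2) (V 3) ∪ tri (V 1) (V 3) (V 4) ∪ tri (V 1) (V 4) (V 0)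

/-- The three triangles of the fan are counterclockwise. -/
structure IsFan (V : Fin 5 → ℂ) : Prop where
  BCD : 0 < orient (V 1) (V 2) (V 3)
  BDE : 0 < orient (V 1) (V 3) (V 4)
  BEA : 0 < orient (V 1) (V 4) (V 0)

theorem mem_boundary_iff {V : Fin 5 → ℂ} {z : ℂ} : z ∈ boundary V ↔
    z ∈ segment ℝ (V 0) (V 1) ∨ z ∈ segment ℝ (V 1) (V 2) ∨ z ∈ segment ℝ (V 2) (V 3) ∨
      z ∈ segment ℝ (V 3) (V 4) ∨ z ∈ segment ℝ (V 4) (V 0) := by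
  simp only [boundary, Set.mem_iUnion, edge]
  constructor
  · rintro ⟨i, hi⟩
    fin_cases i <;> simp_all
  · rintro (h | h | h | h | h)
    exacts [⟨0, h⟩, ⟨1, h⟩, ⟨2, h⟩, ⟨3, h⟩, ⟨4, h⟩]

theorem isClosed_boundary (V : Fin 5 → ℂ) : IsClosed (boundary V) := by
  refine isClosed_iUnion_of_finite fun i => ?_
  unfold edge
  rw [← convexHull_pair]
  exact ((Set.toFinite _).isCompact_convexHull ℝ).isClosed

theorem isCompact_fan (V : Fin 5 → ℂ) : IsCompact (fan V) :=
  ((isCompact_tri _ _ _).union (isCompact_tri _ _ _)).union (isCompact_tri _ _ _)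

theorem starConvex_fan (V : Fin 5 → ℂ) : StarConvex ℝ (V 1) (fan V) :=
  (((convex_tri _ _ _).starConvex (left_mem_tri _ _ _)).union
    ((convex_tri _ _ _).starConvex (left_mem_tri _ _ _))).union
      ((convex_tri _ _ _).starConvex (left_mem_tri _ _ _))

theorem boundary_subset_fan (V : Fin 5 → ℂ) : boundary V ⊆ fan V := by
  intro z hz
  rcases mem_boundary_iff.1 hz with h | h | h | h | h
  · right; rw [← tri_rotate, ← tri_rotate]; exact segment_subset_tri _ _ _ h
  · left; left; exact segment_subset_tri _ _ _ h
  · left; left; rw [← tri_rotate]; exact segment_subset_tri _ _ _ h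
  · left; right; rw [← tri_rotate]; exact segment_subset_tri _ _ _ h
  · right; rw [← tri_rotate]; exact segment_subset_tri _ _ _ h

theorem fan_mem_nhds {V : Fin 5 → ℂ} (hV : IsFan V) {p : ℂ} (hp : p ∈ fan V)
    (hb : p ∉ boundary V) : fan V ∈ 𝓝 p := by
  rw [mem_boundary_iff] at hb
  push Not at hb
  obtain ⟨b0, b1, b2, b3, b4⟩ := hb
  have ne : ∀ i, p ≠ V i := by
    intro i hi; subst hi
    fin_cases i
    exacts [b0 (left_mem_segment _ _ _), b1 (left_mem_segment _ _ _), b2 (left_mem_segment _ _ _),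
      b3 (left_mem_segment _ _ _), b4 (left_mem_segment _ _ _)]
  have dBD : p ∈ segment ℝ (V 1) (V 3) → fan V ∈ 𝓝 p := fun h => by
    filter_upwards [eventually_mem_tri_or_tri hV.BCD hV.BDE h (ne 1) (ne 3)] with z hz
    exact Or.inl hz
  have dBE : p ∈ segment ℝ (V 1) (V 4) → fan V ∈ 𝓝 p := fun h => by
    filter_upwards [eventually_mem_tri_or_tri hV.BDE hV.BEA h (ne 1) (ne 4)] with z hz
    rcases hz with hz | hz
    · exact Or.inl (Or.inr hz)
    · exact Or.inr hz
  -- A point of a counterclockwise triangle is inside it or on one of the three edges.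
  have main : ∀ {P Q R : ℂ}, 0 < orient P Q R → tri P Q R ⊆ fan V → p ∈ tri P Q R →
      (fan V ∈ 𝓝 p ∨ p ∈ segment ℝ P Q ∨ p ∈ segment ℝ Q R ∨ p ∈ segment ℝ R P) := by
    intro P Q R h hsub hpt
    obtain ⟨h1, h2, h3⟩ := (mem_tri_iff h).1 hpt
    rcases h1.eq_or_lt with e1 | l1
    · exact Or.inr (Or.inl (mem_segment_of_orient_eq_zero h hpt e1.symm))
    rcases h2.eq_or_lt with e2 | l2
    · refine Or.inr (Or.inr (Or.inl (mem_segment_of_orient_eq_zero (R := P) ?_ ?_ e2.symm)))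
      · rwa [orient_rotate]
      · rwa [tri_rotate]
    rcases h3.eq_or_lt with e3 | l3
    · refine Or.inr (Or.inr (Or.inr (mem_segment_of_orient_eq_zero (R := Q) ?_ ?_ e3.symm)))
      · rwa [orient_rotate, orient_rotate]
      · rwa [tri_rotate, tri_rotate]
    left
    filter_upwards [eventually_mem_tri h l1 l2 l3] with x hx
    exact hsub hx
  rcases hp with (hp | hp) | hp
  · rcases main hV.BCD (fun x hx => Or.inl (Or.inl hx)) hp with h | h | h | h
    · exact h
    · exact absurd h b1
    · exact absurd h b2
    · exact dBD (segment_symm ℝ (V 1) (V 3) ▸ h)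
  · rcases main hV.BDE (fun x hx => Or.inl (Or.inr hx)) hp with h | h | h | h
    · exact h
    · exact dBD h
    · exact absurd h b3
    · exact dBE (segment_symm ℝ (V 1) (V 4) ▸ h)
  · rcases main hV.BEA (fun x hx => Or.inr hx) hp with h | h | h | h
    · exact h
    · exact dBE h
    · exact absurd h b4
    · exact absurd h b0

/-- The fan is star-shaped about `B`, so a point outside can escape to infinity along the ray that
points away from `B`; a point inside cannot leave the fan without crossing the boundary. -/
theorem region_eq_fan {V : Fin 5 → ℂ} (hV : IsFan V) : region V = fan V := by
  ext z
  constructor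
  · rintro (h | ⟨hz, hbd⟩)
    · exact boundary_subset_fan V h
    by_contra hzf
    have hz1 : z - V 1 ≠ 0 := by
      intro h0
      rw [sub_eq_zero] at h0
      exact hzf (h0 ▸ Or.inr (left_mem_tri _ _ _))
    let ray : Set ℂ := (fun t : ℝ => V 1 + t • (z - V 1)) '' Set.Ici 1
    have hray : ray ⊆ (fan V)ᶜ := by
      rintro _ ⟨t, ht, rfl⟩ hmem
      apply hzf
      have ht0 : (0 : ℝ) < t := lt_of_lt_of_le one_pos ht
      have := (starConvex_fan V).add_smul_sub_mem hmem (t := t⁻¹) (by positivity)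
        (inv_le_one_of_one_le₀ ht)
      simpa [smul_smul, ht0.ne'] using this
    have hcon : IsPreconnected ray :=
      isPreconnected_Ici.image _ (by fun_prop)
    have hsub : ray ⊆ connectedComponentIn (boundary V)ᶜ z :=
      hcon.subset_connectedComponentIn ⟨1, by simp, by simp⟩
        (hray.trans (Set.compl_subset_compl.2 (boundary_subset_fan V)))
    obtain ⟨M, hM⟩ := (hbd.subset hsub).exists_norm_le
    have hpos : 0 < ‖z - V 1‖ := norm_pos_iff.2 hz1
    have h1 := hM (V 1 + (1 + (|M| + ‖V 1‖ + 1) / ‖z - V 1‖) • (z - V 1))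
      ⟨_, by simp only [Set.mem_Ici, le_add_iff_nonneg_right]; positivity, rfl⟩
    have h2 : ‖(1 + (|M| + ‖V 1‖ + 1) / ‖z - V 1‖) • (z - V 1)‖ =
        ‖z - V 1‖ + (|M| + ‖V 1‖ + 1) := by
      rw [norm_smul, Real.norm_of_nonneg (by positivity)]; field_simp
    have h3 := norm_sub_le (V 1 + (1 + (|M| + ‖V 1‖ + 1) / ‖z - V 1‖) • (z - V 1)) (V 1)
    rw [add_sub_cancel_left, h2] at h3
    linarith [le_abs_self M]
  · intro hz
    by_cases hb : z ∈ boundary V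
    · exact Or.inl hb
    refine Or.inr ⟨hb, (isCompact_fan V).isBounded.subset ?_⟩
    have hopen : IsOpen (fan V \ boundary V) := by
      rw [isOpen_iff_mem_nhds]
      intro p hp
      exact Filter.inter_mem (fan_mem_nhds hV hp.1 hp.2)
        ((isClosed_boundary V).isOpen_compl.mem_nhds hp.2)
    have hpre := isPreconnected_connectedComponentIn (x := z) (F := (boundary V)ᶜ)
    have := hpre.subset_left_of_subset_union
      hopen (isCompact_fan V).isClosed.isOpen_compl
      (Set.disjoint_left.2 fun x hx hx' => hx' hx.1)
      (fun x hx => by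
        have := connectedComponentIn_subset _ _ hx
        by_cases hxf : x ∈ fan V
        · exact Or.inl ⟨hxf, this⟩
        · exact Or.inr hxf)
      ⟨z, mem_connectedComponentIn hb, hz, hb⟩
    exact this.trans Set.sdiff_subset

/-! ### Images under isometries -/

theorem image_segment_isometry (g : ℂ ≃ᵢ ℂ) (x y : ℂ) :
    g '' segment ℝ x y = segment ℝ (g x) (g y) := by
  have := image_segment ℝ (g.toRealAffineIsometryEquiv.toAffineEquiv : ℂ →ᵃ[ℝ] ℂ) x y
  simpa using this

theorem image_convexHull_isometry (g : ℂ ≃ᵢ ℂ) (s : Set ℂ) :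
    g '' convexHull ℝ s = convexHull ℝ (g '' s) := by
  have := (g.toRealAffineIsometryEquiv.toAffineEquiv : ℂ →ᵃ[ℝ] ℂ).image_convexHull s
  simpa using this

theorem image_tri (g : ℂ ≃ᵢ ℂ) (P Q R : ℂ) : g '' tri P Q R = tri (g P) (g Q) (g R) := by
  unfold tri
  rw [image_convexHull_isometry, Set.image_insert_eq, Set.image_pair]

theorem convex_image_isometry (g : ℂ ≃ᵢ ℂ) {s : Set ℂ} (hs : Convex ℝ s) : Convex ℝ (g '' s) := by
  rw [← hs.convexHull_eq, image_convexHull_isometry]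
  exact convex_convexHull _ _

theorem edge_comp (g : ℂ ≃ᵢ ℂ) (V : Fin 5 → ℂ) (i : Fin 5) : edge (g ∘ V) i = g '' edge V i :=
  (image_segment_isometry g _ _).symm

theorem boundary_comp (g : ℂ ≃ᵢ ℂ) (V : Fin 5 → ℂ) : boundary (g ∘ V) = g '' boundary V := by
  simp only [boundary, edge_comp, Set.image_iUnion]

theorem region_comp (g : ℂ ≃ᵢ ℂ) (V : Fin 5 → ℂ) : region (g ∘ V) = g '' region V := by
  have hc : (boundary (g ∘ V))ᶜ = g '' (boundary V)ᶜ := by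
    rw [boundary_comp, Set.image_compl_eq g.bijective]
  have key : ∀ z, z ∉ boundary V →
      connectedComponentIn (boundary (g ∘ V))ᶜ (g z) =
        g '' connectedComponentIn (boundary V)ᶜ z := by
    intro z hz
    rw [hc]
    exact (g.toHomeomorph.image_connectedComponentIn (Set.mem_compl hz)).symm
  have hbd : ∀ s : Set ℂ, Bornology.IsBounded (g '' s) ↔ Bornology.IsBounded s := by
    intro s
    constructor
    · intro h
      have := g.symm.isometry.lipschitz.isBounded_image h
      rwa [← Set.image_comp, show (g.symm ∘ g) = id from by ext; simp, Set.image_id] at this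
    · exact fun h => g.isometry.lipschitz.isBounded_image h
  ext x
  obtain ⟨z, rfl⟩ := g.surjective x
  have hb : g z ∈ boundary (g ∘ V) ↔ z ∈ boundary V := by
    rw [boundary_comp, g.injective.mem_set_image]
  rw [g.injective.mem_set_image]
  simp only [region, Set.mem_union, Set.mem_ofPred_eq, hb]
  by_cases h : z ∈ boundary V
  · simp [h]
  · simp only [h, false_or, not_false_eq_true, true_and]
    rw [key z h, hbd]

/-! ### The prototile in normal position -/

/-- The data of the prototile: the length `r` of the four equal edges and the unit number
`w = exp (i (π / 2 - θ))` by which the direction of `BC` is turned against that of `AB`. -/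
structure Shape (n : ℕ) where
  three_le : 3 ≤ n
  r : ℝ
  r_pos : 0 < r
  w : ℂ
  norm_w : ‖w‖ = 1
  re_w : 0 < w.re

namespace Shape
variable {n : ℕ} (S : Shape n)

/-- The real part of the vertices `B` and `E`. -/
def c : ℝ := S.r * Real.cos (Real.pi / n)

/-- The imaginary part of the vertex `E`. -/
def s : ℝ := S.r * Real.sin (Real.pi / n)

/-- The vertex `B`, the vertex `A` being the origin and the bisector at `A` the real axis. -/
def a : ℂ := ⟨S.c, -S.s⟩

/-- The vertex `E`, the complex conjugate of `B`. -/
def b : ℂ := ⟨S.c, S.s⟩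

/-- The vertices `A, B, C, D, E`: the edges `AB`, `BC`, `CD` and `AE` are `a`, `a w`, `b w`
and `b`. -/
def v : Fin 5 → ℂ := ![0, S.a, S.a + S.a * S.w, S.a + S.a * S.w + S.b * S.w, S.b]

theorem cast_pos (S : Shape n) : (0 : ℝ) < n := by
  have := S.three_le
  exact_mod_cast (by omega : 0 < n)

theorem angle_pos (S : Shape n) : 0 < Real.pi / n := div_pos Real.pi_pos S.cast_pos

theorem angle_le (S : Shape n) : Real.pi / n ≤ Real.pi / 3 := by
  have h3 : (3 : ℝ) ≤ n := by exact_mod_cast S.three_le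
  gcongr

theorem c_pos : 0 < S.c := by
  have := S.angle_pos
  have := S.angle_le
  exact mul_pos S.r_pos (Real.cos_pos_of_mem_Ioo ⟨by linarith, by linarith⟩)

theorem s_pos : 0 < S.s := by
  have := S.angle_pos
  have := S.angle_le
  exact mul_pos S.r_pos (Real.sin_pos_of_mem_Ioo ⟨by linarith, by linarith⟩)

theorem sq_c_add_sq_s : S.c ^ 2 + S.s ^ 2 = S.r ^ 2 := by
  unfold c s
  rw [mul_pow, mul_pow, ← mul_add, Real.cos_sq_add_sin_sq, mul_one]

theorem sq_w : S.w.re ^ 2 + S.w.im ^ 2 = 1 := by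
  have h := Complex.sq_norm S.w
  rw [S.norm_w, normSq_apply] at h
  nlinarith

@[simp] theorem a_re : S.a.re = S.c := rfl
@[simp] theorem a_im : S.a.im = -S.s := rfl
@[simp] theorem b_re : S.b.re = S.c := rfl
@[simp] theorem b_im : S.b.im = S.s := rfl
@[simp] theorem conj_a : conj S.a = S.b := by apply Complex.ext <;> simp
@[simp] theorem conj_b : conj S.b = S.a := by apply Complex.ext <;> simp

theorem w_ne_zero : S.w ≠ 0 := by
  intro h
  have := S.re_w
  simp [h] at this

theorem w_mul_conj : S.w * conj S.w = 1 := by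
  rw [mul_conj, ← Complex.sq_norm, S.norm_w]; simp

theorem v_zero : S.v 0 = 0 := rfl
theorem v_one : S.v 1 = S.a := rfl
theorem v_two : S.v 2 = S.a + S.a * S.w := rfl
theorem v_three : S.v 3 = S.a + S.a * S.w + S.b * S.w := rfl
theorem v_four : S.v 4 = S.b := rfl

theorem orient_BCD : orient (S.v 1) (S.v 2) (S.v 3) = 2 * S.c * S.s := by
  have : orient (S.v 1) (S.v 2) (S.v 3) = 2 * S.c * S.s * (S.w.re ^ 2 + S.w.im ^ 2) := by
    simp [orient, v_one, v_two, v_three]; ring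
  rw [this, S.sq_w, mul_one]

theorem orient_BDE : orient (S.v 1) (S.v 3) (S.v 4) = 4 * S.c * S.s * S.w.re := by
  simp [orient, v_one, v_three, v_four]; ring

theorem orient_BEA : orient (S.v 1) (S.v 4) (S.v 0) = 2 * S.c * S.s := by
  simp [orient, v_one, v_four, v_zero]; ring

theorem isFan : IsFan S.v := by
  have := S.c_pos
  have := S.s_pos
  have := S.re_w
  exact ⟨by rw [orient_BCD]; positivity, by rw [orient_BDE]; positivity,
    by rw [orient_BEA]; positivity⟩

theorem injective_v : Function.Injective S.v := by
  have hc := S.c_pos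
  have hp := S.re_w
  have h1 := S.isFan.BCD
  have h2 := S.isFan.BDE
  have h3 := S.isFan.BEA
  have h02 : S.v 0 ≠ S.v 2 := by
    intro h
    have e1 := congrArg re h
    have e2 := congrArg im h
    simp [v_zero, v_two] at e1 e2
    have : (S.c ^ 2 + S.s ^ 2) * (1 + S.w.re) = 0 := by linear_combination -S.c * e1 + S.s * e2
    exact absurd this (by positivity)
  have h03 : S.v 0 ≠ S.v 3 := by
    intro h
    have e1 := congrArg re h
    simp [v_zero, v_three] at e1
    nlinarith [mul_pos hc hp]
  have h24 : S.v 2 ≠ S.v 4 := by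
    intro h
    have e1 := congrArg re h
    have e2 := congrArg im h
    simp [v_two, v_four] at e1 e2
    have : (S.c ^ 2 + S.s ^ 2) * S.w.re + 2 * S.s ^ 2 = 0 := by
      linear_combination S.c * e1 - S.s * e2
    exact absurd this (by positivity)
  have key : ∀ i j, i < j → S.v i ≠ S.v j := by
    intro i j hij h
    fin_cases i <;> fin_cases j <;> first
    | exact absurd hij (by decide)
    | exact h02 h
    | exact h03 h
    | exact h24 h
    | (simp only [Fin.zero_eta, Fin.mk_one, Fin.reduceFinMk] at h
       simp [h, orient, mul_comm] at h1; done)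
    | (simp only [Fin.zero_eta, Fin.mk_one, Fin.reduceFinMk] at h
       simp [h, orient, mul_comm] at h2; done)
    | (simp only [Fin.zero_eta, Fin.mk_one, Fin.reduceFinMk] at h
       simp [h, orient, mul_comm] at h3)
  intro i j h
  rcases lt_trichotomy i j with hij | hij | hij
  · exact absurd h (key i j hij)
  · exact hij
  · exact absurd h.symm (key j i hij)

theorem one_le_norm_one_add_w : 1 ≤ ‖1 + S.w‖ := by
  have h1 := Complex.re_le_norm (1 + S.w)
  have h2 := S.re_w
  simp at h1
  linarith

theorem one_add_w_ne_zero : 1 + S.w ≠ 0 := by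
  intro h
  have := S.one_le_norm_one_add_w
  rw [h, norm_zero] at this
  linarith

theorem norm_a : ‖S.a‖ = S.r := by
  have h := Complex.sq_norm S.a
  rw [normSq_apply, a_re, a_im] at h
  have h2 : ‖S.a‖ ^ 2 = S.r ^ 2 := by rw [h, ← S.sq_c_add_sq_s]; ring
  exact (pow_left_inj₀ (norm_nonneg _) S.r_pos.le two_ne_zero).1 h2

theorem norm_b : ‖S.b‖ = S.r := by
  rw [← conj_a, norm_conj, norm_a]

/-! ### Bent edges of the rhombus tiling -/

/-- The vertices of the rhombus tiling of a sector. The sector is spanned by the vectors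
`A C = a + a w` and its image `b + b w` under the rotation through `2 π / n`. -/
def lat (i j : ℕ) : ℂ := i * (S.a + S.a * S.w) + j * (S.b + S.b * S.w)

/-- The apex of the bent edge from `(i, j)` to `(i + 1, j)`. -/
def apexH (i j : ℕ) : ℂ := S.lat i j + S.a * cond (i + j).bodd S.w 1

/-- The apex of the bent edge from `(i, j)` to `(i, j + 1)`. -/
def apexV (i j : ℕ) : ℂ := S.lat i j + S.b * cond (i + j).bodd S.w 1

theorem lat_succ_left (i j : ℕ) : S.lat (i + 1) j = S.lat i j + (S.a + S.a * S.w) := by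
  unfold lat; push_cast; ring

theorem lat_succ_right (i j : ℕ) : S.lat i (j + 1) = S.lat i j + (S.b + S.b * S.w) := by
  unfold lat; push_cast; ring

theorem bodd_succ_add (i j : ℕ) : (i + 1 + j).bodd = !(i + j).bodd := by
  rw [show i + 1 + j = (i + j) + 1 by ring, Nat.bodd_succ]

theorem bodd_add_succ (i j : ℕ) : (i + (j + 1)).bodd = !(i + j).bodd := by
  rw [← add_assoc, Nat.bodd_succ]

theorem conj_cond_mul (m : Bool) : conj (cond m S.w 1) * cond m S.w 1 = 1 := by
  cases m
  · simp
  · simpa [mul_comm] using S.w_mul_conj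

theorem apexH_eq_sub (i j : ℕ) :
    S.apexH i j = S.lat (i + 1) j + -(S.a * cond (i + 1 + j).bodd S.w 1) := by
  unfold apexH
  rw [bodd_succ_add, lat_succ_left]
  cases (i + j).bodd <;> simp <;> ring

theorem apexV_eq_sub (i j : ℕ) :
    S.apexV i j = S.lat i (j + 1) + -(S.b * cond (i + (j + 1)).bodd S.w 1) := by
  unfold apexV
  rw [bodd_add_succ, lat_succ_right]
  cases (i + j).bodd <;> simp <;> ring

end Shape

/-! ### Motions -/

/-- The isometry `z ↦ p + u z` or, if `m` holds, `z ↦ p + u (conj z)`. -/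
def motion (m : Bool) (u p : ℂ) (hu : ‖u‖ = 1) : ℂ ≃ᵢ ℂ :=
  IsometryEquiv.mk' (fun z => p + u * cond m (conj z) z)
    (fun z => cond m (conj (u⁻¹ * (z - p))) (u⁻¹ * (z - p)))
    (fun z => by
      have hu0 : u ≠ 0 := by rintro rfl; simp at hu
      cases m <;> simp [hu0])
    (Isometry.of_dist_eq fun x y => by
      cases m <;> simp [dist_eq, ← mul_sub, hu, ← map_sub])

theorem motion_apply (m : Bool) (u p : ℂ) (hu : ‖u‖ = 1) (z : ℂ) :
    motion m u p hu z = p + u * cond m (conj z) z := rfl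

theorem orient_motion (m : Bool) (u p : ℂ) (hu : ‖u‖ = 1) (x y z : ℂ) :
    orient (motion m u p hu x) (motion m u p hu y) (motion m u p hu z) =
      cond m (-1) 1 * orient x y z := by
  have h := Complex.sq_norm u
  rw [hu, normSq_apply] at h
  cases m
  · simp only [orient, motion_apply, cond_false, add_re, add_im, mul_re, mul_im]
    linear_combination -((y.re - x.re) * (z.im - x.im) - (y.im - x.im) * (z.re - x.re)) * h
  · simp only [orient, motion_apply, cond_true, add_re, add_im, mul_re, mul_im, conj_re, conj_im]
    linear_combination ((y.re - x.re) * (z.im - x.im) - (y.im - x.im) * (z.re - x.re)) * h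

/-- The `k`-th power of the rotation factor `exp (2 π i / n)`. -/
def rot {n : ℕ} [NeZero n] (k : ZMod n) : ℂ := ZMod.stdAddChar k

section
variable {n : ℕ} [NeZero n]

theorem norm_rot (k : ZMod n) : ‖rot k‖ = 1 := AddChar.norm_apply ZMod.stdAddChar k

theorem rot_add (k l : ZMod n) : rot (k + l) = rot k * rot l := AddChar.map_add_eq_mul _ _ _

theorem rot_zero : rot (0 : ZMod n) = 1 := AddChar.map_zero_eq_one _

theorem rot_ne_zero (k : ZMod n) : rot k ≠ 0 := by
  intro h; have := norm_rot k; simp [h] at this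

theorem rot_natCast (k : ℕ) :
    rot (k : ZMod n) = exp ((2 * Real.pi * k / n : ℝ) * I) := by
  have := ZMod.stdAddChar_coe (N := n) (k : ℤ)
  unfold rot
  rw [Int.cast_natCast] at this
  rw [this]
  congr 1
  push_cast
  ring

end

namespace Shape
variable {n : ℕ} [NeZero n] (S : Shape n)

theorem rot_one_mul_a : rot (1 : ZMod n) * S.a = S.b := by
  have h := rot_natCast (n := n) 1
  have e : (2 * Real.pi * (1 : ℕ) / n : ℝ) = 2 * (Real.pi / n) := by push_cast; ring
  rw [e, exp_mul_I, ← ofReal_cos, ← ofReal_sin, Nat.cast_one] at h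
  have h1 := Real.cos_sq_add_sin_sq (Real.pi / n)
  rw [h]
  apply Complex.ext
  · simp [c, s, -ofReal_cos, -ofReal_sin, -ofReal_mul, -ofReal_div, Real.cos_two_mul,
      Real.sin_two_mul]
    linear_combination (2 * S.r * Real.cos (Real.pi / n)) * h1
  · simp [c, s, -ofReal_cos, -ofReal_sin, -ofReal_mul, -ofReal_div, Real.cos_two_mul,
      Real.sin_two_mul]
    ring

/-! ### The tiles -/

theorem norm_place (k : ZMod n) (m p : Bool) : ‖rot k * cond m S.w 1 * cond p (-1) 1‖ = 1 := by
  cases m <;> cases p <;> simp [norm_rot, S.norm_w]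

end Shape

/-- The tiles are indexed by a sector `k`, a rhombus `(i, j)` of that sector, and a choice of one of
the two tiles that replace this rhombus. -/
abbrev Idx (n : ℕ) := ZMod n × ℕ × ℕ × Bool

/-- Whether the tile is a mirror image of the prototile; this is the case in every other rhombus. -/
def Idx.mir {n : ℕ} (τ : Idx n) : Bool := (τ.2.1 + τ.2.2.1).bodd

/-- The sign of the motion that places the tile. -/
def sgn {n : ℕ} (τ : Idx n) : ℝ := cond τ.mir (-1) 1

theorem sgn_mul_self {n : ℕ} (τ : Idx n) : sgn τ * sgn τ = 1 := by
  unfold sgn; cases τ.mir <;> simp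

theorem sgn_cases {n : ℕ} (τ : Idx n) : sgn τ = 1 ∨ sgn τ = -1 := by
  unfold sgn; cases τ.mir <;> simp

namespace Shape
variable {n : ℕ} [NeZero n] (S : Shape n)

/-- The motion that places the prototile at the tile with index `(k, i, j, p)`. One tile has its
vertex `A` at the corner `(i, j)` of the rhombus, the other one at the opposite corner. -/
def place (τ : Idx n) : ℂ ≃ᵢ ℂ :=
  motion τ.mir (rot τ.1 * cond τ.mir S.w 1 * cond τ.2.2.2 (-1) 1)
    (rot τ.1 * S.lat (τ.2.1 + τ.2.2.2.toNat) (τ.2.2.1 + τ.2.2.2.toNat)) (S.norm_place _ _ _)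

theorem place_apply (k : ZMod n) (i j : ℕ) (p : Bool) (z : ℂ) :
    S.place (k, i, j, p) z = rot k * (S.lat (i + p.toNat) (j + p.toNat) +
      cond (i + j).bodd S.w 1 * cond p (-1) 1 * cond (i + j).bodd (conj z) z) := by
  simp only [place, motion_apply, Idx.mir]
  ring

theorem orient_place (τ : Idx n) (x y z : ℂ) :
    orient (S.place τ x) (S.place τ y) (S.place τ z) = sgn τ * orient x y z :=
  orient_motion _ _ _ _ _ _ _

/-- The vertex number `i` of the tile `τ`. -/
def vtx (τ : Idx n) (i : Fin 5) : ℂ := S.place τ (S.v i)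

/-- The tile with index `τ`. -/
def tile (τ : Idx n) : Set ℂ := S.place τ '' region S.v

theorem tile_eq (τ : Idx n) : S.tile τ = tri (S.vtx τ 1) (S.vtx τ 2) (S.vtx τ 3) ∪
    tri (S.vtx τ 1) (S.vtx τ 3) (S.vtx τ 4) ∪ tri (S.vtx τ 1) (S.vtx τ 4) (S.vtx τ 0) := by
  unfold tile vtx
  rw [region_eq_fan S.isFan, fan, Set.image_union, Set.image_union, image_tri, image_tri, image_tri]

theorem isCompact_tile (τ : Idx n) : IsCompact (S.tile τ) := by
  rw [tile_eq]
  exact ((isCompact_tri _ _ _).union (isCompact_tri _ _ _)).union (isCompact_tri _ _ _)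

/-- The points that lie on no line through two vertices of a tile. -/
def generic : Set ℂ :=
  {z | ∀ (τ : Idx n) (i j : Fin 5), i ≠ j → orient z (S.vtx τ i) (S.vtx τ j) ≠ 0}

theorem injective_vtx (τ : Idx n) : Function.Injective (S.vtx τ) :=
  (S.place τ).injective.comp S.injective_v

end Shape

theorem dense_orient_ne {P Q : ℂ} (h : P ≠ Q) : Dense {z : ℂ | orient z P Q ≠ 0} := by
  intro z
  by_cases hz : orient z P Q = 0
  swap
  · exact subset_closure hz
  rw [mem_closure_iff_nhds]
  intro U hU
  -- Moving at right angles to the line changes the orientation.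
  have hc : Tendsto (fun t : ℝ => z + t * (I * (Q - P))) (𝓝[>] 0) (𝓝 z) := by
    have : Continuous (fun t : ℝ => z + t * (I * (Q - P))) := by fun_prop
    have h0 := this.tendsto 0
    simp only [ofReal_zero, zero_mul, add_zero] at h0
    exact h0.mono_left nhdsWithin_le_nhds
  obtain ⟨t, ht, ht0⟩ := ((hc.eventually hU).and self_mem_nhdsWithin).exists
  refine ⟨_, ht, ?_⟩
  have e : orient (z + t * (I * (Q - P))) P Q =
      orient z P Q + t * ((Q.re - P.re) ^ 2 + (Q.im - P.im) ^ 2) := by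
    simp [orient]; ring
  have hpos : 0 < (Q.re - P.re) ^ 2 + (Q.im - P.im) ^ 2 := by
    by_contra! h0
    apply h
    apply Complex.ext <;> nlinarith [sq_nonneg (Q.re - P.re), sq_nonneg (Q.im - P.im)]
  simp only [Set.mem_ofPred_eq, e, hz, zero_add]
  positivity

namespace Shape
variable {n : ℕ} [NeZero n] (S : Shape n)

theorem dense_generic : Dense S.generic := by
  have : S.generic = ⋂ x : Idx n × {p : Fin 5 × Fin 5 // p.1 ≠ p.2},
      {z | orient z (S.vtx x.1 x.2.1.1) (S.vtx x.1 x.2.1.2) ≠ 0} := by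
    ext z
    simp [generic]
  rw [this]
  refine dense_iInter_of_isOpen (fun x => ?_) fun x => ?_
  · exact isOpen_ne_fun (continuous_orient_left _ _) continuous_const
  · exact dense_orient_ne fun h => x.2.2 (S.injective_vtx x.1 h)

theorem rot_one_mul_lat (j : ℕ) : rot (1 : ZMod n) * S.lat j 0 = S.lat 0 j := by
  unfold lat; rw [← S.rot_one_mul_a]; push_cast; ring

theorem rot_one_mul_apexH (j : ℕ) : rot (1 : ZMod n) * S.apexH j 0 = S.apexV 0 j := by
  unfold apexH apexV
  rw [mul_add, rot_one_mul_lat, ← mul_assoc, rot_one_mul_a, Nat.add_comm 0 j, Nat.add_zero]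

/-- The vertices of the two tiles in the even rhombus `(i, j)`: their edges `AB`, `BC` form a bent
edge in the first direction, and their edges `CD` and `EA` are halves of bent edges in the second
direction. -/
theorem vtx_even {k : ZMod n} {i j : ℕ} (h : (i + j).bodd = false) :
    (S.vtx (k, i, j, false) 0 = rot k * S.lat i j ∧
      S.vtx (k, i, j, false) 1 = rot k * S.apexH i j ∧
      S.vtx (k, i, j, false) 2 = rot k * S.lat (i + 1) j ∧
      S.vtx (k, i, j, false) 3 = rot k * S.apexV (i + 1) j ∧
      S.vtx (k, i, j, false) 4 = rot k * S.apexV i j) ∧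
    S.vtx (k, i, j, true) 0 = rot k * S.lat (i + 1) (j + 1) ∧
      S.vtx (k, i, j, true) 1 = rot k * S.apexH i (j + 1) ∧
      S.vtx (k, i, j, true) 2 = rot k * S.lat i (j + 1) ∧
      S.vtx (k, i, j, true) 3 = rot k * S.apexV i j ∧
      S.vtx (k, i, j, true) 4 = rot k * S.apexV (i + 1) j := by
  simp only [vtx, place_apply, apexH, apexV, bodd_succ_add, bodd_add_succ, h, Bool.toNat_false,
    Bool.toNat_true, cond_true, cond_false, Bool.not_false, lat_succ_left, lat_succ_right,
    v_zero, v_one, v_two, v_three, v_four, Nat.add_zero]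
  refine ⟨⟨?_, ?_, ?_, ?_, ?_⟩, ?_, ?_, ?_, ?_, ?_⟩ <;> ring

/-- The vertices of the two tiles in the odd rhombus `(i, j)`, which are mirror images. -/
theorem vtx_odd {k : ZMod n} {i j : ℕ} (h : (i + j).bodd = true) :
    (S.vtx (k, i, j, false) 0 = rot k * S.lat i j ∧
      S.vtx (k, i, j, false) 1 = rot k * S.apexV i j ∧
      S.vtx (k, i, j, false) 2 = rot k * S.lat i (j + 1) ∧
      S.vtx (k, i, j, false) 3 = rot k * S.apexH i (j + 1) ∧
      S.vtx (k, i, j, false) 4 = rot k * S.apexH i j) ∧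
    S.vtx (k, i, j, true) 0 = rot k * S.lat (i + 1) (j + 1) ∧
      S.vtx (k, i, j, true) 1 = rot k * S.apexV (i + 1) j ∧
      S.vtx (k, i, j, true) 2 = rot k * S.lat (i + 1) j ∧
      S.vtx (k, i, j, true) 3 = rot k * S.apexH i j ∧
      S.vtx (k, i, j, true) 4 = rot k * S.apexH i (j + 1) := by
  have hw := S.w_mul_conj
  simp only [vtx, place_apply, apexH, apexV, bodd_succ_add, bodd_add_succ, h, Bool.toNat_false,
    Bool.toNat_true, cond_true, cond_false, Bool.not_true, lat_succ_left, lat_succ_right,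
    v_zero, v_one, v_two, v_three, v_four, Nat.add_zero, map_add, map_mul, map_zero, conj_a, conj_b]
  refine ⟨⟨?_, ?_, ?_, ?_, ?_⟩, ?_, ?_, ?_, ?_, ?_⟩
  · ring
  · ring
  · linear_combination rot k * S.b * hw
  · linear_combination rot k * (S.a + S.b) * hw
  · ring
  · ring
  · ring
  · linear_combination -rot k * S.b * hw
  · linear_combination -rot k * (S.a + S.b) * hw
  · ring

/-! ### Counting the tiles at a point by winding numbers -/

/-- The number of triangles of the tile `τ` that contain `z`. -/
def cnt (τ : Idx n) (z : ℂ) : ℝ :=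
  (tri (S.vtx τ 1) (S.vtx τ 2) (S.vtx τ 3)).indicator 1 z +
    (tri (S.vtx τ 1) (S.vtx τ 3) (S.vtx τ 4)).indicator 1 z +
      (tri (S.vtx τ 1) (S.vtx τ 4) (S.vtx τ 0)).indicator 1 z

theorem cnt_nat (τ : Idx n) (z : ℂ) : ∃ m : ℕ, S.cnt τ z = m ∧ (z ∈ S.tile τ ↔ 0 < m) := by
  classical
  rw [tile_eq]
  unfold cnt
  simp only [Set.indicator_apply, Pi.one_apply, Set.mem_union]
  split_ifs with h1 h2 h3 h3 h2 h3 h3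
  · exact ⟨3, by norm_num, by simp [h1]⟩
  · exact ⟨2, by norm_num, by simp [h1]⟩
  · exact ⟨2, by norm_num, by simp [h1]⟩
  · exact ⟨1, by norm_num, by simp [h1]⟩
  · exact ⟨2, by norm_num, by simp [h2]⟩
  · exact ⟨1, by norm_num, by simp [h2]⟩
  · exact ⟨1, by norm_num, by simp [h3]⟩
  · exact ⟨0, by norm_num, by simp [h1, h2, h3]⟩

theorem cnt_nonneg (τ : Idx n) (z : ℂ) : 0 ≤ S.cnt τ z := by
  obtain ⟨m, hm, -⟩ := S.cnt_nat τ z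
  rw [hm]; positivity

theorem one_le_cnt {τ : Idx n} {z : ℂ} (h : z ∈ S.tile τ) : 1 ≤ S.cnt τ z := by
  obtain ⟨m, hm, hz⟩ := S.cnt_nat τ z
  rw [hm]; exact_mod_cast hz.1 h

end Shape

theorem sight_triangle_sign {z P Q R : ℂ} {ε : ℝ} (hε : ε = 1 ∨ ε = -1)
    (h : 0 < ε * orient P Q R) (hP : orient z P Q ≠ 0)
    (hQ : orient z Q R ≠ 0) (hR : orient z R P ≠ 0) :
    sight z P Q + sight z Q R + sight z R P =
      2 * Real.pi * (ε * (tri P Q R).indicator 1 z) := by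
  rcases hε with rfl | rfl
  · rw [one_mul] at h ⊢
    exact sight_triangle h hP hQ hR
  · have h' : 0 < orient P R Q := by rw [orient_swap]; linarith
    have := sight_triangle (z := z) h' (by rw [orient_swap]; exact neg_ne_zero.2 hR)
      (by rw [orient_swap]; exact neg_ne_zero.2 hQ) (by rw [orient_swap]; exact neg_ne_zero.2 hP)
    rw [sight_swap hR, sight_swap hQ, sight_swap hP, tri_swap] at this
    linarith

namespace Shape
variable {n : ℕ} [NeZero n] (S : Shape n)

theorem sgn_mul_orient_BCD (τ : Idx n) :
    0 < sgn τ * orient (S.vtx τ 1) (S.vtx τ 2) (S.vtx τ 3) := by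
  unfold vtx; rw [orient_place, ← mul_assoc, sgn_mul_self, one_mul]; exact S.isFan.BCD

theorem sgn_mul_orient_BDE (τ : Idx n) :
    0 < sgn τ * orient (S.vtx τ 1) (S.vtx τ 3) (S.vtx τ 4) := by
  unfold vtx; rw [orient_place, ← mul_assoc, sgn_mul_self, one_mul]; exact S.isFan.BDE

theorem sgn_mul_orient_BEA (τ : Idx n) :
    0 < sgn τ * orient (S.vtx τ 1) (S.vtx τ 4) (S.vtx τ 0) := by
  unfold vtx; rw [orient_place, ← mul_assoc, sgn_mul_self, one_mul]; exact S.isFan.BEA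

/-- The winding number of the boundary of a tile counts the triangles of the tile. -/
theorem sight_tile (τ : Idx n) {z : ℂ} (hz : z ∈ S.generic (n := n)) :
    sight z (S.vtx τ 0) (S.vtx τ 1) + sight z (S.vtx τ 1) (S.vtx τ 2) +
      sight z (S.vtx τ 2) (S.vtx τ 3) + sight z (S.vtx τ 3) (S.vtx τ 4) +
        sight z (S.vtx τ 4) (S.vtx τ 0) = 2 * Real.pi * (sgn τ * S.cnt τ z) := by
  have g : ∀ i j : Fin 5, i ≠ j → orient z (S.vtx τ i) (S.vtx τ j) ≠ 0 := hz τ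
  have h1 := sight_triangle_sign (sgn_cases τ) (S.sgn_mul_orient_BCD τ) (g 1 2 (by decide))
    (g 2 3 (by decide)) (g 3 1 (by decide))
  have h2 := sight_triangle_sign (sgn_cases τ) (S.sgn_mul_orient_BDE τ) (g 1 3 (by decide))
    (g 3 4 (by decide)) (g 4 1 (by decide))
  have h3 := sight_triangle_sign (sgn_cases τ) (S.sgn_mul_orient_BEA τ) (g 1 4 (by decide))
    (g 4 0 (by decide)) (g 0 1 (by decide))
  have s1 := sight_swap (g 1 3 (by decide))
  have s2 := sight_swap (g 1 4 (by decide))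
  unfold cnt
  linarith

/-- The angle under which the bent edge from `(i, j)` to `(i + 1, j)` in the sector `k` is seen. -/
def sightH (k : ZMod n) (i j : ℕ) (z : ℂ) : ℝ :=
  sight z (rot k * S.lat i j) (rot k * S.apexH i j) +
    sight z (rot k * S.apexH i j) (rot k * S.lat (i + 1) j)

/-- The angle under which the bent edge from `(i, j)` to `(i, j + 1)` in the sector `k` is seen. -/
def sightV (k : ZMod n) (i j : ℕ) (z : ℂ) : ℝ :=
  sight z (rot k * S.lat i j) (rot k * S.apexV i j) +
    sight z (rot k * S.apexV i j) (rot k * S.lat i (j + 1))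

theorem sightV_zero (k : ZMod n) (j : ℕ) (z : ℂ) : S.sightV k 0 j z = S.sightH (k + 1) j 0 z := by
  unfold sightV sightH
  rw [rot_add, mul_assoc, mul_assoc, mul_assoc, rot_one_mul_lat, rot_one_mul_lat, rot_one_mul_apexH]

/-- The boundaries of the two tiles in a rhombus add up to the boundary of the bent rhombus, since
their common edge `DE` cancels. In an odd rhombus the tiles are clockwise. -/
theorem sight_rhombus (k : ZMod n) (i j : ℕ) {z : ℂ} (hz : z ∈ S.generic (n := n)) :
    2 * Real.pi * (S.cnt (k, i, j, false) z + S.cnt (k, i, j, true) z) =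
      (S.sightV k (i + 1) j z - S.sightV k i j z) -
        (S.sightH k i (j + 1) z - S.sightH k i j z) := by
  have h1 := S.sight_tile (k, i, j, false) hz
  have h2 := S.sight_tile (k, i, j, true) hz
  have sw : ∀ (τ : Idx n) (i j : Fin 5), i ≠ j →
      sight z (S.vtx τ j) (S.vtx τ i) = -sight z (S.vtx τ i) (S.vtx τ j) :=
    fun τ i j hij => sight_swap (hz τ i j hij)
  have t01 := sw (k, i, j, true) 0 1 (by decide)
  have t12 := sw (k, i, j, true) 1 2 (by decide)
  have t23 := sw (k, i, j, true) 2 3 (by decide)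
  have t34 := sw (k, i, j, true) 3 4 (by decide)
  have f40 := sw (k, i, j, false) 4 0 (by decide)
  unfold sightV sightH
  cases hp : (i + j).bodd
  · have s1 : sgn ((k, i, j, false) : Idx n) = 1 := by simp [sgn, Idx.mir, hp]
    have s2 : sgn ((k, i, j, true) : Idx n) = 1 := by simp [sgn, Idx.mir, hp]
    obtain ⟨⟨e0, e1, e2, e3, e4⟩, d0, d1, d2, d3, d4⟩ := S.vtx_even (k := k) hp
    simp only [s1, s2, one_mul, e0, e1, e2, e3, e4, d0, d1, d2, d3, d4] at *
    linarith
  · have s1 : sgn ((k, i, j, false) : Idx n) = -1 := by simp [sgn, Idx.mir, hp]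
    have s2 : sgn ((k, i, j, true) : Idx n) = -1 := by simp [sgn, Idx.mir, hp]
    obtain ⟨⟨e0, e1, e2, e3, e4⟩, d0, d1, d2, d3, d4⟩ := S.vtx_odd (k := k) hp
    simp only [s1, s2, e0, e1, e2, e3, e4, d0, d1, d2, d3, d4] at *
    linarith

/-- The number of triangles, in the rhombi `(i, j)` with `i, j < N` of all sectors, that contain
`z`. -/
def patch (N : ℕ) (z : ℂ) : ℝ := ∑ k : ZMod n, ∑ i ∈ Finset.range N, ∑ j ∈ Finset.range N,
  (S.cnt (k, i, j, false) z + S.cnt (k, i, j, true) z)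

/-- The contributions of all inner bent edges of a patch cancel. For the bent edges between two
sectors this holds because the first side of the sector `k + 1` is the second side of the
sector `k`. -/
theorem patch_eq_outer (N : ℕ) {z : ℂ} (hz : z ∈ S.generic (n := n)) :
    2 * Real.pi * S.patch (n := n) N z = ∑ k : ZMod n,
      (∑ j ∈ Finset.range N, S.sightV k N j z - ∑ i ∈ Finset.range N, S.sightH k i N z) := by
  have h1 : ∀ k : ZMod n, ∑ i ∈ Finset.range N, ∑ j ∈ Finset.range N,
      2 * Real.pi * (S.cnt (k, i, j, false) z + S.cnt (k, i, j, true) z) =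
      (∑ j ∈ Finset.range N, S.sightV k N j z - ∑ i ∈ Finset.range N, S.sightH k i N z) -
      (∑ j ∈ Finset.range N, S.sightH (k + 1) j 0 z - ∑ i ∈ Finset.range N, S.sightH k i 0 z) := by
    intro k
    have e1 : ∑ i ∈ Finset.range N, ∑ j ∈ Finset.range N,
        (S.sightV k (i + 1) j z - S.sightV k i j z) =
        ∑ j ∈ Finset.range N, S.sightV k N j z - ∑ j ∈ Finset.range N, S.sightH (k + 1) j 0 z := by
      rw [Finset.sum_comm, ← Finset.sum_sub_distrib]
      refine Finset.sum_congr rfl fun j _ => ?_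
      rw [Finset.sum_range_sub (fun i => S.sightV k i j z), sightV_zero]
    have e2 : ∑ i ∈ Finset.range N, ∑ j ∈ Finset.range N,
        (S.sightH k i (j + 1) z - S.sightH k i j z) =
        ∑ i ∈ Finset.range N, S.sightH k i N z - ∑ i ∈ Finset.range N, S.sightH k i 0 z := by
      rw [← Finset.sum_sub_distrib]
      refine Finset.sum_congr rfl fun i _ => ?_
      rw [Finset.sum_range_sub (fun j => S.sightH k i j z)]
    simp only [S.sight_rhombus k _ _ hz]
    rw [sub_sub_sub_comm, ← e1, ← e2, ← Finset.sum_sub_distrib]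
    simp only [← Finset.sum_sub_distrib]
  unfold patch
  simp only [Finset.mul_sum]
  simp only [h1, Finset.sum_sub_distrib]
  have := Equiv.sum_comp (Equiv.addRight (1 : ZMod n))
    (fun k => ∑ j ∈ Finset.range N, S.sightH k j 0 z)
  simp only [Equiv.coe_addRight] at this
  rw [this]
  ring

/-! ### Far away parts of a sector -/

/-- The coordinate of `x` in the direction `1 + w` of the diagonal of the sector `k`. -/
def depth (k : ZMod n) (x : ℂ) : ℝ := (x / (rot k * (1 + S.w))).re

theorem depth_le_norm (k : ZMod n) (x : ℂ) : S.depth k x ≤ ‖x‖ := by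
  refine (Complex.re_le_norm _).trans ?_
  rw [norm_div, norm_mul, norm_rot, one_mul]
  exact div_le_self (norm_nonneg x) S.one_le_norm_one_add_w

/-- Vertices of large index are deep in their sector. -/
theorem le_depth (k : ZMod n) (i j : ℕ) {d : ℂ} (hd : ‖d‖ ≤ S.r) :
    (i + j) * S.c - S.r ≤ S.depth k (rot k * (S.lat i j + d)) := by
  have e : rot k * (S.lat i j + d) / (rot k * (1 + S.w)) = i * S.a + j * S.b + d / (1 + S.w) := by
    have := S.one_add_w_ne_zero
    have := rot_ne_zero k
    unfold lat
    field_simp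
  have h1 : ‖d / (1 + S.w)‖ ≤ S.r := by
    rw [norm_div]
    exact (div_le_self (norm_nonneg _) S.one_le_norm_one_add_w).trans hd
  have h2 := (abs_le.1 ((Complex.abs_re_le_norm _).trans h1)).1
  unfold depth
  rw [e]
  simp only [add_re, mul_re, natCast_re, natCast_im, a_re, b_re]
  linarith

theorem le_depth_lat (k : ZMod n) (i j : ℕ) :
    (i + j) * S.c - S.r ≤ S.depth k (rot k * S.lat i j) := by
  have := S.le_depth k i j (d := 0) (by simpa using S.r_pos.le)
  rwa [add_zero] at this

theorem le_depth_apexH (k : ZMod n) (i j : ℕ) :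
    (i + j) * S.c - S.r ≤ S.depth k (rot k * S.apexH i j) :=
  S.le_depth k i j (by cases (i + j).bodd <;> simp [norm_a, S.norm_w])

theorem le_depth_apexV (k : ZMod n) (i j : ℕ) :
    (i + j) * S.c - S.r ≤ S.depth k (rot k * S.apexV i j) :=
  S.le_depth k i j (by cases (i + j).bodd <;> simp [norm_b, S.norm_w])

theorem sight_eq_sub_of_depth {k : ZMod n} {z P Q : ℂ} {M : ℝ} (hM : ‖z‖ < M)
    (hP : M ≤ S.depth k P) (hQ : M ≤ S.depth k Q) :
    sight z P Q = arg ((Q - z) / (rot k * (1 + S.w))) - arg ((P - z) / (rot k * (1 + S.w))) := by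
  have h := S.depth_le_norm k z
  unfold depth at *
  apply sight_eq_sub <;> rw [sub_div, sub_re] <;> linarith

/-- If the patch is large, its outer boundary in the sector `k` lies in a half-plane that does not
contain `z`, so it is seen under the same angle as the segment between its end points. -/
theorem outer_sector {k : ZMod n} {N : ℕ} {z : ℂ} (hN : ‖z‖ < N * S.c - S.r) :
    ∑ j ∈ Finset.range N, S.sightV k N j z - ∑ i ∈ Finset.range N, S.sightH k i N z =
      sight z (rot k * S.lat N 0) (rot k * S.lat 0 N) := by
  have hc := S.c_pos
  have far : ∀ i j : ℕ, N ≤ i + j → N * S.c - S.r ≤ (i + j) * S.c - S.r := by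
    intro i j h
    have : (N : ℝ) ≤ i + j := by exact_mod_cast h
    gcongr
  let f : ℂ → ℝ := fun Q => arg ((rot k * Q - z) / (rot k * (1 + S.w)))
  have hV : ∀ j, S.sightV k N j z = f (S.lat N (j + 1)) - f (S.lat N j) := by
    intro j
    have p1 := (far N j (by omega)).trans (S.le_depth_lat k N j)
    have p2 := (far N j (by omega)).trans (S.le_depth_apexV k N j)
    have p3 := (far N (j + 1) (by omega)).trans (by exact_mod_cast S.le_depth_lat k N (j + 1))
    unfold sightV
    rw [S.sight_eq_sub_of_depth hN p1 p2, S.sight_eq_sub_of_depth hN p2 p3]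
    ring
  have hH : ∀ i, S.sightH k i N z = f (S.lat (i + 1) N) - f (S.lat i N) := by
    intro i
    have p1 := (far i N (by omega)).trans (S.le_depth_lat k i N)
    have p2 := (far i N (by omega)).trans (S.le_depth_apexH k i N)
    have p3 := (far (i + 1) N (by omega)).trans (by exact_mod_cast S.le_depth_lat k (i + 1) N)
    unfold sightH
    rw [S.sight_eq_sub_of_depth hN p1 p2, S.sight_eq_sub_of_depth hN p2 p3]
    ring
  have p1 := (far N 0 (by omega)).trans (by exact_mod_cast S.le_depth_lat k N 0)
  have p2 := (far 0 N (by omega)).trans (by exact_mod_cast S.le_depth_lat k 0 N)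
  rw [S.sight_eq_sub_of_depth hN p1 p2]
  simp only [hV, hH]
  rw [Finset.sum_range_sub (fun j => f (S.lat N j)), Finset.sum_range_sub (fun i => f (S.lat i N))]
  simp only [f]
  ring

theorem arg_rot_one (S : Shape n) : arg (rot (1 : ZMod n)) = 2 * Real.pi / n := by
  have h := rot_natCast (n := n) 1
  have e : (2 * Real.pi * (1 : ℕ) / n : ℝ) = 2 * (Real.pi / n) := by push_cast; ring
  have h1 := S.angle_pos
  have h2 := S.angle_le
  rw [e, Nat.cast_one, exp_mul_I] at h
  rw [h, arg_cos_add_sin_mul_I ⟨by linarith, by linarith⟩]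
  ring

/-- In the limit, each of the `n` outer segments is seen under the angle `2 π / n`. -/
theorem tendsto_outer (z : ℂ) : Tendsto (fun N : ℕ => ∑ k : ZMod n,
    sight z (rot k * S.lat N 0) (rot k * S.lat 0 N)) atTop (𝓝 (2 * Real.pi)) := by
  have hsum : 2 * Real.pi = ∑ k : ZMod n, arg (rot (1 : ZMod n)) := by
    have := S.cast_pos
    rw [Finset.sum_const, Finset.card_univ, ZMod.card, S.arg_rot_one, nsmul_eq_mul]
    field_simp
  rw [hsum]
  refine tendsto_finsetSum _ fun k _ => ?_
  have hk := rot_ne_zero k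
  have hw := S.one_add_w_ne_zero
  have ha : S.a ≠ 0 := by
    intro h
    have := S.c_pos
    rw [← a_re, h] at this
    simp at this
  have h0 : Tendsto (fun N : ℕ => z / (N : ℂ)) atTop (𝓝 0) :=
    tendsto_const_div_atTop_nhds_zero_nat z
  have h1 : Tendsto (fun N : ℕ => (rot k * (S.b * (1 + S.w)) - z / N) /
      (rot k * (S.a * (1 + S.w)) - z / N)) atTop (𝓝 (rot (1 : ZMod n))) := by
    have e : rot (1 : ZMod n) =
        (rot k * (S.b * (1 + S.w)) - 0) / (rot k * (S.a * (1 + S.w)) - 0) := by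
      rw [← S.rot_one_mul_a (n := n)]
      field_simp
      simp only [sub_zero]
      ring
    rw [e]
    exact (tendsto_const_nhds.sub h0).div (tendsto_const_nhds.sub h0) (by simp [hk, ha, hw])
  have hslit : rot (1 : ZMod n) ∈ slitPlane := by
    rw [mem_slitPlane_iff_arg]
    have h1 := S.angle_pos
    have h2 := S.angle_le
    refine ⟨?_, rot_ne_zero _⟩
    rw [S.arg_rot_one, mul_div_assoc]
    linarith
  refine ((continuousAt_arg hslit).tendsto.comp h1).congr' ?_
  filter_upwards [eventually_gt_atTop 0] with N hN
  have hN' : (N : ℂ) ≠ 0 := by exact_mod_cast hN.ne'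
  unfold sight lat
  simp only [Function.comp]
  congr 1
  have e1 : rot k * (((0 : ℕ) : ℂ) * (S.a + S.a * S.w) + N * (S.b + S.b * S.w)) - z =
      N * (rot k * (S.b * (1 + S.w)) - z / N) := by
    field_simp; push_cast; ring
  have e2 : rot k * ((N : ℂ) * (S.a + S.a * S.w) + ((0 : ℕ) : ℂ) * (S.b + S.b * S.w)) - z =
      N * (rot k * (S.a * (1 + S.w)) - z / N) := by
    field_simp; push_cast; ring
  rw [e1, e2, mul_div_mul_left _ _ hN']

/-- For large patches the winding number of the outer boundary about `z` is one. -/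
theorem eventually_patch_eq_one {z : ℂ} (hz : z ∈ S.generic (n := n)) :
    ∀ᶠ N in atTop, S.patch (n := n) N z = 1 := by
  have hpi := Real.pi_pos
  have h1 : ∀ᶠ N : ℕ in atTop, ‖z‖ < N * S.c - S.r := by
    have : Tendsto (fun N : ℕ => N * S.c - S.r) atTop atTop :=
      tendsto_atTop_add_const_right _ _ (tendsto_natCast_atTop_atTop.atTop_mul_const S.c_pos)
    exact this.eventually_gt_atTop _
  have h2 := (S.tendsto_outer z).eventually (Ioo_mem_nhds (a := 0) (b := 2 * (2 * Real.pi))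
    (by linarith) (by linarith))
  filter_upwards [h1, h2] with N hN hN2
  have h3 := S.patch_eq_outer N hz
  simp only [S.outer_sector hN] at h3
  rw [← h3] at hN2
  have hnat : ∃ m : ℕ, S.patch (n := n) N z = m := by
    have : ∀ τ : Idx n, ∃ m : ℕ, S.cnt τ z = m := fun τ => (S.cnt_nat τ z).imp fun _ h => h.1
    choose f hf using this
    refine ⟨∑ k : ZMod n, ∑ i ∈ Finset.range N, ∑ j ∈ Finset.range N,
      (f (k, i, j, false) + f (k, i, j, true)), ?_⟩
    unfold patch
    push_cast
    simp only [hf]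
  obtain ⟨m, hm⟩ := hnat
  rw [hm] at hN2 ⊢
  have l1 : (0 : ℝ) < m := by by_contra h; push Not at h; nlinarith [hN2.1]
  have l2 : (m : ℝ) < 2 := by by_contra h; push Not at h; nlinarith [hN2.2]
  have l1' : 0 < m := by exact_mod_cast l1
  have l2' : m < 2 := by exact_mod_cast l2
  have : m = 1 := by omega
  simp [this]

/-! ### The tiling -/

/-- A generic point lies in exactly one tile, because the number of triangles of a large patch that
contain it is one. -/
theorem existsUnique_mem_tile {z : ℂ} (hz : z ∈ S.generic (n := n)) :
    ∃! τ : Idx n, z ∈ S.tile τ := by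
  have hev := S.eventually_patch_eq_one hz
  apply existsUnique_of_exists_of_unique
  · obtain ⟨N, hN⟩ := hev.exists
    by_contra! hc
    have h0 : ∀ τ : Idx n, S.cnt τ z = 0 := by
      intro τ
      obtain ⟨m, hm, hz⟩ := S.cnt_nat τ z
      have : m = 0 := by
        by_contra hm0
        exact hc τ (hz.2 (Nat.pos_of_ne_zero hm0))
      rw [hm, this, Nat.cast_zero]
    simp [patch, h0] at hN
  · intro τ τ' h h'
    by_contra hne
    obtain ⟨N, hN, hN1⟩ := (hev.and (eventually_ge_atTop
      (τ.2.1 + τ.2.2.1 + τ'.2.1 + τ'.2.2.1 + 1))).exists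
    let s : Finset (Idx n) := Finset.univ ×ˢ Finset.range N ×ˢ Finset.range N ×ˢ Finset.univ
    have hs : S.patch N z = ∑ x ∈ s, S.cnt x z := by
      simp only [s, Finset.sum_product, patch, Fintype.sum_bool, add_comm]
    have hsub : ({τ, τ'} : Finset (Idx n)) ⊆ s := by
      intro x hx
      simp only [Finset.mem_insert, Finset.mem_singleton] at hx
      simp only [s, Finset.mem_product, Finset.mem_univ, Finset.mem_range, true_and, and_true]
      rcases hx with rfl | rfl <;> constructor <;> omega
    have := Finset.sum_le_sum_of_subset_of_nonneg hsub
      (f := fun x => S.cnt x z) fun x _ _ => S.cnt_nonneg x z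
    rw [Finset.sum_pair hne, ← hs, hN] at this
    linarith [S.one_le_cnt h, S.one_le_cnt h']

theorem tile_subset_depth (τ : Idx n) :
    S.tile τ ⊆ {x | (τ.2.1 + τ.2.2.1) * S.c - S.r ≤ S.depth τ.1 x} := by
  have hc := S.c_pos
  have hconv : Convex ℝ {x | (τ.2.1 + τ.2.2.1) * S.c - S.r ≤ S.depth τ.1 x} := by
    refine convex_halfSpace_ge (𝕜 := ℝ) ⟨fun x y => ?_, fun c x => ?_⟩ _
    · simp [depth, add_div]
    · simp [depth, mul_div_assoc]
  have hv : ∀ i, (τ.2.1 + τ.2.2.1) * S.c - S.r ≤ S.depth τ.1 (S.vtx τ i) := by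
    obtain ⟨k, i, j, p⟩ := τ
    have a1 := S.le_depth_lat k i j
    have a2 := S.le_depth_lat k (i + 1) j
    have a3 := S.le_depth_lat k i (j + 1)
    have a4 := S.le_depth_lat k (i + 1) (j + 1)
    have a5 := S.le_depth_apexH k i j
    have a6 := S.le_depth_apexH k i (j + 1)
    have a7 := S.le_depth_apexV k i j
    have a8 := S.le_depth_apexV k (i + 1) j
    push_cast at *
    intro x
    cases h : (i + j).bodd
    · obtain ⟨⟨e0, e1, e2, e3, e4⟩, d0, d1, d2, d3, d4⟩ := S.vtx_even (k := k) h
      cases p <;> fin_cases x <;> simp [e0, e1, e2, e3, e4, d0, d1, d2, d3, d4] <;> linarith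
    · obtain ⟨⟨e0, e1, e2, e3, e4⟩, d0, d1, d2, d3, d4⟩ := S.vtx_odd (k := k) h
      cases p <;> fin_cases x <;> simp [e0, e1, e2, e3, e4, d0, d1, d2, d3, d4] <;> linarith
  rw [tile_eq]
  exact Set.union_subset (Set.union_subset (tri_subset hconv (hv _) (hv _) (hv _))
    (tri_subset hconv (hv _) (hv _) (hv _))) (tri_subset hconv (hv _) (hv _) (hv _))

/-- The tiles cover the plane: generic points are dense, and the finitely many tiles that come close
to `z` have a closed union. -/
theorem exists_mem_tile (z : ℂ) : ∃ τ : Idx n, z ∈ S.tile τ := by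
  have hc := S.c_pos
  -- Only finitely many tiles come close to `z`.
  obtain ⟨N, hN⟩ := exists_nat_gt ((‖z‖ + 1 + S.r) / S.c)
  rw [div_lt_iff₀ hc] at hN
  let F : Set (Idx n) := Set.univ ×ˢ Set.Iio N ×ˢ Set.Iio N ×ˢ Set.univ
  have hF : F.Finite := Set.finite_univ.prod ((Set.finite_Iio N).prod
    ((Set.finite_Iio N).prod Set.finite_univ))
  have hclosed : IsClosed (⋃ τ ∈ F, S.tile τ) :=
    hF.isClosed_biUnion fun τ _ => (S.isCompact_tile τ).isClosed
  have hsub : Metric.ball z 1 ∩ S.generic (n := n) ⊆ ⋃ τ ∈ F, S.tile τ := by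
    rintro x ⟨hx, hg⟩
    obtain ⟨τ, hτ, -⟩ := S.existsUnique_mem_tile hg
    refine Set.mem_biUnion ?_ hτ
    have h1 : (τ.2.1 + τ.2.2.1) * S.c - S.r ≤ S.depth τ.1 x := S.tile_subset_depth τ hτ
    have h2 := h1.trans (S.depth_le_norm τ.1 x)
    have h3 : ‖x‖ < ‖z‖ + 1 := by
      have := norm_sub_norm_le x z
      rw [mem_ball_iff_norm] at hx
      linarith
    have h4 : ((τ.2.1 + τ.2.2.1 : ℕ) : ℝ) < N := by
      push_cast
      exact lt_of_mul_lt_mul_right (by linarith) hc.le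
    have h5 : τ.2.1 + τ.2.2.1 < N := by exact_mod_cast h4
    simp only [F, Set.mem_prod, Set.mem_univ, Set.mem_Iio, true_and, and_true]
    constructor <;> omega
  have hz : z ∈ closure (Metric.ball z 1 ∩ S.generic (n := n)) :=
    Dense.open_subset_closure_inter S.dense_generic Metric.isOpen_ball
      (Metric.mem_ball_self one_pos)
  have := (closure_minimal hsub hclosed) hz
  simp only [Set.mem_iUnion] at this
  obtain ⟨τ, -, h⟩ := this
  exact ⟨τ, h⟩

/-- A tile that meets an open set has generic points in that set, because every point of a
triangle is a limit of inner points. -/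
theorem exists_generic_mem {τ : Idx n} {p : ℂ} (hp : p ∈ S.tile τ) {U : Set ℂ} (hU : U ∈ 𝓝 p) :
    ∃ z ∈ U, z ∈ S.tile τ ∧ z ∈ S.generic (n := n) := by
  have htri : ∀ {P Q R : ℂ}, 0 < orient P Q R → p ∈ tri P Q R →
      ∃ z ∈ U, z ∈ tri P Q R ∧ z ∈ S.generic (n := n) := by
    intro P Q R h hpt
    have hint : (interior (tri P Q R)).Nonempty := by
      refine ⟨(1 / 3 : ℝ) * P + (1 / 3 : ℝ) * Q + (1 / 3 : ℝ) * R, mem_interior_iff_mem_nhds.2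
        (eventually_mem_tri h ?_ ?_ ?_)⟩
      all_goals
        refine lt_of_lt_of_eq (b := (1 / 3) * orient P Q R) (by positivity) ?_
        simp [orient, -one_div]
        ring
    have hcl : p ∈ closure (interior (tri P Q R)) := by
      rw [(convex_tri P Q R).closure_interior_eq_closure_of_nonempty_interior hint]
      exact subset_closure hpt
    obtain ⟨V, hVU, hV, hpV⟩ := mem_nhds_iff.1 hU
    obtain ⟨y, hyV, hy⟩ := mem_closure_iff.1 hcl V hV hpV
    obtain ⟨z, ⟨hz1, hz2⟩, hz⟩ := S.dense_generic.inter_open_nonempty (V ∩ interior (tri P Q R))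
      (hV.inter isOpen_interior) ⟨y, hyV, hy⟩
    exact ⟨z, hVU hz1, interior_subset hz2, hz⟩
  have htri' : ∀ {P Q R : ℂ}, 0 < sgn τ * orient P Q R → p ∈ tri P Q R →
      ∃ z ∈ U, z ∈ tri P Q R ∧ z ∈ S.generic (n := n) := by
    intro P Q R h hpt
    rcases sgn_cases τ with e | e <;> rw [e] at h
    · exact htri (by linarith) hpt
    · rw [← tri_swap] at hpt ⊢
      exact htri (by rw [orient_swap]; linarith) hpt
  rw [tile_eq] at hp ⊢
  rcases hp with (hp | hp) | hp
  · obtain ⟨z, h1, h2, h3⟩ := htri' (S.sgn_mul_orient_BCD τ) hp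
    exact ⟨z, h1, Or.inl (Or.inl h2), h3⟩
  · obtain ⟨z, h1, h2, h3⟩ := htri' (S.sgn_mul_orient_BDE τ) hp
    exact ⟨z, h1, Or.inl (Or.inr h2), h3⟩
  · obtain ⟨z, h1, h2, h3⟩ := htri' (S.sgn_mul_orient_BEA τ) hp
    exact ⟨z, h1, Or.inr h2, h3⟩

/-- If the tiles with indices in `L` cover a neighbourhood of `p`, then no other tile contains `p`,
because that tile would have generic points close to `p`. -/
theorem mem_of_eventually_mem {L : Set (Idx n)} {p : ℂ}
    (hL : ∀ᶠ z in 𝓝 p, ∃ τ ∈ L, z ∈ S.tile τ) {τ : Idx n} (hp : p ∈ S.tile τ) : τ ∈ L := by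
  obtain ⟨z, ⟨τ', hτ', h'⟩, h, hg⟩ := S.exists_generic_mem hp hL
  rwa [(S.existsUnique_mem_tile hg).unique h h']

theorem disjoint_interior_tile {τ τ' : Idx n} (h : τ ≠ τ') :
    Disjoint (interior (S.tile τ)) (interior (S.tile τ')) := by
  rw [Set.disjoint_left]
  intro p hp hp'
  exact h (S.mem_of_eventually_mem (L := {τ'}) (by
    filter_upwards [mem_interior_iff_mem_nhds.1 hp'] with z hz
    exact ⟨τ', rfl, hz⟩) (interior_subset hp))

theorem vtx_mem_tile (τ : Idx n) (i : Fin 5) : S.vtx τ i ∈ S.tile τ := by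
  rw [tile_eq]
  fin_cases i
  · exact Or.inr (right_mem_tri _ _ _)
  · exact Or.inr (left_mem_tri _ _ _)
  · exact Or.inl (Or.inl (mid_mem_tri _ _ _))
  · exact Or.inl (Or.inl (right_mem_tri _ _ _))
  · exact Or.inr (mid_mem_tri _ _ _)

theorem injective_tile : Function.Injective (S.tile (n := n)) := by
  intro τ τ' h
  obtain ⟨z, -, hz, hg⟩ := S.exists_generic_mem (S.vtx_mem_tile τ 0) univ_mem
  exact (S.existsUnique_mem_tile hg).unique hz (h ▸ hz)

end Shape

theorem sgn_eq_cond {n : ℕ} (k : ZMod n) (i j : ℕ) (p : Bool) :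
    sgn (k, i, j, p) = cond (i + j).bodd (-1) 1 := rfl

namespace Shape
variable {n : ℕ} [NeZero n] (S : Shape n)

/-! ### The tiles around a vertex -/

/-- The three tiles around the apex of a bent edge: the vertex `B` of `τB`, the vertex `D` of `τD`
and the vertex `E` of `τE` coincide, `τD` and `τE` share their edges `DE`, and the two halves of the
bent edge, which are the edges `AB` and `BC` of `τB`, are edges `CD` and `EA` of `τD` and `τE`, in
one of the two possible ways. -/
structure ApexStar (τB τD τE : Idx n) : Prop where
  D_eq : S.vtx τD 3 = S.vtx τB 1
  E_eq : S.vtx τE 4 = S.vtx τB 1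
  ED_eq : S.vtx τD 4 = S.vtx τE 3
  sgn_eq : sgn τD = sgn τE
  sides : (S.vtx τD 2 = S.vtx τB 2 ∧ S.vtx τE 0 = S.vtx τB 0 ∧ sgn τB = sgn τE) ∨
    (S.vtx τE 0 = S.vtx τB 2 ∧ S.vtx τD 2 = S.vtx τB 0 ∧ sgn τB = -sgn τE)

theorem rot_succ_mul_lat (k : ZMod n) (j : ℕ) :
    rot (k + 1) * S.lat j 0 = rot k * S.lat 0 j := by
  rw [rot_add, mul_assoc, rot_one_mul_lat]

theorem rot_succ_mul_apexH (k : ZMod n) (j : ℕ) :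
    rot (k + 1) * S.apexH j 0 = rot k * S.apexV 0 j := by
  rw [rot_add, mul_assoc, rot_one_mul_apexH]

theorem apexStar_right {k : ZMod n} {i j : ℕ} (h : (i + j).bodd = false) :
    S.ApexStar (k, i + 1, j, false) (k, i, j, false) (k, i, j, true) := by
  have h' : (i + 1 + j).bodd = true := by rw [bodd_succ_add, h]; rfl
  obtain ⟨⟨e0, e1, e2, e3, e4⟩, d0, d1, d2, d3, d4⟩ := S.vtx_even (k := k) h
  obtain ⟨⟨f0, f1, f2, f3, f4⟩, -⟩ := S.vtx_odd (k := k) h'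
  refine ⟨by rw [e3, f1], by rw [d4, f1], by rw [e4, d3], by simp only [sgn_eq_cond],
    Or.inr ⟨by rw [d0, f2], by rw [e2, f0], ?_⟩⟩
  simp [sgn_eq_cond, h, h']

theorem apexStar_left {k : ZMod n} {i j : ℕ} (h : (i + 1 + j).bodd = false) :
    S.ApexStar (k, i, j, true) (k, i + 1, j, true) (k, i + 1, j, false) := by
  have h' : (i + j).bodd = true := by rw [bodd_succ_add] at h; simpa using h
  obtain ⟨⟨e0, e1, e2, e3, e4⟩, d0, d1, d2, d3, d4⟩ := S.vtx_even (k := k) h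
  obtain ⟨-, f0, f1, f2, f3, f4⟩ := S.vtx_odd (k := k) h'
  refine ⟨by rw [d3, f1], by rw [e4, f1], by rw [d4, e3], by simp only [sgn_eq_cond],
    Or.inr ⟨by rw [e0, f2], by rw [d2, f0], ?_⟩⟩
  simp [sgn_eq_cond, h, h']

theorem apexStar_left_zero {k : ZMod n} {j : ℕ} (h : j.bodd = false) :
    S.ApexStar (k + 1, j, 0, false) (k, 0, j, true) (k, 0, j, false) := by
  have h1 : (j + 0).bodd = false := h
  have h2 : (0 + j).bodd = false := by rwa [Nat.zero_add]
  obtain ⟨⟨e0, e1, e2, e3, e4⟩, d0, d1, d2, d3, d4⟩ := S.vtx_even (k := k) h2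
  obtain ⟨⟨f0, f1, f2, f3, f4⟩, -⟩ := S.vtx_even (k := k + 1) h1
  refine ⟨by rw [d3, f1, rot_succ_mul_apexH], by rw [e4, f1, rot_succ_mul_apexH],
    by rw [d4, e3], by simp only [sgn_eq_cond],
    Or.inl ⟨by rw [d2, f2, rot_succ_mul_lat], by rw [e0, f0, rot_succ_mul_lat], ?_⟩⟩
  simp [sgn_eq_cond]

theorem apexStar_above {k : ZMod n} {i j : ℕ} (h : (i + j).bodd = true) :
    S.ApexStar (k, i, j + 1, false) (k, i, j, false) (k, i, j, true) := by
  have h' : (i + (j + 1)).bodd = false := by rw [bodd_add_succ, h]; rfl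
  obtain ⟨⟨e0, e1, e2, e3, e4⟩, d0, d1, d2, d3, d4⟩ := S.vtx_odd (k := k) h
  obtain ⟨⟨f0, f1, f2, f3, f4⟩, -⟩ := S.vtx_even (k := k) h'
  refine ⟨by rw [e3, f1], by rw [d4, f1], by rw [e4, d3], by simp only [sgn_eq_cond],
    Or.inr ⟨by rw [d0, f2], by rw [e2, f0], ?_⟩⟩
  simp [sgn_eq_cond, h, h']

theorem apexStar_below {k : ZMod n} {i j : ℕ} (h : (i + (j + 1)).bodd = true) :
    S.ApexStar (k, i, j, true) (k, i, j + 1, true) (k, i, j + 1, false) := by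
  have h' : (i + j).bodd = false := by rw [bodd_add_succ] at h; simpa using h
  obtain ⟨⟨e0, e1, e2, e3, e4⟩, d0, d1, d2, d3, d4⟩ := S.vtx_odd (k := k) h
  obtain ⟨-, f0, f1, f2, f3, f4⟩ := S.vtx_even (k := k) h'
  refine ⟨by rw [d3, f1], by rw [e4, f1], by rw [d4, e3], by simp only [sgn_eq_cond],
    Or.inr ⟨by rw [e0, f2], by rw [d2, f0], ?_⟩⟩
  simp [sgn_eq_cond, h, h']

theorem apexStar_below_zero {k : ZMod n} {i : ℕ} (h : i.bodd = true) :
    S.ApexStar (k, 0, i, false) (k + 1, i, 0, true) (k + 1, i, 0, false) := by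
  have h1 : (i + 0).bodd = true := h
  have h2 : (0 + i).bodd = true := by rwa [Nat.zero_add]
  obtain ⟨⟨e0, e1, e2, e3, e4⟩, d0, d1, d2, d3, d4⟩ := S.vtx_odd (k := k + 1) h1
  obtain ⟨⟨f0, f1, f2, f3, f4⟩, -⟩ := S.vtx_odd (k := k) h2
  refine ⟨by rw [d3, f1, rot_succ_mul_apexH], by rw [e4, f1, rot_succ_mul_apexH],
    by rw [d4, e3], by simp only [sgn_eq_cond],
    Or.inl ⟨by rw [d2, f2, rot_succ_mul_lat], by rw [e0, f0, rot_succ_mul_lat], ?_⟩⟩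
  simp [sgn_eq_cond]

/-- The other tile in the same rhombus. -/
def partner (τ : Idx n) : Idx n := (τ.1, τ.2.1, τ.2.2.1, !τ.2.2.2)

theorem exists_apexStar_D (τ : Idx n) : ∃ τB, S.ApexStar τB τ (partner τ) := by
  obtain ⟨k, i, j, p⟩ := τ
  cases h : (i + j).bodd <;> cases p
  · exact ⟨_, S.apexStar_right h⟩
  · cases i with
    | zero => exact ⟨_, S.apexStar_left_zero (by rwa [Nat.zero_add] at h)⟩
    | succ i => exact ⟨_, S.apexStar_left h⟩
  · exact ⟨_, S.apexStar_above h⟩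
  · cases j with
    | zero =>
      obtain ⟨k, rfl⟩ : ∃ k', k = k' + 1 := ⟨k - 1, by ring⟩
      exact ⟨_, S.apexStar_below_zero h⟩
    | succ j => exact ⟨_, S.apexStar_below h⟩

theorem exists_apexStar_E (τ : Idx n) : ∃ τB, S.ApexStar τB (partner τ) τ := by
  obtain ⟨τB, h⟩ := S.exists_apexStar_D (partner τ)
  refine ⟨τB, ?_⟩
  have : partner (partner τ) = τ := by simp [partner]
  rwa [this] at h

theorem exists_apexStar_B (τ : Idx n) : ∃ τD τE, S.ApexStar τ τD τE := by
  obtain ⟨k, i, j, p⟩ := τ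
  cases h : (i + j).bodd <;> cases p
  · cases j with
    | zero =>
      obtain ⟨k, rfl⟩ : ∃ k', k = k' + 1 := ⟨k - 1, by ring⟩
      exact ⟨_, _, S.apexStar_left_zero h⟩
    | succ j =>
      rw [bodd_add_succ] at h
      exact ⟨_, _, S.apexStar_above (by simpa using h)⟩
  · exact ⟨_, _, S.apexStar_below (by rw [bodd_add_succ, h]; rfl)⟩
  · cases i with
    | zero => exact ⟨_, _, S.apexStar_below_zero (by rwa [Nat.zero_add] at h)⟩
    | succ i =>
      rw [bodd_succ_add] at h
      exact ⟨_, _, S.apexStar_right (by simpa using h)⟩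
  · exact ⟨_, _, S.apexStar_left (by rw [bodd_succ_add, h]; rfl)⟩

theorem tri_BCD_subset (τ : Idx n) : tri (S.vtx τ 1) (S.vtx τ 2) (S.vtx τ 3) ⊆ S.tile τ := by
  rw [tile_eq]; exact fun x hx => Or.inl (Or.inl hx)

theorem tri_BDE_subset (τ : Idx n) : tri (S.vtx τ 1) (S.vtx τ 3) (S.vtx τ 4) ⊆ S.tile τ := by
  rw [tile_eq]; exact fun x hx => Or.inl (Or.inr hx)

theorem tri_BEA_subset (τ : Idx n) : tri (S.vtx τ 1) (S.vtx τ 4) (S.vtx τ 0) ⊆ S.tile τ := by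
  rw [tile_eq]; exact fun x hx => Or.inr hx

/-- The angles at `B`, `D` and `E` of the three tiles at an apex add up to a full turn. -/
theorem ApexStar.eventually_mem {τB τD τE : Idx n} (h : S.ApexStar τB τD τE) :
    ∀ᶠ z in 𝓝 (S.vtx τB 1), ∃ τ ∈ ({τB, τD, τE} : Set (Idx n)), z ∈ S.tile τ := by
  have b1 := S.sgn_mul_orient_BCD τB
  have b2 := S.sgn_mul_orient_BDE τB
  have b3 := S.sgn_mul_orient_BEA τB
  have d1 := S.sgn_mul_orient_BCD τD
  have d2 := S.sgn_mul_orient_BDE τD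
  have e2 := S.sgn_mul_orient_BDE τE
  have e3 := S.sgn_mul_orient_BEA τE
  have tb1 := S.tri_BCD_subset τB
  have tb2 := S.tri_BDE_subset τB
  have tb3 := S.tri_BEA_subset τB
  have td1 := S.tri_BCD_subset τD
  have td2 := S.tri_BDE_subset τD
  have te2 := S.tri_BDE_subset τE
  have te3 := S.tri_BEA_subset τE
  rw [h.sgn_eq] at d1 d2
  rw [h.ED_eq] at d2 td2
  rw [h.D_eq] at d1 d2 td1 td2
  rw [h.E_eq] at e2 e3 te2 te3
  -- Let every triangle start at the common point.
  rw [← orient_rotate] at d2 e3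
  rw [orient_rotate] at d1 e2
  rw [← tri_rotate] at td2 te3
  rw [tri_rotate] at td1 te2
  have mB : τB ∈ ({τB, τD, τE} : Set (Idx n)) := by simp
  have mD : τD ∈ ({τB, τD, τE} : Set (Idx n)) := by simp
  have mE : τE ∈ ({τB, τD, τE} : Set (Idx n)) := by simp
  rcases h.sides with ⟨hC, hA, hs⟩ | ⟨hC, hA, hs⟩
  · rw [hC] at d1 td1
    rw [hA] at e3 te3
    rw [← hs] at d1 d2 e2 e3
    have := eventually_mem_star_of_sign (Equiv.addRight (1 : Fin 7)) ![S.vtx τB 2, S.vtx τB 3,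
      S.vtx τB 4, S.vtx τB 0, S.vtx τE 1, S.vtx τE 3, S.vtx τD 1] (S.vtx τB 1) (ε := sgn τB) (by
      intro i
      fin_cases i
      exacts [b1, b2, b3, e3, e2, d2, d1])
    filter_upwards [this] with z hz
    obtain ⟨i, hi⟩ := hz
    fin_cases i
    exacts [⟨τB, mB, tb1 hi⟩, ⟨τB, mB, tb2 hi⟩, ⟨τB, mB, tb3 hi⟩, ⟨τE, mE, te3 hi⟩,
      ⟨τE, mE, te2 hi⟩, ⟨τD, mD, td2 hi⟩, ⟨τD, mD, td1 hi⟩]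
  · have hs' : sgn τE = -sgn τB := by rw [hs, neg_neg]
    rw [hC] at e3 te3
    rw [hA] at d1 td1
    rw [hs', neg_mul, ← mul_neg, ← orient_swap] at d1 d2 e2 e3
    rw [← tri_swap] at td1 td2 te2 te3
    have := eventually_mem_star_of_sign (Equiv.addRight (1 : Fin 7)) ![S.vtx τB 2, S.vtx τB 3,
      S.vtx τB 4, S.vtx τB 0, S.vtx τD 1, S.vtx τE 3, S.vtx τE 1] (S.vtx τB 1) (ε := sgn τB) (by
      intro i
      fin_cases i
      exacts [b1, b2, b3, d1, d2, e2, e3])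
    filter_upwards [this] with z hz
    obtain ⟨i, hi⟩ := hz
    fin_cases i
    exacts [⟨τB, mB, tb1 hi⟩, ⟨τB, mB, tb2 hi⟩, ⟨τB, mB, tb3 hi⟩, ⟨τD, mD, td1 hi⟩,
      ⟨τD, mD, td2 hi⟩, ⟨τE, mE, te2 hi⟩, ⟨τE, mE, te3 hi⟩]

/-- The `n` tiles with their vertex `A` at the origin fill a neighbourhood of the origin. -/
theorem eventually_mem_origin : ∀ᶠ z in 𝓝 (0 : ℂ), ∃ k : ZMod n, z ∈ S.tile (k, 0, 0, false) := by
  have hab : ∀ k : ZMod n, rot (k + 1) * S.a = rot k * S.b := fun k => by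
    rw [rot_add, mul_assoc, rot_one_mul_a]
  have key : ∀ k : ZMod n, S.vtx (k, 0, 0, false) 0 = 0 ∧ S.vtx (k, 0, 0, false) 1 = rot k * S.a ∧
      S.vtx (k, 0, 0, false) 4 = rot (k + 1) * S.a := by
    intro k
    obtain ⟨⟨e0, e1, e2, e3, e4⟩, -⟩ := S.vtx_even (k := k) (i := 0) (j := 0) rfl
    rw [e0, e1, e4, hab]
    simp [lat, apexH, apexV]
  have := eventually_mem_star_of_sign (Equiv.addRight (1 : ZMod n)) (fun k => rot k * S.a) 0
    (ε := 1) (by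
      intro k
      have h := S.sgn_mul_orient_BEA (k, 0, 0, false)
      rw [(key k).1, (key k).2.1, (key k).2.2, orient_rotate,
        show sgn ((k, 0, 0, false) : Idx n) = 1 by simp [sgn_eq_cond]] at h
      exact h)
  filter_upwards [this] with z ⟨k, hk⟩
  refine ⟨k, S.tri_BEA_subset _ ?_⟩
  rw [(key k).1, (key k).2.1, (key k).2.2, tri_rotate]
  exact hk

/-- The triangle `P Q R` is counterclockwise and contained in the tile `τ`. The point `P` will be
the vertex `A` or `C` of the tile, and `Q`, `R` the two neighbours of this vertex. -/
def IsCorner (τ : Idx n) (P Q R : ℂ) : Prop :=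
  0 < orient P Q R ∧ tri P Q R ⊆ S.tile τ

theorem isCorner_of_BEA {τ : Idx n} (P Q R : ℂ) (h : 0 < orient P Q R)
    (h' : ({P, Q, R} : Set ℂ) = {S.vtx τ 1, S.vtx τ 4, S.vtx τ 0}) : S.IsCorner τ P Q R := by
  refine ⟨h, ?_⟩
  have := S.tri_BEA_subset τ
  unfold tri at *
  rwa [h']

theorem isCorner_of_BCD {τ : Idx n} (P Q R : ℂ) (h : 0 < orient P Q R)
    (h' : ({P, Q, R} : Set ℂ) = {S.vtx τ 1, S.vtx τ 2, S.vtx τ 3}) : S.IsCorner τ P Q R := by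
  refine ⟨h, ?_⟩
  have := S.tri_BCD_subset τ
  unfold tri at *
  rwa [h']

theorem orient_of_sub {k : ZMod n} {P x y : ℂ} :
    orient (rot k * P) (rot k * (P + x)) (rot k * (P + y)) = (conj x * y).im := by
  have h := orient_motion false (rot k) 0 (norm_rot k) P (P + x) (P + y)
  simp only [motion_apply, cond_false, zero_add, one_mul] at h
  rw [h]
  simp [orient]
  ring

theorem isCorner_SW (k : ZMod n) (i j : ℕ) : S.IsCorner (k, i, j, false)
    (rot k * S.lat i j) (rot k * S.apexH i j) (rot k * S.apexV i j) := by
  have hpos : 0 < orient (rot k * S.lat i j) (rot k * S.apexH i j) (rot k * S.apexV i j) := by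
    unfold apexH apexV
    rw [orient_of_sub, map_mul, conj_a, mul_mul_mul_comm, conj_cond_mul]
    simp
    nlinarith [mul_pos S.c_pos S.s_pos]
  apply S.isCorner_of_BEA _ _ _ hpos
  cases h : (i + j).bodd
  · obtain ⟨⟨e0, e1, e2, e3, e4⟩, -⟩ := S.vtx_even (k := k) h
    rw [e0, e1, e4]; ext; simp; tauto
  · obtain ⟨⟨e0, e1, e2, e3, e4⟩, -⟩ := S.vtx_odd (k := k) h
    rw [e0, e1, e4]; ext; simp; tauto

theorem isCorner_SE (k : ZMod n) (i j : ℕ) : S.IsCorner (k, i, j, (i + j).bodd)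
    (rot k * S.lat (i + 1) j) (rot k * S.apexV (i + 1) j) (rot k * S.apexH i j) := by
  have hpos : 0 < orient (rot k * S.lat (i + 1) j) (rot k * S.apexV (i + 1) j)
      (rot k * S.apexH i j) := by
    rw [apexH_eq_sub, apexV, orient_of_sub, map_mul, conj_b, mul_neg, mul_mul_mul_comm,
      conj_cond_mul]
    simp
    nlinarith [mul_pos S.c_pos S.s_pos]
  apply S.isCorner_of_BCD _ _ _ hpos
  cases h : (i + j).bodd
  · obtain ⟨⟨e0, e1, e2, e3, e4⟩, -⟩ := S.vtx_even (k := k) h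
    rw [e1, e2, e3]; ext; simp; tauto
  · obtain ⟨-, e0, e1, e2, e3, e4⟩ := S.vtx_odd (k := k) h
    rw [e1, e2, e3]; ext; simp; tauto

theorem isCorner_NE (k : ZMod n) (i j : ℕ) : S.IsCorner (k, i, j, true)
    (rot k * S.lat (i + 1) (j + 1)) (rot k * S.apexH i (j + 1)) (rot k * S.apexV (i + 1) j) := by
  have hpos : 0 < orient (rot k * S.lat (i + 1) (j + 1)) (rot k * S.apexH i (j + 1))
      (rot k * S.apexV (i + 1) j) := by
    rw [apexH_eq_sub, apexV_eq_sub, orient_of_sub, map_neg, map_mul, conj_a, neg_mul_neg,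
      mul_mul_mul_comm, conj_cond_mul]
    simp
    nlinarith [mul_pos S.c_pos S.s_pos]
  apply S.isCorner_of_BEA _ _ _ hpos
  cases h : (i + j).bodd
  · obtain ⟨-, e0, e1, e2, e3, e4⟩ := S.vtx_even (k := k) h
    rw [e0, e1, e4]; ext; simp; tauto
  · obtain ⟨-, e0, e1, e2, e3, e4⟩ := S.vtx_odd (k := k) h
    rw [e0, e1, e4]; ext; simp; tauto

theorem isCorner_NW (k : ZMod n) (i j : ℕ) : S.IsCorner (k, i, j, !(i + j).bodd)
    (rot k * S.lat i (j + 1)) (rot k * S.apexV i j) (rot k * S.apexH i (j + 1)) := by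
  have hpos : 0 < orient (rot k * S.lat i (j + 1)) (rot k * S.apexV i j)
      (rot k * S.apexH i (j + 1)) := by
    rw [apexH, apexV_eq_sub, orient_of_sub, map_neg, map_mul, conj_b, neg_mul,
      mul_mul_mul_comm, conj_cond_mul]
    simp
    nlinarith [mul_pos S.c_pos S.s_pos]
  apply S.isCorner_of_BCD _ _ _ hpos
  cases h : (i + j).bodd
  · obtain ⟨-, e0, e1, e2, e3, e4⟩ := S.vtx_even (k := k) h
    simp only [Bool.not_false]
    rw [e1, e2, e3]; ext; simp; tauto
  · obtain ⟨⟨e0, e1, e2, e3, e4⟩, -⟩ := S.vtx_odd (k := k) h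
    simp only [Bool.not_true]
    rw [e1, e2, e3]; ext; simp; tauto

theorem exists_four_of_isCorner {P : ℂ} {r : Fin 4 → ℂ} {t : Fin 4 → Idx n}
    (ht : Function.Injective t) (h : ∀ i, S.IsCorner (t i) P (r i) (r (i + 1))) :
    {τ | P ∈ S.tile τ}.ncard = 4 := by
  have h1 := eventually_mem_star_of_sign (Equiv.addRight (1 : Fin 4)) r P (ε := 1)
    fun i => by simpa using (h i).1
  have h2 : {τ | P ∈ S.tile τ} = Set.range t := by
    apply Set.Subset.antisymm
    · intro τ hτ
      refine S.mem_of_eventually_mem (p := P) ?_ hτ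
      filter_upwards [h1] with z ⟨i, hi⟩
      exact ⟨t i, ⟨i, rfl⟩, (h i).2 hi⟩
    · rintro _ ⟨i, rfl⟩
      exact (h i).2 (left_mem_tri _ _ _)
  rw [h2, Set.ncard_range_of_injective ht]
  simp

/-- A vertex of the rhombus tiling, other than the centre, lies in exactly four tiles. -/
theorem ncard_lat (k : ZMod n) (i j : ℕ) (hij : i ≠ 0 ∨ j ≠ 0) :
    {τ : Idx n | rot k * S.lat i j ∈ S.tile τ}.ncard = 4 := by
  have boundaryCase : ∀ (k : ZMod n) (i : ℕ),
      {τ : Idx n | rot k * S.lat 0 (i + 1) ∈ S.tile τ}.ncard = 4 := by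
    intro k i
    refine S.exists_four_of_isCorner (r := ![rot k * S.apexV 0 (i + 1),
      rot (k + 1) * S.apexV (i + 1) 0, rot k * S.apexV 0 i, rot k * S.apexH 0 (i + 1)])
      (t := ![(k + 1, i + 1, 0, false), (k + 1, i, 0, (i + 0).bodd), (k, 0, i, !(0 + i).bodd),
        (k, 0, i + 1, false)]) ?_ ?_
    · intro x y hxy
      fin_cases x <;> fin_cases y <;> simp_all
    · intro x
      fin_cases x
      · have := S.isCorner_SW (k + 1) (i + 1) 0
        rwa [rot_succ_mul_lat, rot_succ_mul_apexH] at this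
      · have := S.isCorner_SE (k + 1) i 0
        rwa [rot_succ_mul_lat, rot_succ_mul_apexH] at this
      · exact S.isCorner_NW k 0 i
      · exact S.isCorner_SW k 0 (i + 1)
  cases i with
  | zero =>
    cases j with
    | zero => simp at hij
    | succ j => exact boundaryCase k j
  | succ i =>
    cases j with
    | zero =>
      obtain ⟨k, rfl⟩ : ∃ k', k = k' + 1 := ⟨k - 1, by ring⟩
      rw [rot_succ_mul_lat]
      exact boundaryCase k i
    | succ j =>
      refine S.exists_four_of_isCorner (r := ![rot k * S.apexH (i + 1) (j + 1),
        rot k * S.apexV (i + 1) (j + 1), rot k * S.apexH i (j + 1), rot k * S.apexV (i + 1) j])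
        (t := ![(k, i + 1, j + 1, false), (k, i, j + 1, (i + (j + 1)).bodd), (k, i, j, true),
          (k, i + 1, j, !(i + 1 + j).bodd)]) ?_ ?_
      · intro x y hxy
        fin_cases x <;> fin_cases y <;> simp_all
      · intro x
        fin_cases x
        exacts [S.isCorner_SW k (i + 1) (j + 1), S.isCorner_SE k i (j + 1), S.isCorner_NE k i j,
          S.isCorner_NW k (i + 1) j]

end Shape

/-! ### Peaks -/

/-- The point `p` of `T` is not the midpoint of two other points of `T` that are close to `p`.
Convex corners of polygons have this property, and it is preserved by isometries. -/
def IsPeak (T : Set ℂ) (p : ℂ) : Prop :=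
  p ∈ T ∧ ∃ ε > 0, ∀ x ∈ T, ∀ y ∈ T, dist x p < ε → dist y p < ε → midpoint ℝ x y = p → x = p

theorem IsPeak.image {T : Set ℂ} {p : ℂ} (h : IsPeak T p) (g : ℂ ≃ᵢ ℂ) :
    IsPeak (g '' T) (g p) := by
  obtain ⟨hp, ε, hε, h⟩ := h
  refine ⟨Set.mem_image_of_mem g hp, ε, hε, ?_⟩
  rintro _ ⟨x, hx, rfl⟩ _ ⟨y, hy, rfl⟩ hxp hyp hm
  rw [g.dist_eq] at hxp hyp
  rw [← g.map_midpoint] at hm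
  rw [h x hx y hy hxp hyp (g.injective hm)]

theorem isPeak_of_eventually_lt {T : Set ℂ} {p : ℂ} (hp : p ∈ T) (f : ℂ →ₗ[ℝ] ℝ)
    (h : ∀ᶠ x in 𝓝 p, x ∈ T → x ≠ p → f x < f p) : IsPeak T p := by
  obtain ⟨ε, hε, hball⟩ := Metric.eventually_nhds_iff.1 h
  refine ⟨hp, ε, hε, fun x hx y hy hxp hyp hm => ?_⟩
  by_contra hne
  have h1 := hball hxp hx hne
  have hne' : y ≠ p := by
    rintro rfl
    exact hne ((midpoint_eq_right_iff ℝ).1 hm)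
  have h2 := hball hyp hy hne'
  have h3 : f p = (f x + f y) / 2 := by
    rw [← hm, midpoint_eq_smul_add, map_smul, map_add, smul_eq_mul, invOf_eq_inv]
    ring
  linarith

theorem eq_vertex_of_isPeak_tri {T : Set ℂ} {P Q R p : ℂ} (h12 : P ≠ Q) (h23 : Q ≠ R)
    (h31 : R ≠ P) (hT : tri P Q R ⊆ T) (hp : p ∈ tri P Q R) (h : IsPeak T p) :
    p = P ∨ p = Q ∨ p = R := by
  obtain ⟨-, ε, hε, h⟩ := h
  obtain ⟨α, β, γ, hα, hβ, hγ, hs, hpe⟩ := mem_tri_iff_exists.1 hp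
  -- Two vertices with positive weight give a direction in which `p` can be moved both ways.
  have main : ∀ {X Y : ℂ}, X ≠ Y → ∀ t₀ > 0, (∀ t : ℝ, |t| ≤ t₀ → p + t * (X - Y) ∈ tri P Q R) →
      False := by
    intro X Y hXY t₀ ht₀ hmem
    have hpos : 0 < ‖X - Y‖ := norm_pos_iff.2 (sub_ne_zero.2 hXY)
    let t := min t₀ (ε / (2 * ‖X - Y‖))
    have htpos : 0 < t := lt_min ht₀ (by positivity)
    have hd : t * ‖X - Y‖ < ε := by
      calc t * ‖X - Y‖ ≤ ε / (2 * ‖X - Y‖) * ‖X - Y‖ := by gcongr; exact min_le_right _ _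
        _ = ε / 2 := by field_simp
        _ < ε := by linarith
    have := h (p + t * (X - Y)) (hT (hmem t (by rw [abs_of_pos htpos]; exact min_le_left _ _)))
      (p + (-t : ℝ) * (X - Y))
      (hT (hmem (-t) (by rw [abs_neg, abs_of_pos htpos]; exact min_le_left _ _)))
      (by rw [dist_eq, add_sub_cancel_left, norm_mul, norm_real,
            Real.norm_of_nonneg htpos.le]; exact hd)
      (by rw [dist_eq, add_sub_cancel_left, norm_mul, norm_real, norm_neg,
            Real.norm_of_nonneg htpos.le]; exact hd)
      (by rw [midpoint_eq_smul_add]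
          simp only [invOf_eq_inv, real_smul]
          push_cast
          ring)
    rw [add_eq_left, mul_eq_zero, ofReal_eq_zero, sub_eq_zero] at this
    rcases this with h | h
    · exact htpos.ne' h
    · exact hXY h
  by_contra! hne
  obtain ⟨n1, n2, n3⟩ := hne
  have hmem : ∀ x y z : ℝ, 0 ≤ x → 0 ≤ y → 0 ≤ z → x + y + z = 1 → ∀ q : ℂ,
      q = x * P + y * Q + z * R → q ∈ tri P Q R := fun x y z hx hy hz hs q hq =>
    mem_tri_iff_exists.2 ⟨x, y, z, hx, hy, hz, hs, hq⟩
  by_cases hPQ : 0 < α ∧ 0 < β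
  · refine main h12 (min α β) (lt_min hPQ.1 hPQ.2) fun t ht => ?_
    have := abs_le.1 ht
    have h1 := min_le_left α β
    have h2 := min_le_right α β
    exact hmem (α + t) (β - t) γ (by linarith) (by linarith) hγ (by linarith) _
      (by rw [hpe]; push_cast; ring)
  by_cases hQR : 0 < β ∧ 0 < γ
  · refine main h23 (min β γ) (lt_min hQR.1 hQR.2) fun t ht => ?_
    have := abs_le.1 ht
    have h1 := min_le_left β γ
    have h2 := min_le_right β γ
    exact hmem α (β + t) (γ - t) hα (by linarith) (by linarith) (by linarith) _
      (by rw [hpe]; push_cast; ring)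
  by_cases hRP : 0 < γ ∧ 0 < α
  · refine main h31 (min γ α) (lt_min hRP.1 hRP.2) fun t ht => ?_
    have := abs_le.1 ht
    have h1 := min_le_left γ α
    have h2 := min_le_right γ α
    exact hmem (α - t) β (γ + t) (by linarith) hβ (by linarith) (by linarith) _
      (by rw [hpe]; push_cast; ring)
  rcases hα.eq_or_lt with h0 | hα
  · rcases hβ.eq_or_lt with h1 | hβ
    · apply n3
      have : γ = 1 := by linarith
      simp [hpe, ← h0, ← h1, this]
    · have h1 : γ = 0 := le_antisymm (not_lt.1 fun hγ => hQR ⟨hβ, hγ⟩) hγ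
      apply n2
      have : β = 1 := by linarith
      simp [hpe, ← h0, h1, this]
  · have h1 : β = 0 := le_antisymm (not_lt.1 fun hβ => hPQ ⟨hα, hβ⟩) hβ
    have h2 : γ = 0 := le_antisymm (not_lt.1 fun hγ => hRP ⟨hγ, hα⟩) hγ
    apply n1
    have : α = 1 := by linarith
    simp [hpe, h1, h2, this]

theorem ne_of_orient_pos {P Q R : ℂ} (h : 0 < orient P Q R) : P ≠ Q ∧ Q ≠ R ∧ R ≠ P := by
  refine ⟨?_, ?_, ?_⟩ <;> rintro rfl
  · simp [orient_self_left] at h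
  · simp [orient_self_right] at h
  · simp [orient_self_outer] at h

theorem exists_eq_vertex_of_isPeak {V : Fin 5 → ℂ} (hV : IsFan V) {p : ℂ}
    (h : IsPeak (region V) p) : ∃ i, p = V i := by
  rw [region_eq_fan hV] at h
  obtain ⟨a1, a2, a3⟩ := ne_of_orient_pos hV.BCD
  obtain ⟨b1, b2, b3⟩ := ne_of_orient_pos hV.BDE
  obtain ⟨c1, c2, c3⟩ := ne_of_orient_pos hV.BEA
  rcases h.1 with (hp | hp) | hp
  · rcases eq_vertex_of_isPeak_tri a1 a2 a3 (fun x hx => Or.inl (Or.inl hx)) hp h with h | h | h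
    exacts [⟨1, h⟩, ⟨2, h⟩, ⟨3, h⟩]
  · rcases eq_vertex_of_isPeak_tri b1 b2 b3 (fun x hx => Or.inl (Or.inr hx)) hp h with h | h | h
    exacts [⟨1, h⟩, ⟨3, h⟩, ⟨4, h⟩]
  · rcases eq_vertex_of_isPeak_tri c1 c2 c3 (fun x hx => Or.inr hx) hp h with h | h | h
    exacts [⟨1, h⟩, ⟨4, h⟩, ⟨0, h⟩]

namespace Shape
variable {n : ℕ} (S : Shape n)

theorem region_eq : region S.v = tri (S.v 1) (S.v 2) (S.v 3) ∪ tri (S.v 1) (S.v 3) (S.v 4) ∪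
    tri (S.v 1) (S.v 4) (S.v 0) := region_eq_fan S.isFan

theorem vertex_mem_region (i : Fin 5) : S.v i ∈ region S.v := by
  rw [region_eq]
  fin_cases i
  · exact Or.inr (right_mem_tri _ _ _)
  · exact Or.inr (left_mem_tri _ _ _)
  · exact Or.inl (Or.inl (mid_mem_tri _ _ _))
  · exact Or.inl (Or.inl (right_mem_tri _ _ _))
  · exact Or.inr (mid_mem_tri _ _ _)

theorem isClosed_tri (P Q R : ℂ) : IsClosed (tri P Q R) := (isCompact_tri P Q R).isClosed

/-- Near the vertex `A` the pentagon is its corner, the triangle `B E A`. -/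
theorem eventually_corner_A :
    ∀ᶠ x in 𝓝 (0 : ℂ), x ∈ region S.v → x ∈ tri (S.v 1) (S.v 4) (S.v 0) := by
  have hc := S.c_pos
  have hs := S.s_pos
  have hp := S.re_w
  have h1 : (0 : ℂ) ∉ tri (S.v 1) (S.v 2) (S.v 3) := by
    rw [mem_tri_iff S.isFan.BCD]
    rintro ⟨h1, -, h3⟩
    have e1 : orient 0 (S.v 1) (S.v 2) = (S.c ^ 2 + S.s ^ 2) * S.w.im := by
      simp [orient, v_one, v_two]; ring
    have e3 : orient 0 (S.v 3) (S.v 1) = -(2 * S.c * (S.s * S.w.re + S.c * S.w.im)) := by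
      simp [orient, v_one, v_three]; ring
    rw [e1] at h1
    rw [e3] at h3
    have hq : 0 ≤ S.w.im := by
      by_contra! hq
      nlinarith [mul_pos_of_neg_of_neg hq hq,
        mul_neg_of_pos_of_neg (by positivity : 0 < S.c ^ 2 + S.s ^ 2) hq]
    have : 0 < 2 * S.c * (S.s * S.w.re + S.c * S.w.im) := by positivity
    linarith
  have h2 : (0 : ℂ) ∉ tri (S.v 1) (S.v 3) (S.v 4) := by
    rw [mem_tri_iff S.isFan.BDE]
    rintro ⟨-, -, h3⟩
    have e3 : orient 0 (S.v 4) (S.v 1) = -(2 * S.c * S.s) := by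
      simp [orient, v_one, v_four]; ring
    rw [e3] at h3
    have : 0 < 2 * S.c * S.s := by positivity
    linarith
  filter_upwards [(isClosed_tri _ _ _).isOpen_compl.mem_nhds h1,
    (isClosed_tri _ _ _).isOpen_compl.mem_nhds h2] with x hx1 hx2 hx
  rw [region_eq] at hx
  rcases hx with (hx | hx) | hx
  · exact absurd hx hx1
  · exact absurd hx hx2
  · exact hx

/-- Near the vertex `C` the pentagon is its corner, the triangle `B C D`. -/
theorem eventually_corner_C :
    ∀ᶠ x in 𝓝 (S.v 2), x ∈ region S.v → x ∈ tri (S.v 1) (S.v 2) (S.v 3) := by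
  have hc := S.c_pos
  have hs := S.s_pos
  have hp := S.re_w
  have h1 : S.v 2 ∉ tri (S.v 1) (S.v 4) (S.v 0) := by
    rw [mem_tri_iff S.isFan.BEA]
    rintro ⟨h1, -, h3⟩
    have e3 : orient (S.v 2) (S.v 0) (S.v 1) = (S.c ^ 2 + S.s ^ 2) * S.w.im := by
      simp [orient, v_zero, v_one, v_two]; ring
    have e1 : orient (S.v 2) (S.v 1) (S.v 4) = -(2 * S.s * (S.c * S.w.re + S.s * S.w.im)) := by
      simp [orient, v_one, v_two, v_four]; ring
    rw [e1] at h1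
    rw [e3] at h3
    have hq : 0 ≤ S.w.im := by
      by_contra! hq
      nlinarith [mul_neg_of_pos_of_neg (by positivity : 0 < S.c ^ 2 + S.s ^ 2) hq]
    have : 0 < 2 * S.s * (S.c * S.w.re + S.s * S.w.im) := by positivity
    linarith
  have h2 : S.v 2 ∉ tri (S.v 1) (S.v 3) (S.v 4) := by
    rw [mem_tri_iff S.isFan.BDE]
    rintro ⟨h1, -, -⟩
    have := S.isFan.BCD
    rw [← orient_rotate, orient_swap] at this
    linarith
  filter_upwards [(isClosed_tri _ _ _).isOpen_compl.mem_nhds h1,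
    (isClosed_tri _ _ _).isOpen_compl.mem_nhds h2] with x hx1 hx2 hx
  rw [region_eq] at hx
  rcases hx with (hx | hx) | hx
  · exact hx
  · exact absurd hx hx2
  · exact absurd hx hx1

/-- The linear functional that is largest at the vertex `C` of the triangle `B C D`, its kernel
being parallel to `BD`. -/
def heightC : ℂ →ₗ[ℝ] ℝ := reLm ∘ₗ LinearMap.mulLeft ℝ (I * conj S.w)

theorem heightC_apply (x : ℂ) : S.heightC x = (I * conj S.w * x).re := rfl

theorem eventually_heightC_lt :
    ∀ᶠ x in 𝓝 (S.v 2), x ∈ region S.v → x ≠ S.v 2 → S.heightC x < S.heightC (S.v 2) := by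
  filter_upwards [S.eventually_corner_C] with x hx hxr hne
  obtain ⟨α, β, γ, hα, hβ, hγ, hs, rfl⟩ := mem_tri_iff_exists.1 (hx hxr)
  have hw := S.sq_w
  have e : S.heightC (S.v 2) - S.heightC (α * S.v 1 + β * S.v 2 + γ * S.v 3) = (1 - β) * S.s := by
    have hγ' : γ = 1 - α - β := by linarith
    subst hγ'
    simp [heightC_apply, v_one, v_two, v_three]
    linear_combination (1 - β) * S.s * hw
  have hβ1 : β < 1 := by
    by_contra! hβ1
    have h1 : α = 0 := by linarith
    have h2 : γ = 0 := by linarith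
    have h3 : β = 1 := by linarith
    apply hne
    simp [h1, h2, h3]
  have := mul_pos (sub_pos.2 hβ1) S.s_pos
  linarith

theorem isPeak_C : IsPeak (region S.v) (S.v 2) :=
  isPeak_of_eventually_lt (S.vertex_mem_region 2) S.heightC S.eventually_heightC_lt

theorem isPeak_A : IsPeak (region S.v) (S.v 0) := by
  refine isPeak_of_eventually_lt (S.vertex_mem_region 0) (-reLm) ?_
  rw [v_zero]
  filter_upwards [S.eventually_corner_A] with x hx hxr hne
  obtain ⟨α, β, γ, hα, hβ, hγ, hs, rfl⟩ := mem_tri_iff_exists.1 (hx hxr)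
  have hc := S.c_pos
  simp only [v_zero, v_one, v_four, mul_zero, add_zero] at hne ⊢
  simp
  by_contra! h
  have h1 : α = 0 := by nlinarith
  have h2 : β = 0 := by nlinarith
  apply hne
  simp [h1, h2]

theorem norm_v_two_gt : S.r < ‖S.v 2‖ := by
  have h1 : 1 < ‖1 + S.w‖ := by
    have h1 := Complex.re_le_norm (1 + S.w)
    have h2 := S.re_w
    simp at h1
    linarith
  have h2 : S.v 2 = S.a * (1 + S.w) := by rw [v_two]; ring
  rw [h2, norm_mul, norm_a]
  exact lt_mul_of_one_lt_right S.r_pos h1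

/-- The number `sin (π / n)` is not the positive root of `2 x² + x = 3 / 2`: it is too large for
`n ≤ 4` and too small for `n ≥ 5`. -/
theorem sin_ne (S : Shape n) :
    2 * Real.sin (Real.pi / n) ^ 2 + Real.sin (Real.pi / n) ≠ 3 / 2 := by
  intro h
  have h3 := S.three_le
  rcases eq_or_lt_of_le h3 with rfl | h4
  · have h5 : Real.sqrt 3 ^ 2 = 3 := Real.sq_sqrt (by norm_num)
    rw [Nat.cast_ofNat, Real.sin_pi_div_three] at h
    nlinarith
  rcases eq_or_lt_of_le (Nat.succ_le_of_lt h4) with h5 | h5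
  · have h6 : Real.sqrt 2 ^ 2 = 2 := Real.sq_sqrt (by norm_num)
    rw [← h5, show ((Nat.succ 3 : ℕ) : ℝ) = 4 by norm_num, Real.sin_pi_div_four] at h
    have : Real.sqrt 2 = 1 := by nlinarith
    rw [this] at h6
    norm_num at h6
  · have h6 : (5 : ℝ) ≤ n := by exact_mod_cast h5
    have h7 : Real.pi / n ≤ 0.63 := by
      rw [div_le_iff₀ S.cast_pos]
      linarith [Real.pi_lt_d2]
    have h8 := Real.sin_le S.angle_pos.le
    have h9 : 0 < Real.sin (Real.pi / n) := pos_of_mul_pos_right S.s_pos S.r_pos.le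
    nlinarith

/-- If the corner `C` lies on the bisector of the angle at `A`, then `w = exp (2 π i / n)` and
`n ≥ 5`. -/
theorem of_im_v_two_eq_zero (h : (S.v 2).im = 0) :
    S.w.re = Real.cos (2 * (Real.pi / n)) ∧ S.w.im = Real.sin (2 * (Real.pi / n)) ∧ 5 ≤ n := by
  have hp := S.re_w
  have hw := S.sq_w
  have hr := S.r_pos
  have hκ : 0 < Real.cos (Real.pi / n) := pos_of_mul_pos_right S.c_pos S.r_pos.le
  have hone := Real.cos_sq_add_sin_sq (Real.pi / n)
  have h1 : Real.cos (Real.pi / n) * S.w.im = Real.sin (Real.pi / n) * (1 + S.w.re) := by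
    have : S.r * (Real.cos (Real.pi / n) * S.w.im - Real.sin (Real.pi / n) * (1 + S.w.re)) = 0 := by
      rw [← h]; simp [v_two, c, s]; ring
    rcases mul_eq_zero.1 this with h | h
    · exact absurd h hr.ne'
    · linarith
  have h2 : S.w.re = Real.cos (Real.pi / n) ^ 2 - Real.sin (Real.pi / n) ^ 2 := by
    have : (1 + S.w.re) * (Real.cos (Real.pi / n) ^ 2 * (1 - S.w.re) -
        Real.sin (Real.pi / n) ^ 2 * (1 + S.w.re)) = 0 := by
      linear_combination Real.cos (Real.pi / n) ^ 2 * (-hw) + (Real.cos (Real.pi / n) * S.w.im +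
        Real.sin (Real.pi / n) * (1 + S.w.re)) * h1
    rcases mul_eq_zero.1 this with h | h
    · linarith
    · linear_combination -h - S.w.re * hone
  have h3 : S.w.im = 2 * Real.sin (Real.pi / n) * Real.cos (Real.pi / n) := by
    apply mul_left_cancel₀ hκ.ne'
    rw [h1, h2]
    linear_combination Real.sin (Real.pi / n) * (-hone)
  refine ⟨?_, ?_, ?_⟩
  · rw [h2, Real.cos_two_mul]; linarith
  · rw [h3, Real.sin_two_mul]
  · by_contra! h5
    have h4 : (n : ℝ) ≤ 4 := by exact_mod_cast Nat.le_of_lt_succ h5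
    have h6 : Real.pi / 4 ≤ Real.pi / n := by
      have := S.cast_pos
      gcongr
    have h7 := S.angle_le
    have : Real.cos (2 * (Real.pi / n)) ≤ 0 :=
      Real.cos_nonpos_of_pi_div_two_le_of_le (by linarith) (by linarith)
    rw [Real.cos_two_mul] at this
    linarith

/-- The pentagon is not symmetric in the bisector of its angle at `A`. The mirror image of the
corner `C` would have to be `C` or `D`; in the first case the corner at `C` would have a wrong
direction, in the second case `sin (π / n)` would have to be the positive root of
`2 x² + x = 3 / 2`. -/
theorem conj_region_ne : (fun z => conj z) '' region S.v ≠ region S.v := by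
  intro h
  have hmem : ∀ z ∈ region S.v, conj z ∈ region S.v := fun z hz => h ▸ Set.mem_image_of_mem _ hz
  have hpk : IsPeak (region S.v) (conj (S.v 2)) := by
    have := S.isPeak_C.image conjLIE.toIsometryEquiv
    have e : ⇑conjLIE.toIsometryEquiv = fun z => conj z := by ext; simp
    rwa [e, h] at this
  have hp := S.re_w
  have hw := S.sq_w
  have hnorm : S.r < ‖conj (S.v 2)‖ := by rw [norm_conj]; exact S.norm_v_two_gt
  obtain ⟨i, hi⟩ := exists_eq_vertex_of_isPeak S.isFan hpk
  rw [hi] at hnorm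
  fin_cases i
  · have := S.r_pos
    simp [v_zero] at hnorm
    linarith
  · exact absurd hnorm (by simp [v_one, norm_a])
  · -- Move from `C` towards `D` and reflect.
    have hC : conj (S.v 2) = S.v 2 := hi
    have him : (S.v 2).im = 0 := conj_eq_iff_im.1 hC
    obtain ⟨h1, h2, h5⟩ := S.of_im_v_two_eq_zero him
    have htend : Tendsto (fun t : ℝ => S.v 2 + t * (S.a * conj S.w)) (𝓝[>] 0) (𝓝 (S.v 2)) := by
      have : Continuous (fun t : ℝ => S.v 2 + t * (S.a * conj S.w)) := by fun_prop
      have h0 := this.tendsto 0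
      simp only [ofReal_zero, zero_mul, add_zero] at h0
      exact h0.mono_left nhdsWithin_le_nhds
    obtain ⟨t, ht, ht0, ht1⟩ := ((htend.eventually S.eventually_heightC_lt).and
      (Ioo_mem_nhdsGT (one_pos : (0 : ℝ) < 1))).exists
    have hx : S.v 2 + t * (S.b * S.w) ∈ region S.v := by
      rw [region_eq]
      refine Or.inl (Or.inl (mem_tri_iff_exists.2 ⟨0, 1 - t, t, le_rfl, by linarith, ht0.le,
        by ring, ?_⟩))
      rw [show S.v 3 = S.v 2 + S.b * S.w from rfl]
      push_cast
      ring
    have hx' := hmem _ hx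
    rw [map_add, hC, map_mul, map_mul, conj_ofReal, conj_b] at hx'
    have hlt := ht hx' (by
      intro h0
      rw [add_eq_left] at h0
      have hne : S.a * conj S.w ≠ 0 := by
        rw [← norm_ne_zero_iff, norm_mul, norm_conj, norm_a, S.norm_w, mul_one]
        exact S.r_pos.ne'
      rcases mul_eq_zero.1 h0 with h0 | h0
      · exact ht0.ne' (ofReal_eq_zero.1 h0)
      · exact hne h0)
    have e : S.heightC (S.v 2 + t * (S.a * conj S.w)) =
        S.heightC (S.v 2) + t * (S.r * Real.sin (Real.pi / n + 2 * (2 * (Real.pi / n)))) := by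
      rw [Real.sin_add, Real.cos_two_mul, Real.sin_two_mul (2 * _), ← h1, ← h2, heightC_apply,
        heightC_apply, mul_add, add_re]
      congr 1
      simp [c, s]
      linear_combination (-t * S.r * Real.sin (Real.pi / n)) * hw
    have hsin : 0 ≤ Real.sin (Real.pi / n + 2 * (2 * (Real.pi / n))) := by
      have hpos := S.angle_pos
      have h5' : (5 : ℝ) ≤ n := by exact_mod_cast h5
      refine Real.sin_nonneg_of_nonneg_of_le_pi (by linarith) ?_
      have : Real.pi / n ≤ Real.pi / 5 := by
        gcongr
      linarith
    rw [e] at hlt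
    have := mul_nonneg ht0.le (mul_nonneg S.r_pos.le hsin)
    linarith
  · have hr := S.r_pos
    have hD : conj (S.v 2) = S.v 3 := hi
    have e1 := congrArg re hD
    have e2 := congrArg im hD
    have hone := Real.cos_sq_add_sin_sq (Real.pi / n)
    have hσ : 0 < Real.sin (Real.pi / n) := pos_of_mul_pos_right S.s_pos S.r_pos.le
    have k1 : Real.cos (Real.pi / n) * S.w.re = Real.sin (Real.pi / n) * S.w.im := by
      have : S.r * (Real.cos (Real.pi / n) * S.w.re - Real.sin (Real.pi / n) * S.w.im) = 0 := by
        simp [v_two, v_three, c, s] at e1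
        linarith
      rcases mul_eq_zero.1 this with h | h
      · exact absurd h hr.ne'
      · linarith
    have k2 : 2 * Real.sin (Real.pi / n) + Real.sin (Real.pi / n) * S.w.re =
        3 * (Real.cos (Real.pi / n) * S.w.im) := by
      have : S.r * (2 * Real.sin (Real.pi / n) + Real.sin (Real.pi / n) * S.w.re -
          3 * (Real.cos (Real.pi / n) * S.w.im)) = 0 := by
        simp [v_two, v_three, c, s] at e2
        linarith
      rcases mul_eq_zero.1 this with h | h
      · exact absurd h hr.ne'
      · linarith
    have k3 : S.w.re = Real.sin (Real.pi / n) := by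
      have : S.w.re ^ 2 = Real.sin (Real.pi / n) ^ 2 := by
        linear_combination (-S.w.re ^ 2) * hone + Real.sin (Real.pi / n) ^ 2 * hw +
          (Real.cos (Real.pi / n) * S.w.re + Real.sin (Real.pi / n) * S.w.im) * k1
      exact (pow_left_inj₀ hp.le hσ.le two_ne_zero).1 this
    have k4 : S.w.im = Real.cos (Real.pi / n) := by
      rw [k3] at k1
      exact (mul_left_cancel₀ hσ.ne' (by linarith)).symm
    apply S.sin_ne
    rw [k3, k4] at k2
    nlinarith
  · exact absurd hnorm (by simp [v_four, norm_b])

end Shape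

/-! ### Symmetries of the tiling -/

theorem isometry_fixing_zero (g : ℂ ≃ᵢ ℂ) (h : g 0 = 0) :
    ∃ u : ℂ, ‖u‖ = 1 ∧ ((∀ z, g z = u * z) ∨ ∀ z, g z = u * conj z) := by
  obtain ⟨u, hu⟩ := linear_isometry_complex (g.toRealLinearIsometryEquivOfMapZero h)
  have e : ∀ z, g z = g.toRealLinearIsometryEquivOfMapZero h z := fun z => rfl
  refine ⟨u, u.norm_coe, hu.imp (fun hu z => ?_) fun hu z => ?_⟩
  · rw [e, hu]; simp [rotation_apply]
  · rw [e, hu]; simp [rotation_apply]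

namespace Shape
variable {n : ℕ} (S : Shape n)

/-- A rotation about `A` that keeps the two edges at `A` in the pentagon is trivial. -/
theorem eq_one_of_mem_corner {u : ℂ} (hu : ‖u‖ = 1)
    (h : ∀ t : ℝ, 0 < t → t < 1 → t * (u * S.a) ∈ region S.v ∧ t * (u * S.b) ∈ region S.v) :
    u = 1 := by
  have htend : ∀ x : ℂ, Tendsto (fun t : ℝ => (t : ℂ) * x) (𝓝[>] 0) (𝓝 0) := by
    intro x
    have : Continuous (fun t : ℝ => (t : ℂ) * x) := by fun_prop
    have h0 := this.tendsto 0
    simp only [ofReal_zero, zero_mul] at h0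
    exact h0.mono_left nhdsWithin_le_nhds
  obtain ⟨t, ⟨ha, hb⟩, ht0, ht1⟩ := (((htend (u * S.a)).eventually S.eventually_corner_A).and
    ((htend (u * S.b)).eventually S.eventually_corner_A)).and
      (Ioo_mem_nhdsGT (one_pos : (0 : ℝ) < 1)) |>.exists
  obtain ⟨-, -, a3⟩ := (mem_tri_iff S.isFan.BEA).1 (ha (h t ht0 ht1).1)
  obtain ⟨-, b2, b3⟩ := (mem_tri_iff S.isFan.BEA).1 (hb (h t ht0 ht1).2)
  have hr : 0 < S.c ^ 2 + S.s ^ 2 := by have := S.c_pos; positivity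
  have hcs := mul_pos S.c_pos S.s_pos
  have e1 : orient (t * (u * S.a)) (S.v 0) (S.v 1) = t * (S.c ^ 2 + S.s ^ 2) * u.im := by
    simp [orient, v_zero, v_one]; ring
  have e2 : orient (t * (u * S.b)) (S.v 4) (S.v 0) = -(t * (S.c ^ 2 + S.s ^ 2) * u.im) := by
    simp [orient, v_zero, v_four]; ring
  have him : u.im = 0 := by
    have : t * (S.c ^ 2 + S.s ^ 2) * u.im = 0 := by linarith
    rcases mul_eq_zero.1 this with h | h
    · exact absurd h (by positivity)
    · exact h
  have e3 : orient (t * (u * S.b)) (S.v 0) (S.v 1) = 2 * t * (S.c * S.s) * u.re := by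
    simp [orient, v_zero, v_one, him]; ring
  rw [e3] at b3
  have hre : 0 ≤ u.re := nonneg_of_mul_nonneg_right b3 (by positivity)
  have hsq := Complex.sq_norm u
  rw [hu, normSq_apply, him] at hsq
  have : u.re = 1 := by nlinarith
  exact Complex.ext this him

/-- The pentagon has no symmetry that fixes the vertex `A`. -/
theorem eq_id_of_image_region {u : ℂ} (hu : ‖u‖ = 1) {g : ℂ → ℂ}
    (hg : (∀ z, g z = u * z) ∨ ∀ z, g z = u * conj z) (h : g '' region S.v = region S.v) :
    ∀ z, g z = z := by
  have hseg : ∀ t : ℝ, 0 < t → t < 1 → (t * S.a : ℂ) ∈ region S.v ∧ (t * S.b : ℂ) ∈ region S.v := by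
    intro t h0 h1
    rw [region_eq]
    exact ⟨Or.inr (mem_tri_iff_exists.2 ⟨t, 0, 1 - t, h0.le, le_rfl, by linarith, by ring,
      by simp [v_zero, v_one]⟩), Or.inr (mem_tri_iff_exists.2 ⟨0, t, 1 - t, le_rfl, h0.le,
      by linarith, by ring, by simp [v_zero, v_four]⟩)⟩
  have hu1 : u = 1 := by
    refine S.eq_one_of_mem_corner hu fun t h0 h1 => ?_
    have ha : g (t * S.a) ∈ region S.v := h ▸ Set.mem_image_of_mem g (hseg t h0 h1).1
    have hb : g (t * S.b) ∈ region S.v := h ▸ Set.mem_image_of_mem g (hseg t h0 h1).2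
    rcases hg with hg | hg
    · rw [hg, mul_left_comm] at ha hb
      exact ⟨ha, hb⟩
    · rw [hg, map_mul, conj_ofReal, mul_left_comm] at ha hb
      rw [conj_a] at ha
      rw [conj_b] at hb
      exact ⟨hb, ha⟩
  rcases hg with hg | hg
  · intro z; rw [hg, hu1, one_mul]
  · exfalso
    apply S.conj_region_ne
    rw [← h]
    conv_lhs => rw [h]
    congr 1
    ext z
    rw [hg, hu1, one_mul]

theorem region_subset_convex {s : Set ℂ} (hs : Convex ℝ s) (h : ∀ i, S.v i ∈ s) :
    region S.v ⊆ s := by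
  rw [region_eq]
  exact Set.union_subset (Set.union_subset (tri_subset hs (h _) (h _) (h _))
    (tri_subset hs (h _) (h _) (h _))) (tri_subset hs (h _) (h _) (h _))

variable [NeZero n]

/-- The set of all tiles. -/
def tiling : Set (Set ℂ) := Set.range (S.tile (n := n))

theorem place_origin (k : ZMod n) (z : ℂ) : S.place (k, 0, 0, false) z = rot k * z := by
  simp [place_apply, lat]

theorem tile_origin (k : ZMod n) :
    S.tile (k, 0, 0, false) = (fun z => rot k * z) '' region S.v := by
  unfold tile
  congr 1
  ext z
  exact S.place_origin k z

theorem zero_mem_tile_iff (τ : Idx n) : (0 : ℂ) ∈ S.tile τ ↔ ∃ k, τ = (k, 0, 0, false) := by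
  constructor
  · intro h
    have := S.mem_of_eventually_mem (L := Set.range fun k => (k, 0, 0, false)) (by
      filter_upwards [S.eventually_mem_origin (n := n)] with z ⟨k, hk⟩
      exact ⟨_, ⟨k, rfl⟩, hk⟩) h
    obtain ⟨k, hk⟩ := this
    exact ⟨k, hk.symm⟩
  · rintro ⟨k, rfl⟩
    rw [tile_origin]
    exact ⟨0, S.vertex_mem_region 0, by simp⟩

theorem ncard_index (p : ℂ) :
    {T ∈ S.tiling (n := n) | p ∈ T}.ncard = {τ : Idx n | p ∈ S.tile τ}.ncard := by
  rw [← Set.ncard_image_of_injective _ S.injective_tile]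
  congr 1
  ext T
  constructor
  · rintro ⟨⟨τ, rfl⟩, h⟩
    exact ⟨τ, h, rfl⟩
  · rintro ⟨τ, h, rfl⟩
    exact ⟨⟨τ, rfl⟩, h⟩

theorem ncard_origin : {T ∈ S.tiling (n := n) | 0 ∈ T}.ncard = n := by
  rw [ncard_index]
  have : {τ : Idx n | (0 : ℂ) ∈ S.tile τ} =
      Set.range fun k : ZMod n => ((k, 0, 0, false) : Idx n) := by
    ext τ
    simp only [Set.mem_ofPred_eq, zero_mem_tile_iff, Set.mem_range, eq_comm]
  rw [this, Set.ncard_range_of_injective fun k l h => by simpa using h]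
  simp

/-- The rotation about the origin that carries the sector `0` to the sector `k`. -/
def turn (k : ZMod n) : ℂ ≃ᵢ ℂ := motion false (rot k) 0 (norm_rot k)

theorem turn_apply (k : ZMod n) (z : ℂ) : turn k z = rot k * z := by
  simp [turn, motion_apply]

theorem image_turn_tile (l k : ZMod n) (i j : ℕ) (p : Bool) :
    turn l '' S.tile (k, i, j, p) = S.tile (l + k, i, j, p) := by
  unfold tile
  rw [← Set.image_comp]
  congr 1
  ext z
  simp only [Function.comp, turn_apply, place_apply, rot_add, mul_assoc]

theorem isSymmetry_turn (l : ZMod n) : IsSymmetry (turn l) (S.tiling (n := n)) := by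
  unfold IsSymmetry tiling
  rw [← Set.range_comp]
  apply Set.Subset.antisymm
  · rintro _ ⟨⟨k, i, j, p⟩, rfl⟩
    exact ⟨(l + k, i, j, p), (S.image_turn_tile l k i j p).symm⟩
  · rintro _ ⟨⟨k, i, j, p⟩, rfl⟩
    refine ⟨(k - l, i, j, p), ?_⟩
    rw [Function.comp, S.image_turn_tile, add_sub_cancel]

theorem exists_image_tile {g : ℂ ≃ᵢ ℂ} (hg : IsSymmetry g (S.tiling (n := n))) (τ : Idx n) :
    ∃ τ', g '' S.tile τ = S.tile τ' := by
  have : g '' S.tile τ ∈ S.tiling (n := n) := hg ▸ Set.mem_image_of_mem _ ⟨τ, rfl⟩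
  obtain ⟨τ', h⟩ := this
  exact ⟨τ', h.symm⟩

theorem exists_tile_image {g : ℂ ≃ᵢ ℂ} (hg : IsSymmetry g (S.tiling (n := n))) (τ : Idx n) :
    ∃ τ', g '' S.tile τ' = S.tile τ := by
  have h : S.tile τ ∈ (fun T : Set ℂ => g '' T) '' S.tiling (n := n) := hg.symm ▸ ⟨τ, rfl⟩
  obtain ⟨_, ⟨τ', rfl⟩, h⟩ := h
  exact ⟨τ', h⟩

theorem eq_turn_of_isSymmetry {g : ℂ ≃ᵢ ℂ} (h0 : g 0 = 0)
    (hg : IsSymmetry g (S.tiling (n := n))) : ∃ k : ZMod n, ∀ z, g z = rot k * z := by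
  obtain ⟨τ, hτ⟩ := S.exists_image_tile hg (0, 0, 0, false)
  have hmem : (0 : ℂ) ∈ S.tile τ := by
    rw [← hτ]
    exact ⟨0, (S.zero_mem_tile_iff _).2 ⟨0, rfl⟩, h0⟩
  obtain ⟨k, rfl⟩ := (S.zero_mem_tile_iff τ).1 hmem
  refine ⟨k, ?_⟩
  rw [tile_origin, tile_origin] at hτ
  simp only [rot_zero, one_mul, Set.image_id'] at hτ
  have hk := rot_ne_zero k
  obtain ⟨u, hu, hgu⟩ := isometry_fixing_zero g h0
  have h1 : (fun z => (rot k)⁻¹ * g z) '' region S.v = region S.v := by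
    rw [← Set.image_image (fun z => (rot k)⁻¹ * z) g, hτ, Set.image_image]
    simp [hk]
  have h2 := S.eq_id_of_image_region (u := (rot k)⁻¹ * u) (by simp [hu, norm_rot])
    (hgu.imp (fun h z => by rw [h, mul_assoc]) fun h z => by rw [h, mul_assoc]) h1
  intro z
  calc g z = rot k * ((rot k)⁻¹ * g z) := by field_simp
    _ = rot k * z := by rw [h2]

theorem hasCnSymmetryAt : HasCnSymmetryAt n 0 (S.tiling (n := n)) := by
  intro g
  constructor
  · rintro ⟨h0, hg⟩
    obtain ⟨k, hk⟩ := S.eq_turn_of_isSymmetry h0 hg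
    refine ⟨k.val, fun z => ?_⟩
    rw [hk, sub_zero, zero_add, ← rot_natCast, ZMod.natCast_zmod_val]
  · rintro ⟨k, hk⟩
    have e : g = turn (k : ZMod n) := by
      ext z
      rw [turn_apply, hk z, sub_zero, zero_add, rot_natCast]
    rw [e]
    exact ⟨by simp [turn_apply], S.isSymmetry_turn _⟩

/-! ### The centre is distinguished -/

theorem exists_lat_of_corner (τ : Idx n) {x : Fin 5} (hx : x = 0 ∨ x = 2) :
    ∃ (k : ZMod n) (i j : ℕ), S.vtx τ x = rot k * S.lat i j := by
  obtain ⟨k, i, j, p⟩ := τ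
  cases h : (i + j).bodd
  · obtain ⟨⟨e0, -, e2, -, -⟩, d0, -, d2, -, -⟩ := S.vtx_even (k := k) h
    cases p <;> rcases hx with rfl | rfl
    exacts [⟨_, _, _, e0⟩, ⟨_, _, _, e2⟩, ⟨_, _, _, d0⟩, ⟨_, _, _, d2⟩]
  · obtain ⟨⟨e0, -, e2, -, -⟩, d0, -, d2, -, -⟩ := S.vtx_odd (k := k) h
    cases p <;> rcases hx with rfl | rfl
    exacts [⟨_, _, _, e0⟩, ⟨_, _, _, e2⟩, ⟨_, _, _, d0⟩, ⟨_, _, _, d2⟩]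

/-- The vertices `B`, `D` and `E` of every tile are apices. -/
theorem exists_apexStar (τ : Idx n) {x : Fin 5} (h0 : x ≠ 0) (h2 : x ≠ 2) :
    ∃ τB τD τE, S.ApexStar τB τD τE ∧ S.vtx τ x = S.vtx τB 1 := by
  fin_cases x
  · exact absurd rfl h0
  · obtain ⟨τD, τE, h⟩ := S.exists_apexStar_B τ
    exact ⟨_, _, _, h, rfl⟩
  · exact absurd rfl h2
  · obtain ⟨τB, h⟩ := S.exists_apexStar_D τ
    exact ⟨_, _, _, h, h.D_eq⟩
  · obtain ⟨τB, h⟩ := S.exists_apexStar_E τ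
    exact ⟨_, _, _, h, h.E_eq⟩

theorem ApexStar.ncard_le {τB τD τE : Idx n} (h : S.ApexStar τB τD τE) :
    {τ | S.vtx τB 1 ∈ S.tile τ}.ncard ≤ 3 := by
  have hsub : {τ | S.vtx τB 1 ∈ S.tile τ} ⊆ ({τB, τD, τE} : Set (Idx n)) :=
    fun τ hτ => S.mem_of_eventually_mem h.eventually_mem hτ
  refine (Set.ncard_le_ncard hsub (Set.toFinite _)).trans ?_
  refine (Set.ncard_insert_le _ _).trans ?_
  have := Set.ncard_insert_le τD ({τE} : Set (Idx n))
  rw [Set.ncard_singleton] at this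
  omega

/-- For `n = 3`, if some point of the pentagon is as far from `B` as `C` is from `E`, then no point
is as far from `D` as `E` is from `B`. So the pentagon does not look alike from `B`, `D` and `E`. -/
theorem distances_ne (S : Shape 3) (h1 : ∃ y ∈ region S.v, dist y (S.v 1) = dist (S.v 2) (S.v 4))
    (h2 : ∃ y ∈ region S.v, dist y (S.v 3) = dist (S.v 4) (S.v 1)) : False := by
  have hc := S.c_pos
  have hs := S.s_pos
  have hp := S.re_w
  have hw := S.sq_w
  have hrc : S.r = 2 * S.c := by
    unfold c
    rw [Nat.cast_ofNat, Real.cos_pi_div_three]; ring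
  have hsc : S.s ^ 2 = 3 * S.c ^ 2 := by
    have := S.sq_c_add_sq_s
    rw [hrc] at this; linarith
  have hd : ∀ x y : ℂ, dist x y ^ 2 = (x.re - y.re) ^ 2 + (x.im - y.im) ^ 2 := by
    intro x y
    rw [dist_eq, Complex.sq_norm, normSq_apply, sub_re, sub_im]; ring
  have hBE : dist (S.v 4) (S.v 1) = 2 * S.s := by
    apply (pow_left_inj₀ dist_nonneg (by positivity) two_ne_zero).1
    rw [hd]; simp [v_four, v_one]; ring
  have hle : ∀ x y : ℂ, (x.re - y.re) ^ 2 + (x.im - y.im) ^ 2 ≤ 4 * S.s ^ 2 →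
      dist x y ≤ 2 * S.s := by
    intro x y h
    apply (pow_le_pow_iff_left₀ dist_nonneg (by positivity) two_ne_zero).1
    rw [hd]; linarith
  have hlt : ∀ x y : ℂ, (x.re - y.re) ^ 2 + (x.im - y.im) ^ 2 < 4 * S.s ^ 2 →
      dist x y < 2 * S.s := by
    intro x y h
    apply (pow_lt_pow_iff_left₀ dist_nonneg (by positivity) two_ne_zero).1
    rw [hd]; linarith
  -- No point is farther from `B` than `E`, so `C` and `E` are not farther apart either.
  have key : S.c + 3 * S.c * S.w.re ≤ S.s * S.w.im := by
    obtain ⟨y, hy, hyd⟩ := h1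
    have hball := S.region_subset_convex (convex_closedBall (S.v 1) (2 * S.s)) (by
      intro i
      rw [Metric.mem_closedBall]
      apply hle
      fin_cases i <;> simp [v_zero, v_one, v_two, v_three, v_four]
      · nlinarith
      · nlinarith
      · have : (S.c * S.w.re + S.s * S.w.im) ^ 2 + (S.c * S.w.im + -(S.s * S.w.re)) ^ 2 =
            (S.c ^ 2 + S.s ^ 2) * (S.w.re ^ 2 + S.w.im ^ 2) := by ring
        nlinarith
      · have : (S.c * S.w.re + S.s * S.w.im + (S.c * S.w.re - S.s * S.w.im)) ^ 2 +
            (S.c * S.w.im + -(S.s * S.w.re) + (S.c * S.w.im + S.s * S.w.re)) ^ 2 =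
            4 * S.c ^ 2 * (S.w.re ^ 2 + S.w.im ^ 2) := by ring
        nlinarith
      · nlinarith) hy
    rw [Metric.mem_closedBall, hyd] at hball
    have := pow_le_pow_left₀ dist_nonneg hball 2
    rw [hd] at this
    have e : ((S.v 2).re - (S.v 4).re) ^ 2 + ((S.v 2).im - (S.v 4).im) ^ 2 =
        S.c ^ 2 + S.s ^ 2 + 4 * S.s ^ 2 + 4 * S.s * (S.s * S.w.re - S.c * S.w.im) := by
      simp [v_two, v_four]
      linear_combination (S.c ^ 2 + S.s ^ 2) * hw
    rw [e] at this
    have h3 : S.c * (S.c + 3 * S.c * S.w.re) ≤ S.c * (S.s * S.w.im) := by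
      linear_combination (1 / 4) * this - (1 / 4 + S.w.re) * hsc
    exact le_of_mul_le_mul_left h3 hc
  obtain ⟨y, hy, hyd⟩ := h2
  rw [hBE] at hyd
  have hball := S.region_subset_convex (convex_ball (S.v 3) (2 * S.s)) (by
    intro i
    rw [Metric.mem_ball]
    apply hlt
    fin_cases i
    · have e : ((S.v 0).re - (S.v 3).re) ^ 2 + ((S.v 0).im - (S.v 3).im) ^ 2 =
          S.c ^ 2 + S.s ^ 2 + 4 * S.c ^ 2 + 4 * S.c * (S.c * S.w.re - S.s * S.w.im) := by
        simp [v_zero, v_three]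
        linear_combination (4 * S.c ^ 2) * hw
      refine e.trans_lt ?_
      nlinarith
    · have e : ((S.v 1).re - (S.v 3).re) ^ 2 + ((S.v 1).im - (S.v 3).im) ^ 2 = 4 * S.c ^ 2 := by
        simp [v_one, v_three]
        linear_combination (4 * S.c ^ 2) * hw
      refine e.trans_lt ?_
      nlinarith
    · have e : ((S.v 2).re - (S.v 3).re) ^ 2 + ((S.v 2).im - (S.v 3).im) ^ 2 =
          S.c ^ 2 + S.s ^ 2 := by
        simp [v_two, v_three]
        linear_combination (S.c ^ 2 + S.s ^ 2) * hw
      refine e.trans_lt ?_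
      nlinarith
    · simp
      positivity
    · have e : ((S.v 4).re - (S.v 3).re) ^ 2 + ((S.v 4).im - (S.v 3).im) ^ 2 =
          4 * S.c ^ 2 + 4 * S.s ^ 2 - 8 * S.c * (S.s * S.w.im) := by
        simp [v_four, v_three]
        linear_combination (4 * S.c ^ 2) * hw
      refine e.trans_lt ?_
      nlinarith) hy
  rw [Metric.mem_ball, hyd] at hball
  exact lt_irrefl _ hball

/-- If `n ≠ 4`, every symmetry of the tiling fixes the centre. It maps the centre to a point that
lies in `n` tiles and is a vertex of one of them. Every other vertex of the rhombus tiling lies in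
exactly four tiles, and an apex lies in at most three; for `n = 3` an apex is excluded by comparing
distances. -/
theorem map_zero_of_isSymmetry (hn : n ≠ 4) {g : ℂ ≃ᵢ ℂ}
    (hg : IsSymmetry g (S.tiling (n := n))) : g 0 = 0 := by
  by_contra hne
  have hcard : {τ : Idx n | g 0 ∈ S.tile τ}.ncard = n := by
    have himg : {T ∈ S.tiling (n := n) | g 0 ∈ T} =
        (fun T => g '' T) '' {T ∈ S.tiling (n := n) | 0 ∈ T} := by
      ext T
      constructor
      · rintro ⟨⟨τ, rfl⟩, h⟩
        obtain ⟨τ', h'⟩ := S.exists_tile_image hg τ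
        rw [← h', g.injective.mem_set_image] at h
        exact ⟨S.tile τ', ⟨⟨τ', rfl⟩, h⟩, h'⟩
      · rintro ⟨_, ⟨⟨τ, rfl⟩, h⟩, rfl⟩
        obtain ⟨τ', h'⟩ := S.exists_image_tile hg τ
        exact ⟨⟨τ', h'.symm⟩, Set.mem_image_of_mem g h⟩
    rw [← ncard_index, himg, Set.ncard_image_of_injective _ g.injective.image_injective,
      ncard_origin]
  obtain ⟨τ, hτ⟩ := S.exists_image_tile hg (0, 0, 0, false)
  -- The image of the centre is a vertex.
  obtain ⟨x, hx⟩ : ∃ x, g 0 = S.vtx τ x := by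
    have h1 : IsPeak (S.tile τ) (g 0) := by
      rw [← hτ, tile_origin]
      simp only [rot_zero, one_mul, Set.image_id']
      exact S.isPeak_A.image g
    have h2 := h1.image (S.place τ).symm
    have h3 : (S.place τ).symm '' S.tile τ = region S.v := by
      unfold tile
      rw [Set.image_image]
      simp
    rw [h3] at h2
    obtain ⟨x, hx⟩ := exists_eq_vertex_of_isPeak S.isFan h2
    exact ⟨x, by rw [vtx, ← hx, IsometryEquiv.apply_symm_apply]⟩
  by_cases hAC : x = 0 ∨ x = 2
  · obtain ⟨k, i, j, h⟩ := S.exists_lat_of_corner τ hAC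
    rw [hx, h] at hcard hne
    have hij : i ≠ 0 ∨ j ≠ 0 := by
      by_contra! h0
      apply hne
      simp [h0.1, h0.2, lat]
    rw [S.ncard_lat k i j hij] at hcard
    exact hn hcard.symm
  · push Not at hAC
    obtain ⟨τB, τD, τE, hstar, h⟩ := S.exists_apexStar τ hAC.1 hAC.2
    have hgB : g 0 = S.vtx τB 1 := hx.trans h
    have h3 := hstar.ncard_le
    rw [← hgB, hcard] at h3
    obtain rfl : n = 3 := le_antisymm h3 S.three_le
    -- All tiles at the image of the centre are seen alike from that point.
    have hrep : ∀ τ : Idx 3, g 0 ∈ S.tile τ →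
        ∃ k : ZMod 3, S.tile τ = (fun z => g (rot k * z)) '' region S.v := by
      intro τ hτ
      obtain ⟨τ', h'⟩ := S.exists_tile_image hg τ
      rw [← h', g.injective.mem_set_image, zero_mem_tile_iff] at hτ
      obtain ⟨k, rfl⟩ := hτ
      refine ⟨k, ?_⟩
      rw [← h', tile_origin, Set.image_image]
    have htrans : ∀ τ τ' : Idx 3, ∀ x x' : Fin 5, S.vtx τ x = g 0 → S.vtx τ' x' = g 0 →
        ∀ z ∈ region S.v, ∃ y ∈ region S.v, dist y (S.v x') = dist z (S.v x) := by
      intro τ τ' x x' hx hx' z hz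
      obtain ⟨k, hk⟩ := hrep τ (hx ▸ S.vtx_mem_tile τ x)
      obtain ⟨k', hk'⟩ := hrep τ' (hx' ▸ S.vtx_mem_tile τ' x')
      have hzτ : S.place τ z ∈ S.tile τ := Set.mem_image_of_mem _ hz
      rw [hk] at hzτ
      obtain ⟨z₀, hz₀, e⟩ := hzτ
      have hy : g (rot k' * z₀) ∈ S.tile τ' := by rw [hk']; exact ⟨z₀, hz₀, rfl⟩
      obtain ⟨y, hy, e'⟩ := hy
      refine ⟨y, hy, ?_⟩
      calc dist y (S.v x') = dist (S.place τ' y) (S.vtx τ' x') := ((S.place τ').dist_eq _ _).symm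
        _ = dist (g (rot k * z₀)) (g 0) := by
            rw [e', hx', g.dist_eq, g.dist_eq, dist_zero_right, dist_zero_right, norm_mul, norm_mul,
              norm_rot, norm_rot]
        _ = dist (S.place τ z) (S.vtx τ x) := by rw [← e, hx]
        _ = dist z (S.v x) := (S.place τ).dist_eq _ _
    have hgD : S.vtx τD 3 = g 0 := by rw [hstar.D_eq, hgB]
    have hgE : S.vtx τE 4 = g 0 := by rw [hstar.E_eq, hgB]
    exact distances_ne S (htrans τE τB 4 1 hgE hgB.symm _ (S.vertex_mem_region 2))
      (htrans τB τD 1 3 hgB.symm hgD _ (S.vertex_mem_region 4))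

end Shape

/-! ### Convex tiles meet edge-to-edge -/

/-- Among three points on a line, one lies between the two others. -/
theorem orient_ne_zero_of_convexIndependent {V : Fin 5 → ℂ} (h : ConvexIndependent ℝ V)
    {x y z : Fin 5} (hxy : x ≠ y) (hyz : y ≠ z) (hzx : z ≠ x) : orient (V x) (V y) (V z) ≠ 0 := by
  intro h0
  have hne : V y - V x ≠ 0 := sub_ne_zero.2 fun e => hxy (h.injective e).symm
  have him : ((V z - V x) / (V y - V x)).im = 0 := by
    have : ((V z - V x) / (V y - V x)).im =
        orient (V x) (V y) (V z) / normSq (V y - V x) := by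
      rw [div_im, ← sub_div]
      simp only [orient, sub_re, sub_im]
      ring
    rw [this, h0, zero_div]
  obtain ⟨t, ht⟩ : ∃ t : ℝ, V z - V x = t * (V y - V x) :=
    ⟨((V z - V x) / (V y - V x)).re, by
      rw [← div_eq_iff hne]; apply Complex.ext <;> simp [him]⟩
  have key : ∀ {i j k : Fin 5}, i ≠ j → i ≠ k → V i ∉ segment ℝ (V j) (V k) := by
    intro i j k hij hik hmem
    have := h {j, k} i (by rwa [Set.image_pair, convexHull_pair])
    simp [hij, hik] at this
  have mem : ∀ {P Q R : ℂ} (s : ℝ), 0 ≤ s → s ≤ 1 → R = P + s * (Q - P) → R ∈ segment ℝ P Q := by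
    intro P Q R s h0 h1 e
    refine ⟨1 - s, s, by linarith, h0, by ring, ?_⟩
    rw [e, real_smul, real_smul]; push_cast; ring
  have hz : V z = V x + t * (V y - V x) := by rw [← ht]; ring
  rcases lt_or_ge t 0 with h1 | h1
  · have h1' : (1 : ℝ) - t ≠ 0 := by linarith
    have q : V x ∈ segment ℝ (V z) (V y) := by
      refine mem ((-t) / (1 - t)) (div_nonneg (by linarith) (by linarith))
        ((div_le_one (by linarith)).2 (by linarith)) ?_
      have : (1 : ℂ) - t ≠ 0 := by exact_mod_cast h1'
      rw [hz]; push_cast; field_simp; ring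
    exact key hzx.symm hxy q
  rcases le_or_gt t 1 with h2 | h2
  · exact key hzx hyz.symm (mem t h1 h2 hz)
  · have h3 : (t : ℂ) ≠ 0 := by
      have : t ≠ 0 := by linarith
      exact_mod_cast this
    refine key hxy.symm hyz (mem t⁻¹ (by positivity) (inv_le_one_of_one_le₀ h2.le)
      (P := V x) (Q := V z) ?_)
    rw [ht]; push_cast; field_simp; ring

/-- An open half-plane stays convex when a segment on its boundary line is added. -/
theorem convex_pos_union_segment {P Q : ℂ} (ε : ℝ) :
    Convex ℝ ({z | 0 < ε * orient P Q z} ∪ segment ℝ P Q) := by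
  have aff : ∀ (x y : ℂ) (a b : ℝ), a + b = 1 →
      orient P Q (a • x + b • y) = a * orient P Q x + b * orient P Q y := by
    intro x y a b hab
    obtain rfl : a = 1 - b := by linarith
    simp [orient]; ring
  have nn : ∀ z ∈ segment ℝ P Q, orient P Q z = 0 := by
    rintro _ ⟨a, b, -, -, hab, rfl⟩
    rw [aff _ _ _ _ hab, orient_self_outer, orient_self_right]; ring
  rw [convex_iff_forall_pos]
  intro x hx y hy a b ha hb hab
  by_cases hs : x ∈ segment ℝ P Q ∧ y ∈ segment ℝ P Q
  · exact Or.inr (convex_segment P Q hs.1 hs.2 ha.le hb.le hab)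
  · left
    rw [Set.mem_ofPred_eq, aff _ _ _ _ hab]
    rcases hx with hx | hx <;> rcases hy with hy | hy
    · have h1 := mul_pos ha hx
      have h2 := mul_pos hb hy
      linarith
    · have h1 := mul_pos ha hx
      rw [nn y hy]; linarith
    · have h2 := mul_pos hb hy
      rw [nn x hx]; linarith
    · exact absurd ⟨hx, hy⟩ hs

namespace Shape
variable {n : ℕ} [NeZero n] (S : Shape n)

/-- Every edge of a tile is an edge of another tile, on the other side. -/
theorem exists_neighbour (τ : Idx n) (x : Fin 5) : ∃ (τ' : Idx n) (y : Fin 5),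
    (S.vtx τ' y = S.vtx τ x ∧ S.vtx τ' (y + 1) = S.vtx τ (x + 1) ∧ sgn τ' = -sgn τ) ∨
      (S.vtx τ' y = S.vtx τ (x + 1) ∧ S.vtx τ' (y + 1) = S.vtx τ x ∧ sgn τ' = sgn τ) := by
  fin_cases x
  · obtain ⟨τD, τE, h⟩ := S.exists_apexStar_B τ
    rcases h.sides with ⟨-, hA, hs⟩ | ⟨-, hA, hs⟩
    · exact ⟨τE, 4, Or.inr ⟨h.E_eq, hA, hs.symm⟩⟩
    · exact ⟨τD, 2, Or.inl ⟨hA, h.D_eq, by rw [h.sgn_eq, hs, neg_neg]⟩⟩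
  · obtain ⟨τD, τE, h⟩ := S.exists_apexStar_B τ
    rcases h.sides with ⟨hC, -, hs⟩ | ⟨hC, -, hs⟩
    · exact ⟨τD, 2, Or.inr ⟨hC, h.D_eq, by rw [h.sgn_eq, hs]⟩⟩
    · exact ⟨τE, 4, Or.inl ⟨h.E_eq, hC, by rw [hs, neg_neg]⟩⟩
  · obtain ⟨τB, h⟩ := S.exists_apexStar_D τ
    rcases h.sides with ⟨hC, -, hs⟩ | ⟨-, hC, hs⟩
    · exact ⟨τB, 1, Or.inr ⟨h.D_eq.symm, hC.symm, by rw [hs, h.sgn_eq]⟩⟩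
    · exact ⟨τB, 0, Or.inl ⟨hC.symm, h.D_eq.symm, by rw [hs, h.sgn_eq]⟩⟩
  · obtain ⟨τB, h⟩ := S.exists_apexStar_D τ
    exact ⟨partner τ, 3, Or.inr ⟨h.ED_eq.symm, h.E_eq.trans h.D_eq.symm, h.sgn_eq.symm⟩⟩
  · obtain ⟨τB, h⟩ := S.exists_apexStar_E τ
    rcases h.sides with ⟨-, hA, hs⟩ | ⟨hA, -, hs⟩
    · exact ⟨τB, 0, Or.inr ⟨hA.symm, h.E_eq.symm, hs⟩⟩
    · exact ⟨τB, 1, Or.inl ⟨h.E_eq.symm, hA.symm, hs⟩⟩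

/-- Every edge of a tile bounds a triangle of the fan. -/
theorem exists_tri_subset (τ : Idx n) (x : Fin 5) : ∃ R,
    0 < sgn τ * orient (S.vtx τ x) (S.vtx τ (x + 1)) R ∧
      tri (S.vtx τ x) (S.vtx τ (x + 1)) R ⊆ S.tile τ := by
  have h1 := S.sgn_mul_orient_BCD τ
  have h2 := S.sgn_mul_orient_BDE τ
  have h3 := S.sgn_mul_orient_BEA τ
  have t1 := S.tri_BCD_subset τ
  have t2 := S.tri_BDE_subset τ
  have t3 := S.tri_BEA_subset τ
  fin_cases x
  · exact ⟨S.vtx τ 4, by rw [orient_rotate] at h3; exact h3, by rw [tri_rotate] at t3; exact t3⟩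
  · exact ⟨S.vtx τ 3, h1, t1⟩
  · exact ⟨S.vtx τ 1, by rw [orient_rotate]; exact h1, by rw [tri_rotate]; exact t1⟩
  · exact ⟨S.vtx τ 1, by rw [orient_rotate]; exact h2, by rw [tri_rotate]; exact t2⟩
  · exact ⟨S.vtx τ 1, by rw [orient_rotate]; exact h3, by rw [tri_rotate]; exact t3⟩

/-- Triangles of two tiles on the two sides of a common edge `P Q` cover a neighbourhood of an inner
point of that edge. -/
theorem eventually_mem_of_sides {τ τ' : Idx n} {P Q R R' p : ℂ} {ε : ℝ} (hε : ε = 1 ∨ ε = -1)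
    (hR : 0 < ε * orient P Q R) (hR' : ε * orient P Q R' < 0)
    (h : tri P Q R ⊆ S.tile τ) (h' : tri P Q R' ⊆ S.tile τ')
    (hp : p ∈ segment ℝ P Q) (hP : p ≠ P) (hQ : p ≠ Q) :
    ∀ᶠ z in 𝓝 p, ∃ τ₁ ∈ ({τ, τ'} : Set (Idx n)), z ∈ S.tile τ₁ := by
  have key : ∀ {U U' : ℂ}, 0 < orient P Q U → orient P Q U' < 0 →
      ∀ᶠ z in 𝓝 p, z ∈ tri P Q U' ∨ z ∈ tri P Q U := by
    intro U U' hU hU'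
    have := eventually_mem_tri_or_tri (R := U') (S := U) (by rw [orient_swap]; linarith) hU hp hP hQ
    simpa only [tri_swap] using this
  rcases hε with rfl | rfl
  · filter_upwards [key (by linarith : 0 < orient P Q R) (by linarith : orient P Q R' < 0)]
      with z hz
    rcases hz with hz | hz
    · exact ⟨τ', by simp, h' hz⟩
    · exact ⟨τ, by simp, h hz⟩
  · filter_upwards [key (by linarith : 0 < orient P Q R') (by linarith : orient P Q R < 0)]
      with z hz
    rcases hz with hz | hz
    · exact ⟨τ, by simp, h hz⟩
    · exact ⟨τ', by simp, h' hz⟩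

/-- A common point of two different tiles lies on an edge of the first one, as it is not an inner
point. -/
theorem exists_mem_edge {τ τ' : Idx n} (hne : τ ≠ τ') {p : ℂ} (hp : p ∈ S.tile τ)
    (hp' : p ∈ S.tile τ') : ∃ x, p ∈ segment ℝ (S.vtx τ x) (S.vtx τ (x + 1)) := by
  obtain ⟨q, hq, rfl⟩ := hp
  by_contra! hno
  have hb : q ∉ boundary S.v := by
    intro hb
    obtain ⟨x, hx⟩ := Set.mem_iUnion.1 hb
    refine hno x ?_
    unfold vtx
    rw [← image_segment_isometry]
    exact Set.mem_image_of_mem _ hx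
  rw [region_eq_fan S.isFan] at hq
  have hn : S.tile τ ∈ 𝓝 (S.place τ q) := by
    unfold tile
    rw [region_eq_fan S.isFan]
    exact (S.place τ).toHomeomorph.isOpenMap.image_mem_nhds (fan_mem_nhds S.isFan hq hb)
  refine hne (S.mem_of_eventually_mem (L := {τ}) ?_ hp').symm
  filter_upwards [hn] with z hz
  exact ⟨τ, rfl, hz⟩

theorem image_edge (τ : Idx n) (x : Fin 5) :
    edge (S.place τ ∘ S.v) x = segment ℝ (S.vtx τ x) (S.vtx τ (x + 1)) := rfl

/-- If a convex tile shares an inner point of one of its edges with another tile, then the other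
tile is the one across this edge, and the two tiles lie on different sides of it. -/
theorem inter_eq_edge (hv : IsConvexPentagon S.v) {τ τ' : Idx n} (hne : τ ≠ τ') {p : ℂ} {x : Fin 5}
    (hp' : p ∈ S.tile τ') (hp : p ∈ segment ℝ (S.vtx τ x) (S.vtx τ (x + 1)))
    (h0 : p ≠ S.vtx τ x) (h1 : p ≠ S.vtx τ (x + 1)) :
    ∃ y, S.tile τ ∩ S.tile τ' = edge (S.place τ ∘ S.v) x ∧
      S.tile τ ∩ S.tile τ' = edge (S.place τ' ∘ S.v) y := by
  obtain ⟨τ₁, y, hy⟩ := S.exists_neighbour τ x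
  obtain ⟨R, hR, hRt⟩ := S.exists_tri_subset τ x
  obtain ⟨R', hR', hRt'⟩ := S.exists_tri_subset τ₁ y
  have hR'' : sgn τ * orient (S.vtx τ x) (S.vtx τ (x + 1)) R' < 0 ∧
      tri (S.vtx τ x) (S.vtx τ (x + 1)) R' ⊆ S.tile τ₁ := by
    rcases hy with ⟨e0, e1, hs⟩ | ⟨e0, e1, hs⟩
    · rw [e0, e1] at hR' hRt'
      rw [hs] at hR'
      exact ⟨by linarith, hRt'⟩
    · rw [e0, e1] at hR' hRt'
      rw [hs, ← orient_rotate, orient_swap] at hR'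
      rw [← tri_rotate, tri_swap] at hRt'
      exact ⟨by linarith, hRt'⟩
  have hτ : τ' = τ₁ := by
    have := S.mem_of_eventually_mem (S.eventually_mem_of_sides (sgn_cases τ) hR hR''.1 hRt hR''.2
      hp h0 h1) hp'
    rcases this with h | h
    · exact absurd h.symm hne
    · exact h
  subst hτ
  -- By convexity, a tile lies on one side of its edges.
  have side : ∀ (τ : Idx n) (x : Fin 5) (τ' : Idx n) (p : ℂ), τ ≠ τ' → p ∈ S.tile τ' →
      p ∈ segment ℝ (S.vtx τ x) (S.vtx τ (x + 1)) → p ≠ S.vtx τ x → p ≠ S.vtx τ (x + 1) →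
      S.tile τ ⊆ {z | 0 < sgn τ * orient (S.vtx τ x) (S.vtx τ (x + 1)) z} ∪
        segment ℝ (S.vtx τ x) (S.vtx τ (x + 1)) := by
    intro τ x τ' p hne hp' hp h0 h1
    obtain ⟨R, hR, hRt⟩ := S.exists_tri_subset τ x
    have hconv : Convex ℝ (S.tile τ) := convex_image_isometry _ hv.1
    have hvert : ∀ z, S.vtx τ z ∈ {z | 0 < sgn τ * orient (S.vtx τ x) (S.vtx τ (x + 1)) z} ∪
        segment ℝ (S.vtx τ x) (S.vtx τ (x + 1)) := by
      intro z
      by_cases hzx : z = x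
      · subst hzx; exact Or.inr (left_mem_segment _ _ _)
      by_cases hzy : z = x + 1
      · subst hzy; exact Or.inr (right_mem_segment _ _ _)
      left
      by_contra! hle
      have hne0 : sgn τ * orient (S.vtx τ x) (S.vtx τ (x + 1)) (S.vtx τ z) ≠ 0 := by
        unfold vtx
        rw [orient_place, ← mul_assoc, sgn_mul_self, one_mul]
        exact orient_ne_zero_of_convexIndependent hv.2 (by fin_cases x <;> decide) (Ne.symm hzy) hzx
      have := S.eventually_mem_of_sides (τ := τ) (τ' := τ) (sgn_cases τ) hR
        (lt_of_le_of_ne (not_lt.1 hle) hne0) hRt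
        (tri_subset hconv (S.vtx_mem_tile _ _) (S.vtx_mem_tile _ _) (S.vtx_mem_tile _ _)) hp h0 h1
      have := S.mem_of_eventually_mem this hp'
      simp at this
      exact hne this.symm
    have hc := convex_image_isometry (S.place τ).symm
      (convex_pos_union_segment (P := S.vtx τ x) (Q := S.vtx τ (x + 1)) (sgn τ))
    have hsub := S.region_subset_convex hc fun z => ⟨_, hvert z, by simp [vtx]⟩
    rintro _ ⟨q, hq, rfl⟩
    obtain ⟨q', hq', e⟩ := hsub hq
    rw [← e]
    simpa using hq'
  have hseg : segment ℝ (S.vtx τ' y) (S.vtx τ' (y + 1)) =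
      segment ℝ (S.vtx τ x) (S.vtx τ (x + 1)) := by
    rcases hy with ⟨e0, e1, -⟩ | ⟨e0, e1, -⟩
    · rw [e0, e1]
    · rw [e0, e1, segment_symm]
  have hpτ : p ∈ S.tile τ := hRt (segment_subset_tri _ _ _ hp)
  have hpy0 : p ≠ S.vtx τ' y ∧ p ≠ S.vtx τ' (y + 1) := by
    rcases hy with ⟨e0, e1, -⟩ | ⟨e0, e1, -⟩
    · rw [e0, e1]; exact ⟨h0, h1⟩
    · rw [e0, e1]; exact ⟨h1, h0⟩
  have s1 := side τ x τ' p hne hp' hp h0 h1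
  have s2 := side τ' y τ p hne.symm hpτ (hseg ▸ hp) hpy0.1 hpy0.2
  have main : S.tile τ ∩ S.tile τ' = segment ℝ (S.vtx τ x) (S.vtx τ (x + 1)) := by
    apply Set.Subset.antisymm
    · rintro q ⟨hq, hq'⟩
      rcases s1 hq with h | h
      · rcases s2 hq' with h' | h'
        · exfalso
          simp only [Set.mem_ofPred_eq] at h h'
          rcases hy with ⟨e0, e1, hs⟩ | ⟨e0, e1, hs⟩
          · rw [e0, e1, hs] at h'
            linarith
          · rw [e0, e1, hs, ← orient_rotate, orient_swap] at h'
            linarith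
        · rwa [hseg] at h'
      · exact h
    · intro q hq
      exact ⟨hRt (segment_subset_tri _ _ _ hq), hR''.2 (segment_subset_tri _ _ _ hq)⟩
  exact ⟨y, by rw [main, image_edge], by rw [main, image_edge, hseg]⟩

theorem isEdgeToEdge (hv : IsConvexPentagon S.v) : IsEdgeToEdge S.v (S.tiling (n := n)) := by
  rintro _ ⟨τ, rfl⟩ _ ⟨τ', rfl⟩ hT
  have hne : τ ≠ τ' := fun h => hT (by rw [h])
  refine ⟨S.place τ, S.place τ', rfl, rfl, ?_⟩
  by_cases hA : ∃ p x, p ∈ S.tile τ' ∧ p ∈ segment ℝ (S.vtx τ x) (S.vtx τ (x + 1)) ∧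
      p ≠ S.vtx τ x ∧ p ≠ S.vtx τ (x + 1)
  · obtain ⟨p, x, hp', hp, h0, h1⟩ := hA
    obtain ⟨y, h⟩ := S.inter_eq_edge hv hne hp' hp h0 h1
    exact Or.inr (Or.inr ⟨x, y, h⟩)
  by_cases hB : ∃ p x, p ∈ S.tile τ ∧ p ∈ segment ℝ (S.vtx τ' x) (S.vtx τ' (x + 1)) ∧
      p ≠ S.vtx τ' x ∧ p ≠ S.vtx τ' (x + 1)
  · obtain ⟨p, x, hp', hp, h0, h1⟩ := hB
    obtain ⟨y, h, h'⟩ := S.inter_eq_edge hv hne.symm hp' hp h0 h1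
    rw [Set.inter_comm] at h h'
    exact Or.inr (Or.inr ⟨y, x, h', h⟩)
  -- Now the two tiles share only vertices of both, hence at most one point.
  have vert : ∀ {τ τ' : Idx n}, τ ≠ τ' → (¬ ∃ p x, p ∈ S.tile τ' ∧
      p ∈ segment ℝ (S.vtx τ x) (S.vtx τ (x + 1)) ∧ p ≠ S.vtx τ x ∧ p ≠ S.vtx τ (x + 1)) →
      ∀ p ∈ S.tile τ, p ∈ S.tile τ' → ∃ x, p = S.vtx τ x := by
    intro τ τ' hne hno p hp hp'
    obtain ⟨x, hx⟩ := S.exists_mem_edge hne hp hp'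
    by_contra! h
    exact hno ⟨p, x, hp', hx, h _, h _⟩
  have hconv : Convex ℝ (S.tile τ ∩ S.tile τ') :=
    (convex_image_isometry _ hv.1).inter (convex_image_isometry _ hv.1)
  have hsub : (S.tile τ ∩ S.tile τ').Subsingleton := by
    by_contra hnt
    rw [Set.not_subsingleton_iff] at hnt
    refine hconv.isPreconnected.infinite_of_nontrivial hnt
      ((Set.finite_range (S.vtx τ)).subset ?_)
    rintro p ⟨hp, hp'⟩
    obtain ⟨x, hx⟩ := vert hne hA p hp hp'
    exact ⟨x, hx.symm⟩
  rcases hsub.eq_empty_or_singleton with h | ⟨p, h⟩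
  · exact Or.inl h
  · obtain ⟨hp, hp'⟩ : p ∈ S.tile τ ∩ S.tile τ' := h ▸ rfl
    obtain ⟨x, hx⟩ := vert hne hA p hp hp'
    obtain ⟨y, hy⟩ := vert hne.symm hB p hp' hp
    refine Or.inr (Or.inl ⟨x, y, ?_, ?_⟩)
    · rw [h, hx]; rfl
    · rw [h, hy]; rfl

end Shape

/-! ### The pentagon in normal position satisfies the conditions -/

theorem exists_of_mem_segment {P Q z : ℂ} (h : z ∈ segment ℝ P Q) :
    ∃ t : ℝ, 0 ≤ t ∧ t ≤ 1 ∧ z = P + t * (Q - P) := by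
  rw [segment_eq_image'] at h
  obtain ⟨t, ⟨h0, h1⟩, rfl⟩ := h
  exact ⟨t, h0, h1, by simp⟩

namespace Shape
variable {n : ℕ} (S : Shape n)

theorem mem_AB {z : ℂ} (h : z ∈ edge S.v 0) :
    ∃ t : ℝ, 0 ≤ t ∧ t ≤ 1 ∧ z = S.a + ⟨-(t * S.c), t * S.s⟩ := by
  obtain ⟨t, h0, h1, rfl⟩ := exists_of_mem_segment h
  refine ⟨1 - t, by linarith, by linarith, ?_⟩
  apply Complex.ext <;> simp [v_zero, v_one] <;> ring

theorem mem_BC {z : ℂ} (h : z ∈ edge S.v 1) :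
    ∃ t : ℝ, 0 ≤ t ∧ t ≤ 1 ∧ z = S.a + ⟨t * S.c, -(t * S.s)⟩ * S.w := by
  obtain ⟨t, h0, h1, rfl⟩ := exists_of_mem_segment h
  refine ⟨t, by linarith, by linarith, ?_⟩
  apply Complex.ext <;> simp [v_two, v_one] <;> ring

theorem mem_CD {z : ℂ} (h : z ∈ edge S.v 2) :
    ∃ t : ℝ, 0 ≤ t ∧ t ≤ 1 ∧ z = S.a + ⟨(1 + t) * S.c, -((1 - t) * S.s)⟩ * S.w := by
  obtain ⟨t, h0, h1, rfl⟩ := exists_of_mem_segment h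
  refine ⟨t, by linarith, by linarith, ?_⟩
  apply Complex.ext <;> simp [v_two, v_three] <;> ring

theorem mem_DE {z : ℂ} (h : z ∈ edge S.v 3) :
    ∃ t : ℝ, 0 ≤ t ∧ t ≤ 1 ∧ z = S.a + (⟨t * (2 * S.c), 0⟩ * S.w + ⟨0, (1 - t) * (2 * S.s)⟩) := by
  obtain ⟨t, h0, h1, rfl⟩ := exists_of_mem_segment h
  refine ⟨1 - t, by linarith, by linarith, ?_⟩
  apply Complex.ext <;> simp [v_three, v_four] <;> ring

theorem mem_EA {z : ℂ} (h : z ∈ edge S.v 4) :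
    ∃ t : ℝ, 0 ≤ t ∧ t ≤ 1 ∧ z = S.a + ⟨-(t * S.c), (2 - t) * S.s⟩ := by
  obtain ⟨t, h0, h1, rfl⟩ := exists_of_mem_segment h
  refine ⟨t, by linarith, by linarith, ?_⟩
  apply Complex.ext
  · simp [v_zero, v_four]
  · simp [v_zero, v_four]; ring

/-- Seen from `B`, the edges `EA` and `AB` lie in the closed second quadrant, while `BC` and `CD`
lie on the other side of the imaginary axis if `0 ≤ Im w`, and of the real axis if `Im w < 0`. -/
theorem sides_of_B : ∃ f : ℂ →ₗ[ℝ] ℝ, (∀ x y : ℝ, x ≤ 0 → 0 ≤ y → f ⟨x, y⟩ ≤ 0) ∧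
    ∀ x y : ℝ, 0 < x → y ≤ 0 → 0 < f (⟨x, y⟩ * S.w) := by
  have hp := S.re_w
  rcases le_or_gt 0 S.w.im with h | h
  · refine ⟨reLm, fun x y hx _ => hx, fun x y hx hy => ?_⟩
    have := mul_pos hx hp
    have := mul_nonneg (neg_nonneg.2 hy) h
    simp
    linarith
  · refine ⟨-imLm, fun x y _ hy => by simpa using hy, fun x y hx hy => ?_⟩
    have := mul_pos hx (neg_pos.2 h)
    have := mul_nonneg (neg_nonneg.2 hy) hp.le
    simp
    linarith

/-- Points of two edges are compared in coordinates with origin `B`, with respect to the axes `1`, `i`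
or `w`, `i w`, or by the functional of `sides_of_B`. -/
theorem isSimplePentagon : IsSimplePentagon S.v := by
  have hc := S.c_pos
  have hs := S.s_pos
  have hp := S.re_w
  have hw := S.w_ne_zero
  obtain ⟨f, hf, hf'⟩ := S.sides_of_B
  have vert : ∀ i, S.v (i + 1) ∈ edge S.v i ∩ edge S.v (i + 1) := fun i =>
    ⟨right_mem_segment _ _ _, left_mem_segment _ _ _⟩
  have cons : ∀ i, (∀ z ∈ edge S.v i, z ∈ edge S.v (i + 1) → z = S.v (i + 1)) →
      edge S.v i ∩ edge S.v (i + 1) = {S.v (i + 1)} := fun i h =>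
    Set.Subset.antisymm (fun z hz => h z hz.1 hz.2) (Set.singleton_subset_iff.2 (vert i))
  -- Cancel `w` in the coordinates of the points seen from `B`.
  have key : ∀ {x y x' y' : ℝ}, (S.a + ⟨x, y⟩ * S.w = S.a + ⟨x', y'⟩ * S.w) → x = x' ∧ y = y' := by
    intro x y x' y' h
    have := mul_right_cancel₀ hw (add_left_cancel h)
    exact ⟨congrArg re this, congrArg im this⟩
  have key' : ∀ {x y x' u : ℝ}, (S.a + ⟨x, y⟩ * S.w = S.a + (⟨x', 0⟩ * S.w + ⟨0, u⟩)) →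
      y = u * S.w.re := by
    intro x y x' u h
    have h1 := add_left_cancel h
    have e1 := congrArg re h1
    have e2 := congrArg im h1
    simp at e1 e2
    have := S.sq_w
    linear_combination (-S.w.im) * e1 + S.w.re * e2 - y * this
  refine ⟨S.injective_v, fun i => cons i fun z hz hz' => ?_, fun i => ?_⟩
  · fin_cases i
    · obtain ⟨t, h0, h1, rfl⟩ := S.mem_AB hz
      obtain ⟨u, k0, k1, h⟩ := S.mem_BC hz'
      have e := add_left_cancel h
      rcases k0.eq_or_lt with rfl | k0
      · rw [h]
        change _ = S.a
        apply Complex.ext <;> simp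
      · have q1 := hf _ _ (by simp; positivity : -(t * S.c) ≤ 0) (by positivity : 0 ≤ t * S.s)
        have q2 := hf' (u * S.c) (-(u * S.s)) (by positivity) (by simp; positivity)
        rw [e] at q1
        linarith
    · obtain ⟨t, h0, h1, rfl⟩ := S.mem_BC hz
      obtain ⟨u, k0, k1, h⟩ := S.mem_CD hz'
      obtain ⟨e1, e2⟩ := key h
      have e1' := mul_right_cancel₀ hc.ne' e1
      obtain rfl : t = 1 := by linarith
      change _ = S.a + S.a * S.w
      congr 1
      simp [a]
    · obtain ⟨t, h0, h1, rfl⟩ := S.mem_CD hz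
      obtain ⟨u, k0, k1, h⟩ := S.mem_DE hz'
      have e := key' h
      have hu := mul_nonneg (mul_nonneg (sub_nonneg.2 k1) (by positivity : 0 ≤ 2 * S.s)) hp.le
      have ht := mul_nonneg (sub_nonneg.2 h1) hs.le
      have : (1 - t) * S.s = 0 := by linarith
      obtain rfl : t = 1 := by
        rcases mul_eq_zero.1 this with h | h <;> linarith
      change _ = S.a + S.a * S.w + S.b * S.w
      apply Complex.ext <;> simp <;> ring
    · obtain ⟨t, h0, h1, rfl⟩ := S.mem_DE hz
      obtain ⟨u, k0, k1, h⟩ := S.mem_EA hz'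
      have e := congrArg re (add_left_cancel h)
      simp at e
      have q1 : 0 ≤ t * (2 * S.c) * S.w.re := by positivity
      have q2 : 0 ≤ u * S.c := by positivity
      have : u * S.c = 0 := by linarith
      obtain rfl : u = 0 := by
        rcases mul_eq_zero.1 this with h | h <;> linarith
      rw [h]
      change _ = S.b
      apply Complex.ext <;> simp; ring
    · obtain ⟨t, h0, h1, rfl⟩ := S.mem_EA hz
      obtain ⟨u, k0, k1, h⟩ := S.mem_AB hz'
      have h' := add_left_cancel h
      have e1 := congrArg re h'
      have e2 := congrArg im h'
      simp at e1 e2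
      have e2' : 2 - t = u := by rcases e2 with h | h <;> linarith
      obtain rfl : t = 1 := by linarith
      change _ = (0 : ℂ)
      apply Complex.ext <;> simp; ring
  · rw [Set.disjoint_left]
    intro z hz hz'
    fin_cases i
    · obtain ⟨t, h0, h1, rfl⟩ := S.mem_AB hz
      obtain ⟨u, k0, k1, h⟩ := S.mem_CD hz'
      have q1 := hf _ _ (by simp; positivity : -(t * S.c) ≤ 0) (by positivity : 0 ≤ t * S.s)
      have q2 := hf' ((1 + u) * S.c) (-((1 - u) * S.s)) (by positivity)
        (by have := mul_nonneg (sub_nonneg.2 k1) hs.le; linarith)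
      rw [add_left_cancel h] at q1
      linarith
    · obtain ⟨t, h0, h1, rfl⟩ := S.mem_BC hz
      obtain ⟨u, k0, k1, h⟩ := S.mem_DE hz'
      have e := key' h
      have ht : 0 ≤ t * S.s := by positivity
      have hu := mul_nonneg (mul_nonneg (sub_nonneg.2 k1) (by positivity : 0 ≤ 2 * S.s)) hp.le
      have hu0 : (1 - u) * (2 * S.s) * S.w.re = 0 := by linarith
      have hu1 : 1 - u = 0 := by
        simpa [hs.ne', hp.ne'] using hu0
      have ht0 : t * S.s = 0 := by linarith
      obtain rfl : t = 0 := by simpa [hs.ne'] using ht0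
      have e1 := congrArg re (add_left_cancel h)
      simp [hu1] at e1
      obtain rfl : u = 1 := by linarith
      simp [hc.ne', hp.ne'] at e1
    · obtain ⟨t, h0, h1, rfl⟩ := S.mem_CD hz
      obtain ⟨u, k0, k1, h⟩ := S.mem_EA hz'
      have q1 := hf (-(u * S.c)) ((2 - u) * S.s) (by simp; positivity)
        (mul_nonneg (by linarith) hs.le)
      have q2 := hf' ((1 + t) * S.c) (-((1 - t) * S.s)) (by positivity)
        (by have := mul_nonneg (sub_nonneg.2 h1) hs.le; linarith)
      rw [← add_left_cancel h] at q1
      linarith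
    · obtain ⟨t, h0, h1, rfl⟩ := S.mem_DE hz
      obtain ⟨u, k0, k1, h⟩ := S.mem_AB hz'
      have h' := add_left_cancel h
      have e1 := congrArg re h'
      simp at e1
      have q1 : 0 ≤ t * (2 * S.c) * S.w.re := by positivity
      have q2 : 0 ≤ u * S.c := by positivity
      have t0 : t * (2 * S.c) * S.w.re = 0 := by linarith
      have u0 : u * S.c = 0 := by linarith
      obtain rfl : t = 0 := by simpa [hc.ne', hp.ne'] using t0
      obtain rfl : u = 0 := by simpa [hc.ne'] using u0
      have e2 := congrArg im h'
      simp [hs.ne'] at e2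
    · obtain ⟨t, h0, h1, rfl⟩ := S.mem_EA hz
      obtain ⟨u, k0, k1, h⟩ := S.mem_BC hz'
      have h' := add_left_cancel h
      rcases k0.eq_or_lt with rfl | k0
      · have e2 := congrArg im h'
        simp [hs.ne'] at e2
        linarith
      · have q1 := hf (-(t * S.c)) ((2 - t) * S.s) (by simp; positivity)
          (mul_nonneg (by linarith) hs.le)
        have q2 := hf' (u * S.c) (-(u * S.s)) (by positivity) (by simp; positivity)
        rw [h'] at q1
        linarith

/-- The prototile for the angle `θ` and the edge length `r`. -/
def ofAngle (hn : 3 ≤ n) {θ r : ℝ} (hθ₀ : 0 < θ) (hθ₁ : θ < Real.pi) (hr : 0 < r) : Shape n where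
  three_le := hn
  r := r
  r_pos := hr
  w := exp ((Real.pi / 2 - θ : ℝ) * I)
  norm_w := norm_exp_ofReal_mul_I _
  re_w := by
    rw [exp_ofReal_mul_I_re, Real.cos_pi_div_two_sub]
    exact Real.sin_pos_of_pos_of_lt_pi hθ₀ hθ₁

theorem a_eq : S.a = S.r * exp ((-(Real.pi / n) : ℝ) * I) := by
  apply Complex.ext
  · rw [re_ofReal_mul, exp_ofReal_mul_I_re, Real.cos_neg]; rfl
  · rw [im_ofReal_mul, exp_ofReal_mul_I_im, Real.sin_neg, a_im, s]; ring

theorem b_eq : S.b = S.r * exp ((Real.pi / n : ℝ) * I) := by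
  apply Complex.ext
  · rw [re_ofReal_mul, exp_ofReal_mul_I_re]; rfl
  · rw [im_ofReal_mul, exp_ofReal_mul_I_im]; rfl

end Shape

/-- The angle `δ` is the argument of `(cot (π / n) - cos θ) + i sin θ`. Multiplying this number by
`exp (i θ)` gives `cot (π / n) exp (i θ) - 1`, which has positive imaginary part, whence
`δ + θ < π`. -/
theorem delta_spec {n : ℕ} (hn : 3 ≤ n) {θ : ℝ} (hθ₀ : 0 < θ) (hθ₁ : θ < Real.pi) :
    0 < delta n θ ∧ delta n θ + θ < Real.pi ∧ ∃ ρ : ℝ, 0 < ρ ∧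
      ρ * Real.sin (Real.pi / n) * Real.cos (delta n θ) =
        Real.cos (Real.pi / n) - Real.sin (Real.pi / n) * Real.cos θ ∧
      ρ * Real.sin (delta n θ) = Real.sin θ := by
  have S := Shape.ofAngle hn hθ₀ hθ₁ one_pos
  have h1 := S.angle_pos
  have h2 := S.angle_le
  have hsin := Real.sin_pos_of_pos_of_lt_pi hθ₀ hθ₁
  have hs : 0 < Real.sin (Real.pi / n) := Real.sin_pos_of_pos_of_lt_pi h1 (by linarith)
  have hc : 0 < Real.cos (Real.pi / n) := Real.cos_pos_of_mem_Ioo ⟨by linarith, by linarith⟩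
  have hcot : Real.tan (Real.pi / 2 - Real.pi / n) =
      Real.cos (Real.pi / n) / Real.sin (Real.pi / n) := by
    rw [Real.tan_pi_div_two_sub, Real.tan_eq_sin_div_cos, inv_div]
  unfold delta
  set z : ℂ := ⟨Real.tan (Real.pi / 2 - Real.pi / n) - Real.cos θ, Real.sin θ⟩ with hz
  have him : z.im = Real.sin θ := rfl
  have hre : z.re = Real.cos (Real.pi / n) / Real.sin (Real.pi / n) - Real.cos θ := by rw [hz, hcot]
  have hz0 : z ≠ 0 := by
    intro h
    rw [h] at him
    simp at him
    linarith
  have hρ : 0 < ‖z‖ := norm_pos_iff.2 hz0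
  have e1 : ‖z‖ * Real.cos z.arg = z.re := Complex.norm_mul_cos_arg z
  have e2 : ‖z‖ * Real.sin z.arg = z.im := Complex.norm_mul_sin_arg z
  have harg0 : 0 < z.arg := by
    refine lt_of_le_of_ne (arg_nonneg_iff.2 (by rw [him]; exact hsin.le)) fun h => ?_
    rw [← h, him] at e2
    simp at e2
    linarith
  refine ⟨harg0, ?_, ‖z‖, hρ, ?_, by rw [e2, him]⟩
  · by_contra! hle
    have h3 := arg_le_pi z
    have h4 : 0 ≤ Real.sin (z.arg + θ - Real.pi) :=
      Real.sin_nonneg_of_nonneg_of_le_pi (by linarith) (by linarith)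
    rw [Real.sin_sub_pi, Real.sin_add] at h4
    have h5 : ‖z‖ * (Real.sin z.arg * Real.cos θ + Real.cos z.arg * Real.sin θ) =
        Real.cos (Real.pi / n) / Real.sin (Real.pi / n) * Real.sin θ := by
      calc _ = (‖z‖ * Real.sin z.arg) * Real.cos θ + (‖z‖ * Real.cos z.arg) * Real.sin θ := by ring
        _ = _ := by rw [e1, e2, him, hre]; ring
    have h6 : 0 < Real.cos (Real.pi / n) / Real.sin (Real.pi / n) * Real.sin θ := by positivity
    rw [← h5] at h6
    have := pos_of_mul_pos_right h6 hρ.le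
    linarith
  · calc _ = (‖z‖ * Real.cos z.arg) * Real.sin (Real.pi / n) := by ring
      _ = _ := by rw [e1, hre]; field_simp

namespace Shape
variable {n : ℕ} (S : Shape n)

/-- The diagonal `BD` has the direction of `w = exp (i (π / 2 - θ))`, and the edge `DE` makes the
angle `δ` with it. -/
theorem v_four_sub_v_three (hn : 3 ≤ n) {θ : ℝ} (hθ₀ : 0 < θ) (hθ₁ : θ < Real.pi) : ∃ x : ℝ, 0 < x ∧
    (ofAngle hn hθ₀ hθ₁ one_pos).v 4 - (ofAngle hn hθ₀ hθ₁ one_pos).v 3 =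
      -(x * (exp ((Real.pi / 2 - θ : ℝ) * I) * exp ((-delta n θ : ℝ) * I))) := by
  obtain ⟨-, -, ρ, hρ, e1, e2⟩ := delta_spec hn hθ₀ hθ₁
  set S := ofAngle hn hθ₀ hθ₁ one_pos with hS
  have hs := S.s_pos
  have hc' : S.c = Real.cos (Real.pi / n) := one_mul _
  have hs' : S.s = Real.sin (Real.pi / n) := one_mul _
  refine ⟨2 * S.s * ρ, by positivity, ?_⟩
  rw [← hs', ← hc'] at e1
  have h1 := Real.cos_sq_add_sin_sq θ
  have hw : S.w = exp ((Real.pi / 2 - θ : ℝ) * I) := rfl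
  have hwre : S.w.re = Real.sin θ := by rw [hw, exp_ofReal_mul_I_re, Real.cos_pi_div_two_sub]
  have hwim : S.w.im = Real.cos θ := by rw [hw, exp_ofReal_mul_I_im, Real.sin_pi_div_two_sub]
  rw [← hw]
  have hE : ρ * exp ((-delta n θ : ℝ) * I) =
      ⟨ρ * Real.cos (delta n θ), -(ρ * Real.sin (delta n θ))⟩ := by
    apply Complex.ext
    · rw [re_ofReal_mul, exp_ofReal_mul_I_re, Real.cos_neg]
    · rw [im_ofReal_mul, exp_ofReal_mul_I_im, Real.sin_neg, mul_neg]
  have : ((2 * S.s * ρ : ℝ) : ℂ) * (S.w * exp ((-delta n θ : ℝ) * I)) =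
      S.w * ⟨2 * (ρ * S.s * Real.cos (delta n θ)), -(2 * S.s * (ρ * Real.sin (delta n θ)))⟩ := by
    calc _ = 2 * S.s * S.w * (ρ * exp ((-delta n θ : ℝ) * I)) := by push_cast; ring
      _ = _ := by
        rw [hE]
        apply Complex.ext <;> simp [-ofReal_cos, -ofReal_sin] <;> ring
  rw [this, e1, e2]
  apply Complex.ext
  · simp [v_three, v_four, hwre, hwim]
    ring
  · simp [v_three, v_four, hwre, hwim]
    linear_combination (-2 * S.s) * h1

theorem satisfiesConditions (hn : 3 ≤ n) {θ : ℝ} (hθ₀ : 0 < θ) (hθ₁ : θ < Real.pi) :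
    SatisfiesConditions n θ (ofAngle hn hθ₀ hθ₁ one_pos).v := by
  obtain ⟨hδ₀, hδ₁, -⟩ := delta_spec hn hθ₀ hθ₁
  obtain ⟨x, hx, hDE⟩ := v_four_sub_v_three hn hθ₀ hθ₁
  set S := ofAngle hn hθ₀ hθ₁ one_pos with hS
  have ha1 := S.angle_pos
  have ha2 := S.angle_le
  have hw : S.w = exp ((Real.pi / 2 - θ : ℝ) * I) := rfl
  have hr : S.r = 1 := rfl
  have ha := S.a_eq
  have hb := S.b_eq
  rw [hr, ofReal_one, one_mul] at ha hb
  have e2 : 2 * Real.pi / n = 2 * (Real.pi / n) := by ring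
  have hπ : exp ((Real.pi : ℝ) * I) = -1 := exp_pi_mul_I
  have add : ∀ s t : ℝ, exp ((s : ℂ) * I) * exp ((t : ℂ) * I) = exp (((s + t : ℝ) : ℂ) * I) := by
    intro s t; rw [← exp_add]; congr 1; push_cast; ring
  have neg : ∀ s t : ℝ, s = Real.pi + t → exp ((s : ℂ) * I) = -exp ((t : ℂ) * I) := by
    rintro s t rfl
    rw [← add, hπ, neg_one_mul]
  have d01 : dist (S.v 0) (S.v 1) = 1 := by
    rw [v_zero, v_one, dist_zero_left, norm_a]; rfl
  have d12 : dist (S.v 1) (S.v 2) = 1 := by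
    rw [v_one, v_two, dist_self_add_right, norm_mul, norm_a, S.norm_w, mul_one]; rfl
  have d23 : dist (S.v 2) (S.v 3) = 1 := by
    rw [v_two, v_three, dist_self_add_right, norm_mul, norm_b, S.norm_w, mul_one]; rfl
  have d40 : dist (S.v 4) (S.v 0) = 1 := by
    rw [v_four, v_zero, dist_zero_right, norm_b]; rfl
  refine ⟨S.isSimplePentagon, ⟨?_, ?_, 1, Or.inl rfl, ?_⟩, by rw [d01, d12], by rw [d12, d23],
    by rw [d23, d40]⟩
  · rw [e2]
    intro i
    fin_cases i <;> simp <;> constructor <;> linarith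
  · simp [Fin.sum_univ_five]
    ring
  · rw [e2]
    have h21 : S.v 2 - S.v 1 = S.a * S.w := by rw [v_two, v_one]; ring
    have h32 : S.v 3 - S.v 2 = S.b * S.w := by rw [v_two, v_three]; ring
    intro i
    fin_cases i
    · refine ⟨1, one_pos, ?_⟩
      change S.v 4 - S.v 0 = (1 : ℝ) * exp ((1 * (2 * (Real.pi / n)) : ℝ) * I) * (S.v 1 - S.v 0)
      rw [v_zero, v_one, v_four, sub_zero, sub_zero, ofReal_one, one_mul, one_mul, ha, hb, add]
      congr 3
      ring
    · refine ⟨1, one_pos, ?_⟩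
      change S.v 0 - S.v 1 = (1 : ℝ) * exp ((1 * (Real.pi / 2 + θ) : ℝ) * I) * (S.v 2 - S.v 1)
      rw [h21, v_zero, v_one, hw, ofReal_one, one_mul, one_mul, mul_left_comm, add,
        neg (Real.pi / 2 + θ + (Real.pi / 2 - θ)) 0 (by ring)]
      simp
    · refine ⟨1, one_pos, ?_⟩
      change S.v 1 - S.v 2 =
        (1 : ℝ) * exp ((1 * (Real.pi - 2 * (Real.pi / n)) : ℝ) * I) * (S.v 3 - S.v 2)
      rw [h32, ← neg_sub, h21, ofReal_one, one_mul, one_mul, ← mul_assoc, hb, add,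
        neg _ (-(Real.pi / n)) (by ring), ← ha, neg_mul]
    · refine ⟨x⁻¹, by positivity, ?_⟩
      change S.v 2 - S.v 3 =
        (x⁻¹ : ℝ) * exp ((1 * (delta n θ + Real.pi / n) : ℝ) * I) * (S.v 4 - S.v 3)
      have hx0 : (x : ℂ) ≠ 0 := by exact_mod_cast hx.ne'
      have e : exp (((delta n θ + Real.pi / n : ℝ) : ℂ) * I) *
          exp ((-delta n θ : ℝ) * I) = S.b := by
        rw [add, hb]; congr 3; ring
      rw [← neg_sub, h32, hDE, ← hw, ← e, one_mul]
      push_cast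
      field_simp
    · refine ⟨x, hx, ?_⟩
      change S.v 3 - S.v 4 = (x : ℝ) *
        exp ((1 * (3 * Real.pi / 2 - θ - delta n θ - Real.pi / n) : ℝ) * I) * (S.v 0 - S.v 4)
      rw [← neg_sub, hDE, v_zero, v_four, zero_sub, hb, one_mul, mul_assoc, mul_neg, add, add,
        neg (3 * Real.pi / 2 - θ - delta n θ - Real.pi / n + Real.pi / n)
          (Real.pi / 2 - θ + -delta n θ) (by ring)]
      ring

end Shape

/-! ### Every pentagon with the given angles and edges is congruent to the one in normal position -/

theorem eq_exp_mul_of_norm_eq {x y : ℂ} {r t : ℝ} (hr : 0 < r) (h : ‖x‖ = ‖y‖) (hy : y ≠ 0)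
    (e : x = r * exp ((t : ℂ) * I) * y) : x = exp ((t : ℂ) * I) * y := by
  have h1 := congrArg norm e
  rw [norm_mul, norm_mul, norm_exp_ofReal_mul_I, mul_one, norm_real, Real.norm_of_nonneg hr.le, h,
    eq_comm, mul_eq_right₀ (norm_ne_zero_iff.2 hy)] at h1
  rw [e, h1, ofReal_one, one_mul]

namespace Shape
variable {n : ℕ}

/-- A counterclockwise pentagon with equal edges `AB`, `BC`, `CD`, `EA` is determined by its angles
at `A`, `B` and `C` up to a rotation and a translation. -/
theorem exists_eq_add_mul (hn : 3 ≤ n) {θ r : ℝ} (hθ₀ : 0 < θ) (hθ₁ : θ < Real.pi) (hr : 0 < r)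
    {V : Fin 5 → ℂ} (hV : ‖V 1 - V 0‖ = r)
    (hA : V 4 - V 0 = exp ((2 * (Real.pi / n) : ℝ) * I) * (V 1 - V 0))
    (hB : V 0 - V 1 = exp ((Real.pi / 2 + θ : ℝ) * I) * (V 2 - V 1))
    (hC : V 1 - V 2 = exp ((Real.pi - 2 * (Real.pi / n) : ℝ) * I) * (V 3 - V 2)) :
    ∃ p u : ℂ, ‖u‖ = 1 ∧ ∀ i, V i = p + u * (ofAngle hn hθ₀ hθ₁ hr).v i := by
  set S := ofAngle hn hθ₀ hθ₁ hr with hS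
  have hr' : S.r = r := rfl
  have ha0 : S.a ≠ 0 := by
    rw [← norm_ne_zero_iff, norm_a]; exact hr.ne'
  have hw : S.w = exp ((Real.pi / 2 - θ : ℝ) * I) := rfl
  have hπ : exp ((Real.pi : ℝ) * I) = -1 := exp_pi_mul_I
  have add : ∀ s t : ℝ, exp ((s : ℂ) * I) * exp ((t : ℂ) * I) = exp (((s + t : ℝ) : ℂ) * I) := by
    intro s t; rw [← exp_add]; congr 1; push_cast; ring
  have hba : S.b = exp ((2 * (Real.pi / n) : ℝ) * I) * S.a := by
    rw [a_eq, b_eq, mul_left_comm, add]; congr 4; ring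
  obtain ⟨u, hu⟩ : ∃ u, V 1 - V 0 = u * S.a := ⟨(V 1 - V 0) / S.a, by field_simp⟩
  have h1 : V 1 = V 0 + u * S.a := by rw [← hu]; ring
  have hun : ‖u‖ = 1 := by
    rw [hu, norm_mul, norm_a, hr', mul_eq_right₀ hr.ne'] at hV
    exact hV
  have h21 : V 2 - V 1 = u * (S.a * S.w) := by
    have e : S.w * exp ((Real.pi / 2 + θ : ℝ) * I) = -1 := by
      rw [hw, add, ← hπ]; congr 3; ring
    rw [← neg_sub, hu] at hB
    linear_combination S.w * hB + (V 2 - V 1) * e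
  have h32 : V 3 - V 2 = u * (S.b * S.w) := by
    have e : exp ((2 * (Real.pi / n) : ℝ) * I) *
        exp ((Real.pi - 2 * (Real.pi / n) : ℝ) * I) = -1 := by
      rw [add, ← hπ]; congr 3; ring
    rw [← neg_sub, h21] at hC
    rw [hba]
    linear_combination exp ((2 * (Real.pi / n) : ℝ) * I) * hC + (V 3 - V 2) * e
  have h4 : V 4 = V 0 + u * S.b := by
    rw [hu] at hA
    rw [hba]
    linear_combination hA
  refine ⟨V 0, u, hun, fun i => ?_⟩
  fin_cases i
  · change V 0 = V 0 + u * 0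
    ring
  · exact h1
  · change V 2 = V 0 + u * (S.a + S.a * S.w)
    linear_combination h21 + h1
  · change V 3 = V 0 + u * (S.a + S.a * S.w + S.b * S.w)
    linear_combination h32 + h21 + h1
  · exact h4

/-- A pentagon that satisfies the conditions is the image of the pentagon in normal position under
an isometry, which is orientation-reversing if the vertices are listed clockwise. -/
theorem exists_eq_comp (hn : 3 ≤ n) {θ : ℝ} (hθ₀ : 0 < θ) (hθ₁ : θ < Real.pi) {V : Fin 5 → ℂ}
    (hV : SatisfiesConditions n θ V) : ∃ (S : Shape n) (J : ℂ ≃ᵢ ℂ), V = J ∘ S.v := by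
  obtain ⟨⟨hinj, -, -⟩, ⟨-, -, ε, hε, hang⟩, d1, d2, d3⟩ := hV
  have ne : ∀ {i j}, i ≠ j → V i - V j ≠ 0 := fun h => sub_ne_zero.2 (hinj.ne h)
  have hr : 0 < ‖V 1 - V 0‖ := norm_pos_iff.2 (ne (by decide))
  rw [dist_eq, dist_eq] at d1 d2 d3
  have e2 : 2 * Real.pi / n = 2 * (Real.pi / n) := by ring
  rw [e2] at hang
  obtain ⟨r0, hr0, hA⟩ := hang 0
  obtain ⟨r1, hr1, hB⟩ := hang 1
  obtain ⟨r2, hr2, hC⟩ := hang 2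
  have hA' : V 4 - V 0 = exp ((ε * (2 * (Real.pi / n)) : ℝ) * I) * (V 1 - V 0) :=
    eq_exp_mul_of_norm_eq hr0 (by rw [← d3, ← d2, ← d1, norm_sub_rev]) (ne (by decide)) hA
  have hB' : V 0 - V 1 = exp ((ε * (Real.pi / 2 + θ) : ℝ) * I) * (V 2 - V 1) :=
    eq_exp_mul_of_norm_eq hr1 (by rw [d1, norm_sub_rev]) (ne (by decide)) hB
  have hC' : V 1 - V 2 = exp ((ε * (Real.pi - 2 * (Real.pi / n)) : ℝ) * I) * (V 3 - V 2) :=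
    eq_exp_mul_of_norm_eq hr2 (by rw [d2, norm_sub_rev]) (ne (by decide)) hC
  rcases hε with rfl | rfl
  · rw [one_mul] at hA' hB' hC'
    obtain ⟨p, u, hu, h⟩ := exists_eq_add_mul hn hθ₀ hθ₁ hr rfl hA' hB' hC'
    exact ⟨_, motion false u p hu, funext h⟩
  · have hconj : ∀ t : ℝ, conj (exp (((-1 * t : ℝ) : ℂ) * I)) = exp ((t : ℂ) * I) := by
      intro t
      rw [← exp_conj]
      simp
    have hA'' := congrArg conj hA'
    have hB'' := congrArg conj hB'
    have hC'' := congrArg conj hC'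
    rw [map_mul, hconj, map_sub, map_sub] at hA'' hB'' hC''
    obtain ⟨p, u, hu, h⟩ := exists_eq_add_mul hn hθ₀ hθ₁ hr (V := fun i => conj (V i))
      (by rw [← map_sub, norm_conj]) hA'' hB'' hC''
    refine ⟨ofAngle hn hθ₀ hθ₁ hr, motion true (conj u) (conj p) (by rwa [norm_conj]),
      funext fun i => ?_⟩
    have := congrArg conj (h i)
    rw [conj_conj, map_add, map_mul] at this
    exact this

/-! ### The tiling by copies of a given pentagon -/

variable [NeZero n] (S : Shape n)

theorem tile_eq_image (J : ℂ ≃ᵢ ℂ) (τ : Idx n) :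
    S.tile τ = J.symm.trans (S.place τ) '' region (J ∘ S.v) := by
  rw [region_comp, ← Set.image_comp, tile]
  congr 1
  ext z
  simp

theorem isMonohedralTiling (J : ℂ ≃ᵢ ℂ) : IsMonohedralTiling (J ∘ S.v) (S.tiling (n := n)) := by
  refine ⟨?_, ?_, ?_⟩
  · rintro _ ⟨τ, rfl⟩
    exact ⟨_, S.tile_eq_image J τ⟩
  · refine Set.eq_univ_of_forall fun z => ?_
    obtain ⟨τ, hτ⟩ := S.exists_mem_tile (n := n) z
    exact ⟨_, ⟨τ, rfl⟩, hτ⟩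
  · rintro _ ⟨τ, rfl⟩ _ ⟨τ', rfl⟩ h
    exact S.disjoint_interior_tile fun e => h (by rw [e])

/-- A reflection that preserves the tiling fixes the centre, hence would be a rotation. -/
theorem not_isSymmetry_of_isLineReflection (hn : n ≠ 4) {g : ℂ ≃ᵢ ℂ} (hg : IsLineReflection g) :
    ¬ IsSymmetry g (S.tiling (n := n)) := by
  intro hsym
  obtain ⟨k, hk⟩ := S.eq_turn_of_isSymmetry (S.map_zero_of_isSymmetry hn hsym) hsym
  obtain ⟨p, u, hu, h⟩ := hg
  have hu0 : u ≠ 0 := by rintro rfl; simp at hu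
  have h0 := h 0
  have h1 := h 1
  have hI := h I
  rw [hk] at h0 h1 hI
  simp at h0 h1 hI
  have e1 : rot k = u ^ 2 := by linear_combination h1 - h0
  have e2 : rot k * I = -u ^ 2 * I := by linear_combination hI - h0
  have e3 : u ^ 2 * (2 * I) = 0 := by rw [e1] at e2; linear_combination e2
  simp [hu0] at e3

end Shape

theorem IsConvexPentagon.of_comp {V : Fin 5 → ℂ} {J : ℂ ≃ᵢ ℂ} (h : IsConvexPentagon (J ∘ V)) :
    IsConvexPentagon V := by
  have e : J.symm ∘ (J ∘ V) = V := by ext i; simp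
  refine ⟨?_, fun s x hx => h.2 s x ?_⟩
  · have := convex_image_isometry J.symm h.1
    rwa [← region_comp, e] at this
  · rw [Set.image_comp, ← image_convexHull_isometry]
    exact Set.mem_image_of_mem J hx

theorem IsEdgeToEdge.comp {V : Fin 5 → ℂ} {𝒯 : Set (Set ℂ)} (h : IsEdgeToEdge V 𝒯) (J : ℂ ≃ᵢ ℂ) :
    IsEdgeToEdge (J ∘ V) 𝒯 := by
  intro T hT T' hT' hne
  obtain ⟨g, g', e, e', h⟩ := h T hT T' hT' hne
  have key : ∀ g : ℂ ≃ᵢ ℂ, (J.symm.trans g) ∘ (J ∘ V) = g ∘ V := by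
    intro g; ext i; simp
  refine ⟨J.symm.trans g, J.symm.trans g', ?_, ?_, ?_⟩
  · rw [← region_comp, key, region_comp, e]
  · rw [← region_comp, key, region_comp, e']
  · rw [key, key]
    simpa using h

end PentagonTiling
end

theorem mainTheorem1 (n : ℕ) (hn : 3 ≤ n) (θ : ℝ) (hθ₀ : 0 < θ) (hθ₁ : θ < Real.pi) :
    (∃ V : Fin 5 → ℂ, PentagonTiling.SatisfiesConditions n θ V) ∧
    ∀ V : Fin 5 → ℂ, PentagonTiling.SatisfiesConditions n θ V →
      ∃ (𝒯 : Set (Set ℂ)) (O : ℂ),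
        PentagonTiling.IsMonohedralTiling V 𝒯 ∧
        PentagonTiling.HasCnSymmetryAt n O 𝒯 ∧
        {T ∈ 𝒯 | O ∈ T}.ncard = n ∧
        (∀ T ∈ 𝒯, O ∈ T →
          ∃ g : ℂ ≃ᵢ ℂ, T = g '' PentagonTiling.region V ∧ g (V 0) = O) ∧
        (n ≠ 4 → ∀ g : ℂ ≃ᵢ ℂ, PentagonTiling.IsLineReflection g →
          ¬ PentagonTiling.IsSymmetry g 𝒯) ∧
        (PentagonTiling.IsConvexPentagon V → PentagonTiling.IsEdgeToEdge V 𝒯) := by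
  have : NeZero n := ⟨by omega⟩
  refine ⟨⟨_, PentagonTiling.Shape.satisfiesConditions hn hθ₀ hθ₁⟩, fun V hV => ?_⟩
  obtain ⟨S, J, rfl⟩ := PentagonTiling.Shape.exists_eq_comp hn hθ₀ hθ₁ hV
  refine ⟨S.tiling, 0, S.isMonohedralTiling J, S.hasCnSymmetryAt, S.ncard_origin, ?_,
    fun hn4 g hg => S.not_isSymmetry_of_isLineReflection hn4 hg,
    fun hconv => (S.isEdgeToEdge hconv.of_comp).comp J⟩
  rintro _ ⟨τ, rfl⟩ hτ
  obtain ⟨k, rfl⟩ := (S.zero_mem_tile_iff τ).1 hτ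
  refine ⟨_, S.tile_eq_image J _, ?_⟩
  simp [PentagonTiling.Shape.place_origin, PentagonTiling.Shape.v_zero]
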